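/- Let $n\ge 0$ and let $P_n$ be the pure braid group on $n$ strands, i.e. the kernel of the homomorphism $B_n\to S_n$ from Artin's braid group to the symmetric group. Then $P_n$ is $\mathbb{Q}$-good. Here a group is called $\mathbb{Q}$-unipotent if it is nilpotent, uniquely divisible, and has finite-dimensional $H_1(-;\mathbb{Q})$. The $\mathbb{Q}$-completion of a group $G$ is the pro-group $G^\wedge=\{G_j\}_j$ (indexed by a small cofiltered category) consisting of $\mathbb{Q}$-unipotent groups, with a map of pro-groups $G\to\{G_j\}_j$ such that $\operatorname{colim}_j\operatorname{Hom}(G_j,N)\to\operatorname{Hom}(G,N)$ is bijective for every $\mathbb{Q}$-unipotent group $N$. The group $G$ is called $\mathbb{Q}$-good if it has a $\mathbb{Q}$-completion and the map of pro-spaces $BG\to B(G^\wedge)$ induces an isomorphism $$\operatorname{colim}_j H^i(BG_j;\mathbb{Q})\xrightarrow{\ \cong\ }H^i(BG;\mathbb{Q})\qquad\text{for all } i\ge 0.$$ Moreover, the $\mathbb{Q}$-completion of $P_n$ is given by the tower $\{(P_n/\Gamma^kP_n)\otimes\mathbb{Q}\}_{k\in\mathbb{N}}$, so that $$\operatorname{colim}_k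 H^i\bigl(B((P_n/\Gamma^kP_n)\otimes\mathbb{Q});\mathbb{Q}\bigr)\xrightarrow{\ \cong\ }H^i(BP_n;\mathbb{Q})\qquad\text{for all } i\ge 0,$$ where $\Gamma^k$ denotes the lower central series and $-\otimes\mathbb{Q}$ is the left adjoint of the inclusion of nilpotent uniquely divisible groups into nilpotent groups. -/

import Mathlib

open CategoryTheory Opposite

universe u

namespace QGoodness

open scoped commutatorElement

/-! ### Pure braid groups -/

/-- Artin's relations among the generators `σ₀, …, σ_{n-2}` of the braid group on `n` strands. -/
inductive IsBraidRelator (n : ℕ) : FreeGroup (Fin (n - 1)) → Prop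
  | comm (i j : Fin (n - 1)) (h : (i : ℕ) + 2 ≤ j) :
      IsBraidRelator n
        (FreeGroup.of i * FreeGroup.of j * (FreeGroup.of j * FreeGroup.of i)⁻¹)
  | braid (i j : Fin (n - 1)) (h : (i : ℕ) + 1 = j) :
      IsBraidRelator n
        (FreeGroup.of i * FreeGroup.of j * FreeGroup.of i *
          (FreeGroup.of j * FreeGroup.of i * FreeGroup.of j)⁻¹)

/-- The Artin braid group `B_n` on `n` strands. -/
abbrev BraidGroup (n : ℕ) : Type := PresentedGroup {r | IsBraidRelator n r}

/-- The transposition of the strands `i` and `i + 1`. -/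
def strandSwap (n : ℕ) (i : Fin (n - 1)) : Equiv.Perm (Fin n) :=
  Equiv.swap ⟨i, by omega⟩ ⟨i + 1, by omega⟩

theorem swap_braid {α : Type*} [DecidableEq α] {a b c : α} (hab : a ≠ b) (hac : a ≠ c)
    (hbc : b ≠ c) :
    Equiv.swap a b * Equiv.swap b c * Equiv.swap a b =
      Equiv.swap b c * Equiv.swap a b * Equiv.swap b c := by
  rw [Equiv.swap_mul_swap_mul_swap hab hac, Equiv.swap_comm a b, Equiv.swap_comm b c,
    Equiv.swap_mul_swap_mul_swap hbc.symm hac.symm, Equiv.swap_comm]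

theorem lift_strandSwap_eq_one (n : ℕ) (r : FreeGroup (Fin (n - 1)))
    (hr : r ∈ {r | IsBraidRelator n r}) : FreeGroup.lift (strandSwap n) r = 1 := by
  rcases hr with ⟨i, j, h⟩ | ⟨i, j, h⟩
  · simp only [map_mul, map_inv, FreeGroup.lift_apply_of]
    rw [mul_inv_eq_one]
    have hd : Equiv.Perm.Disjoint (strandSwap n i) (strandSwap n j) := by
      intro x
      by_cases hx : (x : ℕ) = i ∨ (x : ℕ) = i + 1
      · right
        apply Equiv.swap_apply_of_ne_of_ne <;> simp only [ne_eq, Fin.ext_iff] <;> omega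
      · left
        apply Equiv.swap_apply_of_ne_of_ne <;> simp only [ne_eq, Fin.ext_iff] <;> omega
    exact hd.commute.eq
  · simp only [map_mul, map_inv, FreeGroup.lift_apply_of]
    rw [mul_inv_eq_one]
    obtain ⟨i, hi⟩ := i
    obtain ⟨j, hj⟩ := j
    simp only at h
    subst h
    simp only [strandSwap]
    apply swap_braid
    · simp only [ne_eq, Fin.mk.injEq]; omega
    · simp only [ne_eq, Fin.mk.injEq]; omega
    · simp only [ne_eq, Fin.mk.injEq]; omega

/-- The underlying permutation of a braid, `σ_i ↦ (i  i+1)`. -/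
def braidPerm (n : ℕ) : BraidGroup n →* Equiv.Perm (Fin n) :=
  PresentedGroup.toGroup (lift_strandSwap_eq_one n)

/-- The pure braid group `P_n`: braids whose underlying permutation is trivial. -/
abbrev PureBraidGroup (n : ℕ) : Type := (braidPerm n).ker

/-! ### Uniquely divisible groups and `G ⊗ ℚ` -/

/-- Every element has exactly one `n`-th root, for each `n ≥ 1`. -/
def IsUniquelyDivisible (G : Type u) [Group G] : Prop :=
  ∀ n : ℕ, n ≠ 0 → Function.Bijective fun x : G => x ^ n

/-- The only subgroup of `A` which contains the image of `f` and is closed under roots is `A`. -/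
def IsRootDense {G A : Type u} [Group G] [Group A] (f : G →* A) : Prop :=
  ∀ K : Subgroup A, (∀ g, f g ∈ K) → (∀ (n : ℕ) (x : A), x ^ (n + 1) ∈ K → x ∈ K) → K = ⊤

theorem IsUniquelyDivisible.pow_inj {A : Type u} [Group A] (hA : IsUniquelyDivisible A) (n : ℕ)
    {x y : A} (h : x ^ (n + 1) = y ^ (n + 1)) : x = y :=
  (hA (n + 1) n.succ_ne_zero).1 h

theorem IsUniquelyDivisible.commute_of_pow {A : Type u} [Group A] (hA : IsUniquelyDivisible A)
    (n : ℕ) {x y : A} (h : Commute (x ^ (n + 1)) y) : Commute x y := by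
  have h1 : (y * x * y⁻¹) ^ (n + 1) = x ^ (n + 1) := by
    rw [conj_pow, ← h.eq, mul_inv_cancel_right]
  have h2 := hA.pow_inj n h1
  exact (mul_inv_eq_iff_eq_mul.mp h2).symm

theorem IsRootDense.mem_center {G A : Type u} [Group G] [Group A] {f : G →* A}
    (hA : IsUniquelyDivisible A) (hf : IsRootDense f) {z : A} (hz : ∀ g, Commute (f g) z) :
    z ∈ Subgroup.center A := by
  have hK : Subgroup.centralizer {z} = ⊤ := by
    apply hf
    · intro g
      rw [Subgroup.mem_centralizer_singleton_iff]
      exact (hz g).eq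
    · intro n x hx
      rw [Subgroup.mem_centralizer_singleton_iff] at hx ⊢
      exact (hA.commute_of_pow n hx).eq
  rw [Subgroup.mem_center_iff]
  intro g
  have hg : g ∈ Subgroup.centralizer {z} := hK ▸ Subgroup.mem_top g
  rw [Subgroup.mem_centralizer_singleton_iff] at hg
  exact hg

theorem IsUniquelyDivisible.quotient_center {A : Type u} [Group A] (hA : IsUniquelyDivisible A) :
    IsUniquelyDivisible (A ⧸ Subgroup.center A) := by
  intro n hn
  obtain ⟨n, rfl⟩ := Nat.exists_eq_succ_of_ne_zero hn
  constructor
  · intro x y h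
    obtain ⟨x, rfl⟩ := QuotientGroup.mk_surjective x
    obtain ⟨y, rfl⟩ := QuotientGroup.mk_surjective y
    change (x : A ⧸ Subgroup.center A) ^ (n + 1) = (y : A ⧸ Subgroup.center A) ^ (n + 1) at h
    rw [← QuotientGroup.mk_pow, ← QuotientGroup.mk_pow, QuotientGroup.eq] at h
    obtain ⟨w, hw⟩ := (hA (n + 1) n.succ_ne_zero).2 ((x ^ (n + 1))⁻¹ * y ^ (n + 1))
    change w ^ (n + 1) = _ at hw
    have hwc : ∀ a, Commute w a := fun a =>
      hA.commute_of_pow n (by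
        rw [hw]
        exact (Subgroup.mem_center_iff.mp h a).symm)
    have hxy : x * w = y := by
      apply hA.pow_inj n
      rw [(hwc x).symm.mul_pow, hw, mul_inv_cancel_left]
    rw [QuotientGroup.eq, ← hxy, inv_mul_cancel_left, Subgroup.mem_center_iff]
    exact fun a => (hwc a).symm.eq
  · intro x
    obtain ⟨x, rfl⟩ := QuotientGroup.mk_surjective x
    obtain ⟨w, hw⟩ := (hA (n + 1) n.succ_ne_zero).2 x
    exact ⟨w, congrArg _ hw⟩

theorem IsRootDense.isNilpotent (c : ℕ) {G A : Type u} [Group G] [Group A] {f : G →* A}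
    (hA : IsUniquelyDivisible A) (hf : IsRootDense f)
    (hc : ((⊤ : Subgroup G).lowerCentralSeries c).map f = ⊥) : Group.IsNilpotent A := by
  induction c generalizing A with
  | zero =>
    have hbot : (⊥ : Subgroup A) = ⊤ := by
      apply hf
      · intro g
        rw [← hc]
        exact Subgroup.mem_map_of_mem f (Subgroup.mem_top g)
      · intro n x hx
        rw [Subgroup.mem_bot] at hx ⊢
        exact hA.pow_inj n (by rw [hx, one_pow])
    have : Subsingleton A := Subgroup.subsingleton_iff.mp (subsingleton_of_bot_eq_top hbot)
    infer_instance
  | succ c ih =>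
    have hcen : ∀ x ∈ (⊤ : Subgroup G).lowerCentralSeries c, f x ∈ Subgroup.center A := by
      intro x hx
      apply hf.mem_center hA
      intro g
      have h1 : f ⁅x, g⁆ ∈ ((⊤ : Subgroup G).lowerCentralSeries (c + 1)).map f :=
        Subgroup.mem_map_of_mem f (Subgroup.commutator_mem_commutator hx (Subgroup.mem_top g))
      rw [hc, Subgroup.mem_bot, map_commutatorElement, commutatorElement_eq_one_iff_commute] at h1
      exact h1.symm
    have hq : Group.IsNilpotent (A ⧸ Subgroup.center A) := by
      apply ih (f := (QuotientGroup.mk' (Subgroup.center A)).comp f) hA.quotient_center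
      · intro K hK hr
        have h1 : K.comap (QuotientGroup.mk' (Subgroup.center A)) = ⊤ := by
          apply hf
          · exact hK
          · intro n x hx
            apply hr n
            rw [Subgroup.mem_comap, map_pow] at hx
            exact hx
        rw [← Subgroup.map_comap_eq_self_of_surjective
          (QuotientGroup.mk'_surjective (Subgroup.center A)) K, h1]
        exact Subgroup.map_top_of_surjective _ (QuotientGroup.mk'_surjective _)
      · rw [eq_bot_iff, Subgroup.map_le_iff_le_comap]
        intro x hx
        rw [Subgroup.mem_comap, Subgroup.mem_bot]
        exact (QuotientGroup.eq_one_iff _).mpr (hcen x hx)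
    exact Group.of_quotient_center_nilpotent hq

/-- Formal expressions in elements of `G`, group operations and roots; `root n x` stands for the
`(n + 1)`-st root of `x`. -/
inductive RatTerm (G : Type u) : Type u
  | of : G → RatTerm G
  | one : RatTerm G
  | mul : RatTerm G → RatTerm G → RatTerm G
  | inv : RatTerm G → RatTerm G
  | root : ℕ → RatTerm G → RatTerm G

/-- Formal powers. -/
def RatTerm.npow {G : Type u} : ℕ → RatTerm G → RatTerm G
  | 0, _ => .one
  | n + 1, x => .mul (RatTerm.npow n x) x

/-- The congruence generated by the group axioms, the multiplication of `G`, and the fact that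
`root n` is inverse to the `(n + 1)`-st power. -/
inductive RatTerm.Rel {G : Type u} [Group G] : RatTerm G → RatTerm G → Prop
  | refl (x) : Rel x x
  | symm {x y} : Rel x y → Rel y x
  | trans {x y z} : Rel x y → Rel y z → Rel x z
  | mul_congr {x x' y y'} : Rel x x' → Rel y y' → Rel (.mul x y) (.mul x' y')
  | inv_congr {x x'} : Rel x x' → Rel (.inv x) (.inv x')
  | root_congr (n : ℕ) {x x'} : Rel x x' → Rel (.root n x) (.root n x')
  | mul_assoc (x y z) : Rel (.mul (.mul x y) z) (.mul x (.mul y z))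
  | one_mul (x) : Rel (.mul .one x) x
  | inv_mul (x) : Rel (.mul (.inv x) x) .one
  | of_mul (g h : G) : Rel (.of (g * h)) (.mul (.of g) (.of h))
  | npow_root (n : ℕ) (x) : Rel (RatTerm.npow (n + 1) (.root n x)) x
  | root_npow (n : ℕ) (x) : Rel (.root n (RatTerm.npow (n + 1) x)) x

/-- The setoid of `RatTerm.Rel`. -/
def ratSetoid (G : Type u) [Group G] : Setoid (RatTerm G) where
  r := RatTerm.Rel
  iseqv := ⟨.refl, .symm, .trans⟩

/-- The universal uniquely divisible group under `G`. For nilpotent `G` this is `G ⊗ ℚ`, the value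
at `G` of the left adjoint of the inclusion of nilpotent uniquely divisible groups into nilpotent
groups: see `Rationalization.isUniquelyDivisible`, `Rationalization.isNilpotent` and
`Rationalization.existsUnique_lift`. -/
def Rationalization (G : Type u) [Group G] : Type u := Quotient (ratSetoid G)

namespace Rationalization

section Basic

variable {G : Type u} [Group G]

/-- The class of a formal expression. -/
def mk (x : RatTerm G) : Rationalization G := Quotient.mk (ratSetoid G) x

theorem mk_surjective : Function.Surjective (mk : RatTerm G → Rationalization G) :=
  Quotient.mk_surjective

theorem mk_eq {x y : RatTerm G} (h : RatTerm.Rel x y) : mk x = mk y := Quotient.sound h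

instance : Mul (Rationalization G) :=
  ⟨Quotient.map₂ RatTerm.mul fun _ _ h _ _ h' => RatTerm.Rel.mul_congr h h'⟩

instance : One (Rationalization G) := ⟨mk .one⟩

instance : Inv (Rationalization G) :=
  ⟨Quotient.map RatTerm.inv fun _ _ h => RatTerm.Rel.inv_congr h⟩

instance : Group (Rationalization G) :=
  Group.ofLeftAxioms
    (by
      rintro ⟨x⟩ ⟨y⟩ ⟨z⟩
      exact mk_eq (RatTerm.Rel.mul_assoc x y z))
    (by
      rintro ⟨x⟩
      exact mk_eq (RatTerm.Rel.one_mul x))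
    (by
      rintro ⟨x⟩
      exact mk_eq (RatTerm.Rel.inv_mul x))

theorem mk_one : mk (.one : RatTerm G) = 1 := rfl

theorem mk_mul (x y : RatTerm G) : mk (.mul x y) = mk x * mk y := rfl

theorem mk_inv (x : RatTerm G) : mk (.inv x) = (mk x)⁻¹ := rfl

theorem mk_npow (n : ℕ) (x : RatTerm G) : mk (RatTerm.npow n x) = mk x ^ n := by
  induction n with
  | zero => rw [pow_zero]; rfl
  | succ n ih => rw [pow_succ, ← ih]; rfl

/-- The canonical map `G → G ⊗ ℚ`. -/
def of : G →* Rationalization G :=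
  MonoidHom.mk' (fun g => mk (.of g)) fun g h => mk_eq (RatTerm.Rel.of_mul g h)

theorem mk_root_pow (n : ℕ) (x : RatTerm G) : mk (.root n x) ^ (n + 1) = mk x := by
  rw [← mk_npow]
  exact mk_eq (RatTerm.Rel.npow_root n x)

variable (G) in
theorem isUniquelyDivisible : IsUniquelyDivisible (Rationalization G) := by
  intro n hn
  obtain ⟨n, rfl⟩ := Nat.exists_eq_succ_of_ne_zero hn
  constructor
  · intro x y h
    obtain ⟨x, rfl⟩ := mk_surjective x
    obtain ⟨y, rfl⟩ := mk_surjective y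
    change mk x ^ (n + 1) = mk y ^ (n + 1) at h
    rw [← mk_npow, ← mk_npow] at h
    exact (mk_eq (RatTerm.Rel.root_npow n x)).symm.trans
      ((mk_eq (RatTerm.Rel.root_congr n (Quotient.exact h))).trans
        (mk_eq (RatTerm.Rel.root_npow n y)))
  · intro x
    obtain ⟨x, rfl⟩ := mk_surjective x
    exact ⟨mk (.root n x), mk_root_pow n x⟩

/-- `G ⊗ ℚ` is the root closure of the image of `G`. -/
theorem isRootDense_of : IsRootDense (of : G →* Rationalization G) := by
  intro K hof hroot
  rw [eq_top_iff]
  intro x _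
  obtain ⟨x, rfl⟩ := mk_surjective x
  induction x with
  | of g => exact hof g
  | one => exact K.one_mem
  | mul x y hx hy => exact K.mul_mem (hx trivial) (hy trivial)
  | inv x hx => exact K.inv_mem (hx trivial)
  | root n x hx =>
    apply hroot n
    rw [mk_root_pow]
    exact hx trivial

variable (G) in
theorem isNilpotent [Group.IsNilpotent G] : Group.IsNilpotent (Rationalization G) := by
  obtain ⟨c, hc⟩ := Subgroup.nilpotent_iff_lowerCentralSeries.mp ‹Group.IsNilpotent G›
  exact IsRootDense.isNilpotent c (isUniquelyDivisible G) isRootDense_of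
    (by rw [hc, Subgroup.map_bot])

end Basic

section Lift

variable {G N : Type u} [Group G] [Group N]

/-- Evaluation of formal expressions in a uniquely divisible group. -/
noncomputable def eval (hN : IsUniquelyDivisible N) (f : G →* N) : RatTerm G → N
  | .of g => f g
  | .one => 1
  | .mul x y => eval hN f x * eval hN f y
  | .inv x => (eval hN f x)⁻¹
  | .root n x => (Equiv.ofBijective _ (hN (n + 1) n.succ_ne_zero)).symm (eval hN f x)

theorem eval_npow (hN : IsUniquelyDivisible N) (f : G →* N) (n : ℕ) (x : RatTerm G) :
    eval hN f (RatTerm.npow n x) = eval hN f x ^ n := by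
  induction n with
  | zero => rw [pow_zero]; rfl
  | succ n ih => rw [pow_succ, ← ih]; rfl

theorem eval_eq_of_rel (hN : IsUniquelyDivisible N) (f : G →* N) {x y : RatTerm G}
    (h : RatTerm.Rel x y) : eval hN f x = eval hN f y := by
  induction h with
  | refl x => rfl
  | symm _ ih => exact ih.symm
  | trans _ _ ih ih' => exact ih.trans ih'
  | mul_congr _ _ ih ih' => simp only [eval, ih, ih']
  | inv_congr _ ih => simp only [eval, ih]
  | root_congr n _ ih => simp only [eval, ih]
  | mul_assoc x y z => simp only [eval, _root_.mul_assoc]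
  | one_mul x => simp only [eval, _root_.one_mul]
  | inv_mul x => simp only [eval, inv_mul_cancel]
  | of_mul g h => simp only [eval, map_mul]
  | npow_root n x =>
    rw [eval_npow]
    exact (Equiv.ofBijective _ (hN (n + 1) n.succ_ne_zero)).apply_symm_apply (eval hN f x)
  | root_npow n x =>
    change (Equiv.ofBijective _ (hN (n + 1) n.succ_ne_zero)).symm _ = _
    rw [eval_npow]
    exact (Equiv.ofBijective _ (hN (n + 1) n.succ_ne_zero)).symm_apply_apply (eval hN f x)

/-- The extension of `f : G → N` to `G ⊗ ℚ`, for `N` uniquely divisible. -/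
noncomputable def lift (hN : IsUniquelyDivisible N) (f : G →* N) : Rationalization G →* N :=
  MonoidHom.mk' (Quotient.lift (eval hN f) fun _ _ h => eval_eq_of_rel hN f h) (by
    rintro ⟨x⟩ ⟨y⟩
    rfl)

theorem lift_comp_of (hN : IsUniquelyDivisible N) (f : G →* N) : (lift hN f).comp of = f := rfl

theorem hom_ext (hN : IsUniquelyDivisible N) {f g : Rationalization G →* N}
    (h : f.comp of = g.comp of) : f = g := by
  have hK : f.eqLocus g = ⊤ := by
    apply isRootDense_of
    · exact fun x => DFunLike.congr_fun h x
    · intro n x hx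
      apply (hN (n + 1) n.succ_ne_zero).1
      change f (x ^ (n + 1)) = g (x ^ (n + 1)) at hx
      simpa using hx
  ext x
  have : x ∈ f.eqLocus g := hK ▸ Subgroup.mem_top x
  exact this

/-- The universal property of `G ⊗ ℚ`. -/
theorem existsUnique_lift (hN : IsUniquelyDivisible N) (f : G →* N) :
    ∃! g : Rationalization G →* N, g.comp of = f :=
  ⟨lift hN f, lift_comp_of hN f, fun _ hg => hom_ext hN (hg.trans (lift_comp_of hN f).symm)⟩

end Lift

end Rationalization

/-! ### Completions and goodness -/

/-- A group is `ℚ`-unipotent if it is nilpotent and uniquely divisible, and `H₁(G; ℚ)` is finite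
dimensional. -/
structure IsQUnipotent (G : Type) [Group G] : Prop where
  nilpotent : Group.IsNilpotent G
  uniquelyDivisible : IsUniquelyDivisible G
  finite_H1 : FiniteDimensional ℚ (groupHomology (Rep.trivial ℚ G ℚ) 1)

/-- `Hⁱ(BG; ℚ)`: cohomology of `G` with trivial coefficients `ℚ`, computed by the inhomogeneous
cochains, which are the simplicial cochains of the nerve of `G`. -/
noncomputable def ratCohomology (i : ℕ) : GrpCat.{0}ᵒᵖ ⥤ ModuleCat.{0} ℚ where
  obj G := groupCohomology (Rep.trivial ℚ G.unop ℚ) i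
  map {G H} f := groupCohomology.map (A := Rep.trivial ℚ G.unop ℚ) (B := Rep.trivial ℚ H.unop ℚ)
    f.unop.hom (𝟙 (Rep.trivial ℚ H.unop ℚ)) i
  map_id _ := groupCohomology.map_id i
  map_comp {G H K} f g :=
    groupCohomology.map_comp (A := Rep.trivial ℚ G.unop ℚ) (B := Rep.trivial ℚ H.unop ℚ)
      (C := Rep.trivial ℚ K.unop ℚ) f.unop.hom g.unop.hom
      (𝟙 (Rep.trivial ℚ H.unop ℚ)) (𝟙 (Rep.trivial ℚ K.unop ℚ)) i

/-- A cone with apex `G` over a cofiltered diagram `X` of groups is a morphism of pro-groups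
`G ⟶ X`. It exhibits `X` as the `ℚ`-completion of `G` if every `X j` is `ℚ`-unipotent and
`colim_j Hom(X j, N) ⟶ Hom(G, N)` is bijective for every `ℚ`-unipotent group `N`. -/
structure IsQCompletion {J : Type} [SmallCategory J] {X : J ⥤ GrpCat.{0}} (c : Limits.Cone X) :
    Prop where
  isCofiltered : IsCofiltered J
  isQUnipotent (j : J) : IsQUnipotent (X.obj j)
  bijective (N : GrpCat.{0}) (hN : IsQUnipotent N) :
    Nonempty (Limits.IsColimit ((yoneda.obj N).mapCocone c.op))

/-- The morphism of pro-spaces `BG ⟶ {B (X j)}_j` induced by a cone with apex `G` is an isomorphism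
in rational cohomology: `colim_j Hⁱ(B (X j); ℚ) ⟶ Hⁱ(BG; ℚ)` is an isomorphism for every `i`. -/
def IsRatCohomologyIso {J : Type} [SmallCategory J] {X : J ⥤ GrpCat.{0}} (c : Limits.Cone X) :
    Prop :=
  ∀ i : ℕ, Nonempty (Limits.IsColimit ((ratCohomology i).mapCocone c.op))

/-- `G` is `ℚ`-good if it has a `ℚ`-completion `G^` and `BG ⟶ B(G^)` is an isomorphism in
rational cohomology, for whatever diagram is used to represent the pro-group `G^`. -/
def IsQGood (G : GrpCat.{0}) : Prop :=
  (∃ (J : Type) (_ : SmallCategory J) (X : J ⥤ GrpCat.{0})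
    (π : (Functor.const J).obj G ⟶ X), IsQCompletion (Limits.Cone.mk G π)) ∧
  ∀ (J : Type) [SmallCategory J] (X : J ⥤ GrpCat.{0})
    (π : (Functor.const J).obj G ⟶ X), IsQCompletion (Limits.Cone.mk G π) →
      IsRatCohomologyIso (Limits.Cone.mk G π)

/-- The quotient of `G` by the `k`-th term of its lower central series, which starts with `G`
in degree `0`. -/
abbrev LcsQuotient (G : Type u) [Group G] (k : ℕ) : Type u :=
  G ⧸ (⊤ : Subgroup G).lowerCentralSeries k

/-- The projection between quotients by terms of the lower central series. -/
def lcsProj (G : Type u) [Group G] {k l : ℕ} (h : l ≤ k) : LcsQuotient G k →* LcsQuotient G l :=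
  QuotientGroup.map _ _ (MonoidHom.id G) (Subgroup.lowerCentralSeries_antitone ⊤ h)

/-- The map `G → (G/Γᵏ G) ⊗ ℚ`. -/
def toMalcev (G : Type u) [Group G] (k : ℕ) : G →* Rationalization (LcsQuotient G k) :=
  Rationalization.of.comp (QuotientGroup.mk' _)

/-- The transition map `(G/Γᵏ G) ⊗ ℚ → (G/Γˡ G) ⊗ ℚ` for `l ≤ k`. -/
noncomputable def malcevTransition (G : Type u) [Group G] {k l : ℕ} (h : l ≤ k) :
    Rationalization (LcsQuotient G k) →* Rationalization (LcsQuotient G l) :=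
  Rationalization.lift (Rationalization.isUniquelyDivisible _)
    (Rationalization.of.comp (lcsProj G h))

theorem malcevTransition_comp_toMalcev (G : Type u) [Group G] {k l : ℕ} (h : l ≤ k) :
    (malcevTransition G h).comp (toMalcev G k) = toMalcev G l := rfl

theorem malcevTransition_ext (G : Type u) [Group G] {k l : ℕ}
    {f g : Rationalization (LcsQuotient G k) →* Rationalization (LcsQuotient G l)}
    (h : f.comp (toMalcev G k) = g.comp (toMalcev G k)) : f = g :=
  Rationalization.hom_ext (Rationalization.isUniquelyDivisible _)
    (QuotientGroup.monoidHom_ext _ h)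

/-- The pro-group `{(G/Γᵏ G) ⊗ ℚ}_k`. -/
noncomputable def malcevTower (G : Type) [Group G] : ℕᵒᵖ ⥤ GrpCat.{0} where
  obj k := GrpCat.of (Rationalization (LcsQuotient G k.unop))
  map f := GrpCat.ofHom (malcevTransition G (leOfHom f.unop))
  map_id k := by
    ext1
    exact malcevTransition_ext G (malcevTransition_comp_toMalcev G le_rfl)
  map_comp {k l m} f g := by
    ext1
    apply malcevTransition_ext G
    change (malcevTransition G _).comp (toMalcev G k.unop) =
      (malcevTransition G _).comp ((malcevTransition G _).comp (toMalcev G k.unop))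
    simp only [malcevTransition_comp_toMalcev]

/-- The map of pro-groups `G ⟶ {(G/Γᵏ G) ⊗ ℚ}_k`. -/
noncomputable def malcevCone (G : Type) [Group G] : Limits.Cone (malcevTower G) where
  pt := GrpCat.of G
  π :=
    { app := fun k => GrpCat.ofHom (toMalcev G k.unop)
      naturality := fun k l f => by
        ext1
        exact (malcevTransition_comp_toMalcev G (leOfHom f.unop)).symm }

end QGoodness

/-! A function from a group `G` to a rational vector space is polynomial if some power of the
augmentation ideal kills it. All functions on `G` form a coinduced, hence acyclic, module. Call `G`
good (`IsPolGood`) if the polynomial functions `G → V` are acyclic too, for every `V`. The proof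
rests on two facts about this notion.

Good groups have polynomial cohomology. If `G` is good and the root closure of a finite set, the
polynomial cochains on the powers of `G` compute `Hⁱ(G; ℚ)` (`exists_sub_trivD_mem_pol`). Indeed,
both complexes become contractible after coinduction, the same homotopy works for both, and all
coinduced terms are acyclic. A polynomial of degree less than `k` on a power of `G` is invariant
under `Γᵏ` and extends uniquely to the same power of `(G/Γᵏ G) ⊗ ℚ` (`exists_polDeg_malcev`). So
polynomial cochains on `G` are the union of those on the Malcev tower. When the stages of the tower
are good as well, passing to cohomology gives the isomorphism (`isRatCohomologyIso_malcevCone`).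

The relevant groups are good. By a Hochschild-Serre argument (`acyclic_of_extension`), goodness of
an extension follows from goodness of the quotient and acyclicity of the polynomial functions over
the kernel. For a central kernel which is the root closure of one element, this is discrete
integration of polynomials along a polynomial coordinate (`isPolGood_of_central`). Iteration covers
the stages of the Malcev tower (`isPolGood_malcev`). For a finite rank free kernel in a semidirect
product acting trivially on the abelianization of the kernel, a crossed homomorphism has an explicit
polynomial primitive (`isPolGood_semidirectProduct`), and there is no cohomology above degree one.

Finally `P_{n+1} ≅ F_n ⋊ P_n` is such a product (`pureBraidDecomposition_bijective`), so induction
makes every `P_n` good. The decomposition is purely algebraic. Artin's action defines `F_n ⋊ B_n →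
B_{n+1}`. The coset representatives `τ_j` of its image give a homomorphism from `B_{n+1}` to a
wreath product, whose component at the last strand is a left inverse.

Acyclicity is expressed without derived functors: `W` is acyclic if it lies in a class of modules
with vanishing `H¹` that is closed under `W ↦ Fun(G, W) / W`. -/

namespace QGoodness

/-! ### Crossed homomorphisms and acyclic representations -/

section Acyclic

variable {G : Type} [Group G]
variable {W : Type} [AddCommGroup W] [Module ℚ W]

/-- Crossed homomorphisms. -/
def IsCrossed (ρ : Representation ℚ G W) (c : G → W) : Prop :=
  ∀ g h, c (g * h) = c g + ρ g (c h)

theorem IsCrossed.map_one {ρ : Representation ℚ G W} {c : G → W} (hc : IsCrossed ρ c) :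
    c 1 = 0 := by
  have := hc 1 1
  simpa using this

theorem IsCrossed.map_inv {ρ : Representation ℚ G W} {c : G → W} (hc : IsCrossed ρ c) (g : G) :
    c g⁻¹ = -ρ g⁻¹ (c g) := by
  have := hc g⁻¹ g
  rw [inv_mul_cancel, hc.map_one] at this
  exact eq_neg_of_add_eq_zero_left this.symm

/-- The elements where a crossed homomorphism takes values in an invariant submodule. -/
def IsCrossed.preimage {ρ : Representation ℚ G W} {c : G → W} (hc : IsCrossed ρ c)
    (D : Submodule ℚ W) (hD : ∀ g, ∀ w ∈ D, ρ g w ∈ D) : Subgroup G where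
  carrier := {g | c g ∈ D}
  one_mem' := by
    change c 1 ∈ D
    rw [hc.map_one]; exact D.zero_mem
  mul_mem' {g h} hg hh := by
    change c (g * h) ∈ D
    rw [hc]; exact D.add_mem hg (hD _ _ hh)
  inv_mem' {g} hg := by
    change c g⁻¹ ∈ D
    rw [hc.map_inv]; exact D.neg_mem (hD _ _ hg)

/-- Every crossed homomorphism is principal, that is, `H¹(G; W) = 0`. -/
def H1Vanishes (ρ : Representation ℚ G W) : Prop :=
  ∀ c, IsCrossed ρ c → ∃ w, ∀ g, c g = ρ g w - w

variable (G) in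
/-- The action of `G` on functions on `G` by right translation. -/
def translation (V : Type) [AddCommGroup V] [Module ℚ V] : Representation ℚ G (G → V) where
  toFun g :=
    { toFun := fun f x => f (x * g)
      map_add' := fun _ _ => rfl
      map_smul' := fun _ _ => rfl }
  map_one' := by ext; simp
  map_mul' g h := by ext; simp [mul_assoc]

@[simp]
theorem translation_apply {V : Type} [AddCommGroup V] [Module ℚ V] (g : G) (f : G → V) (x : G) :
    translation G V g f x = f (x * g) := rfl

/-- The orbit map embeds a representation into a coinduced one. -/
def orbitMap (ρ : Representation ℚ G W) : W →ₗ[ℚ] G → W where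
  toFun w x := ρ x w
  map_add' _ _ := by ext; simp
  map_smul' _ _ := by ext; simp

@[simp]
theorem orbitMap_apply (ρ : Representation ℚ G W) (w : W) (x : G) : orbitMap ρ w x = ρ x w := rfl

theorem translation_orbitMap (ρ : Representation ℚ G W) (g : G) (w : W) :
    translation G W g (orbitMap ρ w) = orbitMap ρ (ρ g w) := by
  ext x; simp

theorem orbitMap_injective (ρ : Representation ℚ G W) : Function.Injective (orbitMap ρ) := by
  intro v w h
  simpa using congrFun h 1

/-- The representation on a quotient by an invariant submodule. -/
def quotientRep (ρ : Representation ℚ G W) (D : Submodule ℚ W)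
    (hD : ∀ g, ∀ w ∈ D, ρ g w ∈ D) : Representation ℚ G (W ⧸ D) where
  toFun g := D.mapQ D (ρ g) fun w hw => hD g w hw
  map_one' := by ext; simp
  map_mul' g h := by ext; simp

/-- The representation on an invariant submodule. -/
def subRep (ρ : Representation ℚ G W) (D : Submodule ℚ W)
    (hD : ∀ g, ∀ w ∈ D, ρ g w ∈ D) : Representation ℚ G D where
  toFun g := (ρ g).restrict fun w hw => hD g w hw
  map_one' := by ext; simp
  map_mul' g h := by ext; simp

theorem translation_mem_range_orbitMap (ρ : Representation ℚ G W) (g : G) :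
    ∀ w ∈ LinearMap.range (orbitMap ρ), translation G W g w ∈ LinearMap.range (orbitMap ρ) := by
  rintro _ ⟨w, rfl⟩
  exact ⟨ρ g w, (translation_orbitMap ρ g w).symm⟩

/-- The dimension shift `Fun(G, W) / W` of `W`. -/
def shift (ρ : Representation ℚ G W) :
    Representation ℚ G ((G → W) ⧸ LinearMap.range (orbitMap ρ)) :=
  quotientRep (translation G W) _ (translation_mem_range_orbitMap ρ)

/-- A class of representations with vanishing `H¹` which is closed under dimension shift. -/
def IsAcyclicClass
    (P : ∀ (W : Type) [AddCommGroup W] [Module ℚ W], Representation ℚ G W → Prop) : Prop :=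
  ∀ (W : Type) [AddCommGroup W] [Module ℚ W] (ρ : Representation ℚ G W),
    P W ρ → H1Vanishes ρ ∧ P _ (shift ρ)

/-- `Hⁱ(G; W) = 0` for all `i ≥ 1`, expressed by means of dimension shift. -/
def Acyclic (ρ : Representation ℚ G W) : Prop :=
  ∃ P : ∀ (W : Type) [AddCommGroup W] [Module ℚ W], Representation ℚ G W → Prop,
    IsAcyclicClass P ∧ P W ρ

theorem Acyclic.h1Vanishes {ρ : Representation ℚ G W} (h : Acyclic ρ) : H1Vanishes ρ := by
  obtain ⟨P, hP, h⟩ := h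
  exact (hP _ ρ h).1

theorem Acyclic.shift {ρ : Representation ℚ G W} (h : Acyclic ρ) : Acyclic (shift ρ) := by
  obtain ⟨P, hP, h⟩ := h
  exact ⟨P, hP, (hP _ ρ h).2⟩

/-- Short exact sequences of representations. -/
structure IsShortExact {A B C : Type} [AddCommGroup A] [Module ℚ A] [AddCommGroup B] [Module ℚ B]
    [AddCommGroup C] [Module ℚ C] (ρA : Representation ℚ G A) (ρB : Representation ℚ G B)
    (ρC : Representation ℚ G C) (f : A →ₗ[ℚ] B) (p : B →ₗ[ℚ] C) : Prop where
  inj : Function.Injective f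
  surj : Function.Surjective p
  comp_eq_zero : ∀ a, p (f a) = 0
  exact : ∀ b, p b = 0 → ∃ a, f a = b
  equivariant_left : ∀ g a, f (ρA g a) = ρB g (f a)
  equivariant_right : ∀ g b, p (ρB g b) = ρC g (p b)

/-! ### Short exact sequences and acyclicity -/

section TwoOfThree

variable {A B C : Type} [AddCommGroup A] [Module ℚ A] [AddCommGroup B] [Module ℚ B]
  [AddCommGroup C] [Module ℚ C] {ρA : Representation ℚ G A} {ρB : Representation ℚ G B}
  {ρC : Representation ℚ G C} {f : A →ₗ[ℚ] B} {p : B →ₗ[ℚ] C}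

/-- The map of dimension shifts induced by an equivariant map. -/
def shiftMap (ρA : Representation ℚ G A) (ρB : Representation ℚ G B) (f : A →ₗ[ℚ] B)
    (hf : ∀ g a, f (ρA g a) = ρB g (f a)) :
    ((G → A) ⧸ LinearMap.range (orbitMap ρA)) →ₗ[ℚ]
      ((G → B) ⧸ LinearMap.range (orbitMap ρB)) :=
  Submodule.mapQ _ _ (f.compLeft G) (by
    rintro _ ⟨a, rfl⟩
    exact ⟨f a, by ext x; simp [hf]⟩)

/-- The nine lemma for the sequences `0 → W → Fun(G, W) → Fun(G, W) / W → 0`. -/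
theorem IsShortExact.shift (h : IsShortExact ρA ρB ρC f p) :
    IsShortExact (shift ρA) (shift ρB) (shift ρC)
      (shiftMap ρA ρB f h.equivariant_left) (shiftMap ρB ρC p h.equivariant_right) where
  inj := by
    rw [injective_iff_map_eq_zero]
    intro F hF
    obtain ⟨F, rfl⟩ := Submodule.mkQ_surjective _ F
    obtain ⟨b, hb⟩ := (Submodule.Quotient.mk_eq_zero _).mp hF
    refine (Submodule.Quotient.mk_eq_zero _).mpr ⟨F 1, ?_⟩
    ext x
    apply h.inj
    have h1 : b = f (F 1) := by simpa using congrFun hb 1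
    have h2 : ρB x b = f (F x) := congrFun hb x
    rw [← h2, h1, orbitMap_apply, h.equivariant_left]
  surj := by
    intro F
    obtain ⟨F, rfl⟩ := Submodule.mkQ_surjective _ F
    choose s hs using h.surj
    refine ⟨Submodule.mkQ _ fun x => s (F x), congrArg (Submodule.mkQ _) ?_⟩
    ext x
    exact hs (F x)
  comp_eq_zero := by
    intro F
    obtain ⟨F, rfl⟩ := Submodule.mkQ_surjective _ F
    refine (Submodule.Quotient.mk_eq_zero _).mpr ⟨0, ?_⟩
    ext x
    simp [h.comp_eq_zero]
  exact := by
    intro F hF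
    obtain ⟨F, rfl⟩ := Submodule.mkQ_surjective _ F
    obtain ⟨c, hc⟩ := (Submodule.Quotient.mk_eq_zero _).mp hF
    obtain ⟨b, rfl⟩ := h.surj c
    have h1 : ∀ x, ∃ a, f a = F x - ρB x b := by
      intro x
      apply h.exact
      have h2 : ρC x (p b) = p (F x) := congrFun hc x
      rw [map_sub, h.equivariant_right, h2, sub_self]
    choose a ha using h1
    refine ⟨Submodule.mkQ _ a, ?_⟩
    change Submodule.mkQ _ _ = Submodule.mkQ _ F
    rw [← sub_eq_zero, ← map_sub]
    refine (Submodule.Quotient.mk_eq_zero _).mpr ⟨-b, ?_⟩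
    ext x
    simp [ha]
  equivariant_left := by
    intro g F
    obtain ⟨F, rfl⟩ := Submodule.mkQ_surjective _ F
    rfl
  equivariant_right := by
    intro g F
    obtain ⟨F, rfl⟩ := Submodule.mkQ_surjective _ F
    rfl

/-- The segment `H¹(B) → H¹(C) → H²(A)` of the long exact sequence, with `H²(A)` replaced by `H¹` of
the dimension shift of `A`. -/
theorem IsShortExact.h1Vanishes (h : IsShortExact ρA ρB ρC f p)
    (hA : H1Vanishes (QGoodness.shift ρA))
    (hB : H1Vanishes ρB) : H1Vanishes ρC := by
  intro c hc
  choose s hs using h.surj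
  set φ : G → B := fun x => s (c x) with hφ
  have hpφ : ∀ x, p (φ x) = c x := fun x => hs _
  have h1 : ∀ g, ∃ α : G → A, ∀ x, f (α x) = φ (x * g) - φ x - ρB x (φ g) := by
    intro g
    have h2 : ∀ x, ∃ a, f a = φ (x * g) - φ x - ρB x (φ g) := by
      intro x
      apply h.exact
      rw [map_sub, map_sub, h.equivariant_right, hpφ, hpφ, hpφ, hc x g]
      abel
    exact ⟨fun x => (h2 x).choose, fun x => (h2 x).choose_spec⟩
  -- The defect `α g` of the set-theoretic lift `φ` is a crossed homomorphism only modulo orbit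
  -- maps, that is, with values in the dimension shift of `A`.
  choose α hα using h1
  obtain ⟨F, hF⟩ := hA (fun g => Submodule.mkQ _ (α g)) (by
    intro g k
    change Submodule.mkQ _ _ = Submodule.mkQ _ _ + Submodule.mkQ _ (translation G A g (α k))
    rw [← sub_eq_zero, ← map_add, ← map_sub]
    have h3 : ∃ a, f a = φ g + ρB g (φ k) - φ (g * k) := by
      apply h.exact
      rw [map_sub, map_add, h.equivariant_right, hpφ, hpφ, hpφ, hc g k, sub_self]
    obtain ⟨a, ha⟩ := h3
    refine (Submodule.Quotient.mk_eq_zero _).mpr ⟨a, ?_⟩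
    ext x
    apply h.inj
    simp only [orbitMap_apply, h.equivariant_left, ha, Pi.sub_apply, Pi.add_apply,
      translation_apply, map_sub, map_add, hα, map_mul, Module.End.mul_apply, mul_assoc]
    abel)
  obtain ⟨F, rfl⟩ := Submodule.mkQ_surjective _ F
  have h4 : ∀ g, ∃ a : A, ∀ x, ρA x a = α g x - (F (x * g) - F x) := by
    intro g
    have h5 := hF g
    change Submodule.mkQ _ _ = Submodule.mkQ _ (translation G A g F) - Submodule.mkQ _ F at h5
    rw [← sub_eq_zero, ← map_sub, ← map_sub] at h5
    obtain ⟨a, ha⟩ := (Submodule.Quotient.mk_eq_zero _).mp h5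
    exact ⟨a, fun x => congrFun ha x⟩
  choose a ha using h4
  -- With `ψ = φ - f ∘ F`, the corrected lift at `g` is `ψ g - ψ 1`, and `x` moves it to `ψ (x * g)
  -- - ψ x`. The crossed homomorphism identity then telescopes.
  have h6 : ∀ g x, ρB x (φ g + f (a g)) = (φ (x * g) - f (F (x * g))) - (φ x - f (F x)) := by
    intro g x
    rw [map_add, ← h.equivariant_left, ha, map_sub, map_sub, hα]
    abel
  obtain ⟨b, hb⟩ := hB (fun g => φ g + f (a g)) (by
    intro g k
    have h7 := h6 (g * k) 1
    have h8 := h6 g 1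
    have h9 := h6 k g
    simp only [map_one, one_mul, Module.End.one_apply] at h7 h8
    change φ (g * k) + f (a (g * k)) = φ g + f (a g) + ρB g (φ k + f (a k))
    rw [h7, h8, h9]
    abel)
  refine ⟨p b, fun g => ?_⟩
  have := congrArg p (hb g)
  rw [map_add, hpφ, h.comp_eq_zero, add_zero, map_sub, h.equivariant_right] at this
  exact this

/-- The third terms of short exact sequences with acyclic first two terms form a class closed under
dimension shift, because shifting preserves exactness. -/
theorem IsShortExact.acyclic (h : IsShortExact ρA ρB ρC f p) (hA : Acyclic ρA) (hB : Acyclic ρB) :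
    Acyclic ρC := by
  refine ⟨fun C _ _ ρC => ∃ (A B : Type) (_ : AddCommGroup A) (_ : Module ℚ A)
    (_ : AddCommGroup B) (_ : Module ℚ B) (ρA : Representation ℚ G A) (ρB : Representation ℚ G B)
    (f : A →ₗ[ℚ] B) (p : B →ₗ[ℚ] C), IsShortExact ρA ρB ρC f p ∧ Acyclic ρA ∧ Acyclic ρB, ?_, ?_⟩
  · rintro C _ _ ρC ⟨A, B, _, _, _, _, ρA, ρB, f, p, h, hA, hB⟩
    exact ⟨h.h1Vanishes hA.shift.h1Vanishes hB.h1Vanishes,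
      _, _, _, _, _, _, _, _, _, _, h.shift, hA.shift, hB.shift⟩
  · exact ⟨A, B, _, _, _, _, ρA, ρB, f, p, h, hA, hB⟩

end TwoOfThree

/-! ### Coinduced representations -/

/-- `W` is an equivariant direct summand of `Fun(G, W)`. -/
def IsRelInjective (ρ : Representation ℚ G W) : Prop :=
  ∃ r : (G → W) →ₗ[ℚ] W, (∀ g F, r (translation G W g F) = ρ g (r F)) ∧ ∀ w, r (orbitMap ρ w) = w

/-- Regarded as an element of `Fun(G, W)`, a crossed homomorphism `c` has increment `x ↦ ρ x (c g)`
along `g`, which is the orbit map of `c g`. The retraction `r` turns this into `c g = ρ g (r c) - r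
c`. -/
theorem IsRelInjective.h1Vanishes {ρ : Representation ℚ G W} (h : IsRelInjective ρ) :
    H1Vanishes ρ := by
  obtain ⟨r, hr, hr'⟩ := h
  intro c hc
  refine ⟨r c, fun g => ?_⟩
  rw [← hr, ← map_sub, ← hr' (c g)]
  congr 1
  ext x
  simp [hc x g]

theorem IsRelInjective.shift {ρ : Representation ℚ G W} (h : IsRelInjective ρ) :
    IsRelInjective (shift ρ) := by
  obtain ⟨r, hr, hr'⟩ := h
  -- The retraction splits the quotient map: `e` identifies `Fun(G, W) / W` with the kernel of `r`.
  -- A function `Φ` on `G` with values in the quotient is then retracted to the class of `x ↦ e (Φ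
  -- x) 1`.
  let e : ((G → W) ⧸ LinearMap.range (orbitMap ρ)) →ₗ[ℚ] G → W :=
    Submodule.liftQ _ (LinearMap.id - (orbitMap ρ).comp r) (by
      rintro _ ⟨w, rfl⟩
      simp [hr'])
  have he : ∀ F, e (Submodule.mkQ _ F) = F - orbitMap ρ (r F) := fun F => rfl
  let ev : (G → G → W) →ₗ[ℚ] G → W :=
    { toFun := fun Φ x => Φ x 1
      map_add' := fun _ _ => rfl
      map_smul' := fun _ _ => rfl }
  refine ⟨(Submodule.mkQ (LinearMap.range (orbitMap ρ))).comp (ev.comp (e.compLeft G)), ?_, ?_⟩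
  · intro g F
    rfl
  · intro F
    obtain ⟨F, rfl⟩ := Submodule.mkQ_surjective _ F
    have h1 : ev (e.compLeft G (orbitMap (QGoodness.shift ρ) (Submodule.mkQ _ F))) =
        F - orbitMap ρ (r F) := by
      ext x
      change e (Submodule.mkQ _ (translation G W x F)) 1 = _
      rw [he]
      simp [hr]
    refine Eq.trans (congrArg (Submodule.mkQ (LinearMap.range (orbitMap ρ))) h1) ?_
    rw [map_sub, sub_eq_self]
    exact (Submodule.Quotient.mk_eq_zero _).mpr ⟨_, rfl⟩

theorem IsRelInjective.acyclic {ρ : Representation ℚ G W} (h : IsRelInjective ρ) : Acyclic ρ :=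
  ⟨fun _ _ _ ρ => IsRelInjective ρ, fun _ _ _ _ h => ⟨h.h1Vanishes, h.shift⟩, h⟩

/-- Functions on a set with a free action of `G` are acyclic. -/
theorem acyclic_of_free {X V : Type} [AddCommGroup V] [Module ℚ V]
    (σ : Representation ℚ G (X → V)) (a : X → G → X) (ha : ∀ x g h, a x (g * h) = a (a x g) h)
    (hσ : ∀ g f x, σ g f x = f (a x g)) (s : X → G) (hs : ∀ x g, s (a x g) = s x * g) :
    Acyclic σ := by
  apply IsRelInjective.acyclic
  -- The set `X` is a union of free orbits, and `s x` is the coordinate of `x` in its orbit. The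
  -- retraction evaluates `Φ` at this coordinate and at the base point of the orbit.
  refine ⟨{ toFun := fun Φ x => Φ (s x) (a x (s x)⁻¹)
            map_add' := fun _ _ => rfl
            map_smul' := fun _ _ => rfl }, ?_, ?_⟩
  · intro g F
    ext x
    simp [hσ, hs, ← ha]
  · intro w
    ext x
    have h1 : w (a x 1) = w x := by
      rw [← hσ 1 w x, map_one]; rfl
    simp [hσ, ← ha, h1]

theorem acyclic_translation (V : Type) [AddCommGroup V] [Module ℚ V] :
    Acyclic (translation G V) :=
  acyclic_of_free _ (fun x g => x * g) (fun _ _ _ => (mul_assoc _ _ _).symm) (fun _ _ _ => rfl) id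
    fun _ _ => rfl

/-- Right multiplication by `N` on `G` is a free action. A coordinate on each left coset comes from
a choice of coset representatives. -/
theorem acyclic_translation_comp {N : Type} [Group N] (f : N →* G) (hf : Function.Injective f)
    (V : Type) [AddCommGroup V] [Module ℚ V] :
    Acyclic ((translation G V).comp f) := by
  have h1 : ∀ x : G, ∃ n : N, x = (x : G ⧸ f.range).out * f n := by
    intro x
    obtain ⟨⟨_, n, rfl⟩, hn⟩ := QuotientGroup.mk_out_eq_mul f.range x
    refine ⟨n⁻¹, ?_⟩
    rw [hn]
    simp
  choose s hs using h1
  refine acyclic_of_free _ (fun x n => x * f n) (fun _ _ _ => by rw [map_mul, mul_assoc])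
    (fun _ _ _ => rfl) s fun x n => ?_
  have h2 : ((x * f n : G) : G ⧸ f.range) = x := by
    rw [QuotientGroup.eq]
    exact ⟨n⁻¹, by simp⟩
  apply hf
  have h3 := hs (x * f n)
  rw [h2] at h3
  nth_rewrite 1 [hs x] at h3
  rw [mul_assoc] at h3
  rw [map_mul]
  exact (mul_left_cancel h3).symm

/-! ### Isomorphisms -/

theorem acyclic_of_subsingleton [Subsingleton W] (ρ : Representation ℚ G W) : Acyclic ρ := by
  apply IsRelInjective.acyclic
  exact ⟨0, fun _ _ => Subsingleton.elim _ _, fun _ => Subsingleton.elim _ _⟩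

/-- An isomorphism is a short exact sequence with zero first term. -/
theorem Acyclic.of_equiv {W' : Type} [AddCommGroup W'] [Module ℚ W'] {ρ : Representation ℚ G W}
    {ρ' : Representation ℚ G W'} (h : Acyclic ρ) (e : W ≃ₗ[ℚ] W')
    (he : ∀ g w, e (ρ g w) = ρ' g (e w)) : Acyclic ρ' := by
  refine IsShortExact.acyclic (ρA := (1 : Representation ℚ G PUnit)) (ρB := ρ) (f := 0)
    (p := e.toLinearMap) ?_ (acyclic_of_subsingleton _) h
  exact ⟨Function.injective_of_subsingleton _, e.surjective, fun _ => by simp,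
    fun b hb => ⟨0, by
      rw [LinearEquiv.coe_coe, LinearEquiv.map_eq_zero_iff] at hb
      simp [hb]⟩, fun _ _ => by simp, he⟩

/-- The quotient by an acyclic subrepresentation. -/
theorem acyclic_quotientRep {ρ : Representation ℚ G W} (h : Acyclic ρ) (D : Submodule ℚ W)
    (hD : ∀ g, ∀ w ∈ D, ρ g w ∈ D) (hD' : Acyclic (subRep ρ D hD)) :
    Acyclic (quotientRep ρ D hD) := by
  refine IsShortExact.acyclic (f := D.subtype) (p := D.mkQ) ⟨D.injective_subtype,
    D.mkQ_surjective, ?_, ?_, fun _ _ => rfl, fun _ _ => rfl⟩ hD' h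
  · intro a
    simp
  · intro b hb
    exact ⟨⟨b, by simpa using hb⟩, rfl⟩

end Acyclic

end QGoodness

namespace QGoodness

/-! ### Free groups, extensions and unions -/

section

variable {G : Type} [Group G]
variable {W : Type} [AddCommGroup W] [Module ℚ W]

theorem IsCrossed.comp {N : Type} [Group N] {ρ : Representation ℚ G W} {c : G → W}
    (hc : IsCrossed ρ c) (f : N →* G) : IsCrossed (ρ.comp f) fun n => c (f n) := by
  intro n m
  change c (f (n * m)) = _
  rw [map_mul, hc]; rfl

/-- Crossed homomorphisms on a free group have arbitrary values on the generators. -/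
theorem exists_isCrossed_of_free {ι : Type} (ρ : Representation ℚ (FreeGroup ι) W) (v : ι → W) :
    ∃ c, IsCrossed ρ c ∧ ∀ i, c (FreeGroup.of i) = v i := by
  -- A crossed homomorphism is the translation part of an action by affine maps with linear part
  -- `ρ`. On a free group such an action is prescribed freely on the generators, and the orbit of
  -- `0` recovers the crossed homomorphism.
  let L : FreeGroup ι →* Equiv.Perm W := FreeGroup.lift fun i =>
    { toFun := fun w => ρ (FreeGroup.of i) w + v i
      invFun := fun w => ρ (FreeGroup.of i)⁻¹ (w - v i)
      left_inv := fun w => by simp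
      right_inv := fun w => by simp }
  have hL : ∀ g w, L g w = ρ g w + L g 0 := by
    intro g
    induction g using FreeGroup.induction_on with
    | C1 => simp
    | of i => intro w; simp [L]
    | inv_of i _ =>
      intro w
      rw [map_inv, Equiv.Perm.inv_eq_iff_eq]
      simp only [L, FreeGroup.lift_apply_of, Equiv.coe_fn_mk, map_add,
        Representation.self_inv_apply,
        add_assoc]
      rw [eq_comm, add_eq_left]
      simp
    | mul g h hg hh =>
      intro w
      rw [map_mul, Equiv.Perm.mul_apply, Equiv.Perm.mul_apply, hh, hg, hg (L h 0)]
      simp [add_assoc]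
  refine ⟨fun g => L g 0, ?_, fun i => by simp [L]⟩
  intro g h
  change L (g * h) 0 = _
  rw [map_mul, Equiv.Perm.mul_apply, hL g (L h 0), add_comm]

theorem IsCrossed.ext_of_free {ι : Type} {ρ : Representation ℚ (FreeGroup ι) W}
    {c c' : FreeGroup ι → W} (hc : IsCrossed ρ c) (hc' : IsCrossed ρ c')
    (h : ∀ i, c (FreeGroup.of i) = c' (FreeGroup.of i)) : c = c' := by
  ext g
  induction g using FreeGroup.induction_on with
  | C1 => rw [hc.map_one, hc'.map_one]
  | of i => exact h i
  | inv_of i ih => rw [hc.map_inv, hc'.map_inv, ih]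
  | mul g k hg hk => rw [hc, hc', hg, hk]

/-- Identifies `H¹` with the cokernel of `W → (ι → W)`. In this form the vanishing of `H¹` visibly
passes to quotients of `W`. -/
theorem h1Vanishes_free_iff {ι : Type} {ρ : Representation ℚ (FreeGroup ι) W} :
    H1Vanishes ρ ↔ ∀ v : ι → W, ∃ w, ∀ i, v i = ρ (FreeGroup.of i) w - w := by
  constructor
  · intro h v
    obtain ⟨c, hc, hv⟩ := exists_isCrossed_of_free ρ v
    obtain ⟨w, hw⟩ := h c hc
    exact ⟨w, fun i => by rw [← hv, hw]⟩
  · intro h c hc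
    obtain ⟨w, hw⟩ := h fun i => c (FreeGroup.of i)
    refine ⟨w, congrFun (hc.ext_of_free ?_ hw)⟩
    intro g k
    simp

/-- Free groups have cohomological dimension one. -/
theorem acyclic_of_freeGroup {ι : Type} {ρ : Representation ℚ (FreeGroup ι) W}
    (h : H1Vanishes ρ) : Acyclic ρ := by
  refine ⟨fun _ _ _ ρ => H1Vanishes ρ, fun W _ _ ρ h => ⟨h, h1Vanishes_free_iff.mpr fun v => ?_⟩, h⟩
  -- A dimension shift is a quotient of the coinduced module, whose `H¹` vanishes. Hence every
  -- dimension shift over a free group has vanishing `H¹`.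
  choose s hs using fun i => Submodule.mkQ_surjective _ (v i)
  obtain ⟨F, hF⟩ := h1Vanishes_free_iff.mp (acyclic_translation (G := FreeGroup ι) W).h1Vanishes s
  refine ⟨Submodule.mkQ _ F, fun i => ?_⟩
  rw [← hs, hF]
  rfl

/-- If `W` is acyclic for a normal subgroup `N` and the invariants of `N` are acyclic for `G / N`,
then `W` is acyclic. -/
theorem acyclic_of_extension {N Q : Type} [Group N] [Group Q] {ι : N →* G} {π : G →* Q}
    (hι : Function.Injective ι) (hπ : Function.Surjective π) (hex : ι.range = π.ker)
    {ρ : Representation ℚ G W} {W' : Type} [AddCommGroup W'] [Module ℚ W']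
    {σ : Representation ℚ Q W'} (j : W' →ₗ[ℚ] W) (hj : Function.Injective j)
    (hjρ : ∀ g w, j (σ (π g) w) = ρ g (j w)) (hinv : ∀ w, (∀ n, ρ (ι n) w = w) → ∃ w', j w' = w)
    (hN : Acyclic (ρ.comp ι)) (hQ : Acyclic σ) : Acyclic ρ := by
  have hπι : ∀ n, π (ι n) = 1 := fun n => by
    rw [← MonoidHom.mem_ker, ← hex]; exact ⟨n, rfl⟩
  have hker : ∀ g, π g = 1 → ∃ n, ι n = g := fun g hg => by
    rw [← MonoidHom.mem_ker, ← hex] at hg; exact hg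
  -- The class consists of all modules that satisfy the hypotheses, for some model `W'` of the
  -- `N`-invariants.
  refine ⟨fun W _ _ ρ => ∃ (W' : Type) (_ : AddCommGroup W') (_ : Module ℚ W')
    (σ : Representation ℚ Q W') (j : W' →ₗ[ℚ] W), Function.Injective j ∧
    (∀ g w, j (σ (π g) w) = ρ g (j w)) ∧ (∀ w, (∀ n, ρ (ι n) w = w) → ∃ w', j w' = w) ∧
    Acyclic (ρ.comp ι) ∧ Acyclic σ, ?_, ⟨W', _, _, σ, j, hj, hjρ, hinv, hN, hQ⟩⟩
  clear! W W'
  rintro W _ _ ρ ⟨W', _, _, σ, j, hj, hjρ, hinv, hN, hQ⟩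
  constructor
  · intro c hc
    obtain ⟨w, hw⟩ : ∃ w, ∀ n, c (ι n) = ρ (ι n) w - w := hN.h1Vanishes _ (hc.comp ι)
    -- After subtraction of a principal crossed homomorphism, `d` vanishes on `N`. It is therefore
    -- constant on cosets of `N`, has `N`-invariant values, and comes from a crossed homomorphism of
    -- `Q`.
    set d : G → W := fun g => c g - (ρ g w - w) with hd
    have hdc : IsCrossed ρ d := by
      intro g h
      simp only [hd, hc g h, map_sub, map_mul, Module.End.mul_apply]
      abel
    have hdN : ∀ n, d (ι n) = 0 := fun n => by
      rw [hd]
      change c (ι n) - _ = 0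
      rw [sub_eq_zero]; exact hw n
    have hd1 : ∀ g n, d (g * ι n) = d g := fun g n => by
      rw [hdc, hdN, map_zero, add_zero]
    have hd2 : ∀ g n, ρ (ι n) (d g) = d g := by
      intro g n
      obtain ⟨m, hm⟩ := hker (g⁻¹ * ι n * g) (by simp [hπι])
      have h1 := hdc (ι n) g
      rw [hdN, zero_add] at h1
      rw [← h1, ← hd1 g m, hm]
      congr 1
      group
    choose e he using fun g => hinv (d g) (hd2 g)
    choose t ht using hπ
    have het : ∀ g, e (t (π g)) = e g := by
      intro g
      apply hj
      obtain ⟨m, hm⟩ := hker (g⁻¹ * t (π g)) (by simp [ht])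
      rw [he, he, ← hd1 g m, hm, mul_inv_cancel_left]
    obtain ⟨w', hw'⟩ := hQ.h1Vanishes (fun q => e (t q)) (by
      intro q r
      change e (t (q * r)) = e (t q) + σ q (e (t r))
      have h1 : e (t (q * r)) = e (t q * t r) := by
        rw [← het (t q * t r), map_mul, ht, ht]
      apply hj
      rw [h1, he, hdc, map_add, he]
      have h2 : j (σ q (e (t r))) = ρ (t q) (d (t r)) := by
        rw [← he, ← hjρ, ht]
      rw [h2])
    refine ⟨w + j w', fun g => ?_⟩
    have h1 : d g = ρ g (j w') - j w' := by
      rw [← hjρ, ← map_sub, ← hw' (π g), het, he]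
    rw [map_add, ← sub_add_cancel (c g) (ρ g w - w)]
    change d g + _ = _
    rw [h1]
    abel
  · have hsh : IsShortExact ρ (translation G W) (shift ρ) (orbitMap ρ) (Submodule.mkQ _) :=
      ⟨orbitMap_injective ρ, Submodule.mkQ_surjective _,
        fun a => (Submodule.Quotient.mk_eq_zero _).mpr ⟨a, rfl⟩,
        fun b hb => (Submodule.Quotient.mk_eq_zero _).mp hb,
        fun g a => (translation_orbitMap ρ g a).symm, fun _ _ => rfl⟩
    have hshN : IsShortExact (ρ.comp ι) ((translation G W).comp ι) ((shift ρ).comp ι) (orbitMap ρ)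
        (Submodule.mkQ _) :=
      ⟨hsh.inj, hsh.surj, hsh.comp_eq_zero, hsh.exact, fun g => hsh.equivariant_left (ι g),
        fun g => hsh.equivariant_right (ι g)⟩
    -- The `N`-invariant functions on `G` are the functions on `Q`. Since `H¹(N; W) = 0`, the
    -- invariants of `Fun(G, W) / W` are `Fun(Q, W) / W'`, with `W'` embedded by `i`. This quotient
    -- is acyclic for `Q` by two out of three.
    let i : W' →ₗ[ℚ] Q → W := (j.compLeft Q).comp (orbitMap σ)
    have hi : ∀ w q, i w q = j (σ q w) := fun _ _ => rfl
    have hiinv : ∀ q, ∀ F ∈ LinearMap.range i, translation Q W q F ∈ LinearMap.range i := by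
      rintro q _ ⟨w, rfl⟩
      refine ⟨σ q w, ?_⟩
      ext x
      simp [hi]
    let pull : (Q → W) →ₗ[ℚ] G → W := LinearMap.funLeft ℚ W π
    have hpi : ∀ w, pull (i w) = orbitMap ρ (j w) := by
      intro w
      ext g
      exact hjρ g w
    have hpinj : Function.Injective pull := LinearMap.funLeft_injective_of_surjective _ _ _ hπ
    refine ⟨_, _, _, quotientRep (translation Q W) (LinearMap.range i) hiinv,
      Submodule.mapQ _ _ pull (by
        rintro _ ⟨w, rfl⟩
        exact ⟨j w, (hpi w).symm⟩), ?_, ?_, ?_,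
        hshN.acyclic hN (acyclic_translation_comp ι hι W), ?_⟩
    · rw [injective_iff_map_eq_zero]
      intro F hF
      obtain ⟨F, rfl⟩ := Submodule.mkQ_surjective _ F
      obtain ⟨w, hw⟩ := (Submodule.Quotient.mk_eq_zero _).mp hF
      obtain ⟨w', rfl⟩ := hinv w (by
        intro n
        apply orbitMap_injective ρ
        rw [← translation_orbitMap, hw]
        ext x
        simp [pull, LinearMap.funLeft_apply, hπι])
      refine (Submodule.Quotient.mk_eq_zero _).mpr ⟨w', hpinj ?_⟩
      rw [hpi, hw]
    · intro g F
      obtain ⟨F, rfl⟩ := Submodule.mkQ_surjective _ F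
      change Submodule.mkQ _ (pull (translation Q W (π g) F)) =
        Submodule.mkQ _ (translation G W g (pull F))
      congr 1
      ext x
      simp [pull, LinearMap.funLeft_apply]
    · intro F hF
      obtain ⟨F, rfl⟩ := Submodule.mkQ_surjective _ F
      have h1 : ∀ n, ∃ w, orbitMap ρ w = translation G W (ι n) F - F := by
        intro n
        have : translation G W (ι n) F - F ∈ LinearMap.range (orbitMap ρ) :=
          (Submodule.Quotient.mk_eq_zero _).mp (sub_eq_zero.mpr (hF n))
        exact this
      choose c hc using h1
      -- An invariant class is represented by a function `F` whose increments along `N` are orbit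
      -- maps of a crossed homomorphism. Its triviality allows `F` to be changed into an
      -- `N`-invariant function.
      obtain ⟨w, hw⟩ := hN.h1Vanishes c (by
        intro n m
        apply orbitMap_injective ρ
        change _ = orbitMap ρ (c n + ρ (ι n) (c m))
        rw [map_add, ← translation_orbitMap, hc, hc, hc]
        simp)
      choose t ht using hπ
      refine ⟨Submodule.mkQ _ fun q => F (t q) - ρ (t q) w, ?_⟩
      change Submodule.mkQ _ _ = Submodule.mkQ _ F
      rw [← sub_eq_zero, ← map_sub]
      refine (Submodule.Quotient.mk_eq_zero _).mpr ⟨-w, ?_⟩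
      ext g
      obtain ⟨n, hn⟩ := hker (g⁻¹ * t (π g)) (by simp [ht])
      have h2 : t (π g) = g * ι n := by rw [hn, mul_inv_cancel_left]
      have h3 : ρ g (c n) = F (g * ι n) - F g := congrFun (hc n) g
      rw [hw n] at h3
      change ρ g (ρ (ι n) w - w) = _ at h3
      simp only [orbitMap_apply, map_neg, pull, LinearMap.funLeft_apply, Pi.sub_apply, h2, map_mul,
        Module.End.mul_apply]
      rw [map_sub] at h3
      rw [sub_eq_sub_iff_add_eq_add] at h3
      rw [eq_sub_iff_add_eq, eq_sub_iff_add_eq, neg_add_eq_sub, sub_add_eq_add_sub,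
        sub_eq_iff_eq_add,
        ← h3, add_comm]
    · refine IsShortExact.acyclic (f := i) (p := Submodule.mkQ _) ⟨?_, Submodule.mkQ_surjective _,
        fun a => (Submodule.Quotient.mk_eq_zero _).mpr ⟨a, rfl⟩,
        fun b hb => (Submodule.Quotient.mk_eq_zero _).mp hb, ?_, fun _ _ => rfl⟩ hQ
        (acyclic_translation W)
      · intro v w h
        apply hj
        simpa [hi] using congrFun h 1
      · intro q w
        ext x
        simp [hi]

/-- A representation of an increasing union of subgroups is acyclic if it is acyclic for each of
the subgroups and `lim¹` of the invariants vanishes. -/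
theorem acyclic_of_iUnion {K : ℕ → Type} [∀ n, Group (K n)] (f : ∀ n, K n →* G)
    (hf : ∀ n, Function.Injective (f n)) (hmono : ∀ n, (f n).range ≤ (f (n + 1)).range)
    (hG : ∀ g, ∃ n, g ∈ (f n).range) {ρ : Representation ℚ G W}
    (hK : ∀ n, Acyclic (ρ.comp (f n)))
    (hlim : ∀ u : ℕ → W, (∀ n k, ρ (f n k) (u n) = u n) →
      ∃ v : ℕ → W, (∀ n k, ρ (f n k) (v n) = v n) ∧ ∀ n, u n = v n - v (n + 1)) :
    Acyclic ρ := by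
  have hmono' : Monotone fun n => (f n).range := monotone_nat_of_le_succ hmono
  refine ⟨fun W _ _ ρ => (∀ n, Acyclic (ρ.comp (f n))) ∧
    ∀ u : ℕ → W, (∀ n k, ρ (f n k) (u n) = u n) →
      ∃ v : ℕ → W, (∀ n k, ρ (f n k) (v n) = v n) ∧ ∀ n, u n = v n - v (n + 1), ?_, hK, hlim⟩
  clear! W
  rintro W _ _ ρ ⟨hK, hlim⟩
  have hsucc : ∀ n k, ∃ k', f (n + 1) k' = f n k := fun n k => hmono n ⟨k, rfl⟩
  constructor
  · intro c hc
    have h1 : ∀ n, ∃ w, ∀ k, c (f n k) = ρ (f n k) w - w := fun n =>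
      (hK n).h1Vanishes _ (hc.comp (f n))
    choose w hw using h1
    -- The primitives `w n` and `w (n + 1)` both work on the `n`-th subgroup, so they differ by an
    -- invariant. The vanishing of `lim¹` corrects them to a single primitive `w n - v n`,
    -- independent of `n`.
    obtain ⟨v, hv, hv'⟩ := hlim (fun n => w n - w (n + 1)) (by
      intro n k
      obtain ⟨k', hk'⟩ := hsucc n k
      have h2 := hw n k
      rw [← hk', hw, hk'] at h2
      rw [map_sub]
      rw [sub_eq_sub_iff_add_eq_add] at h2 ⊢
      rw [← h2, add_comm])
    have hconst : ∀ n, w n - v n = w 0 - v 0 := by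
      intro n
      induction n with
      | zero => rfl
      | succ n ih =>
        rw [← ih, ← sub_eq_zero]
        have := sub_eq_zero.mpr (hv' n)
        rw [← neg_eq_zero, ← this]
        abel
    refine ⟨w 0 - v 0, fun g => ?_⟩
    obtain ⟨n, k, rfl⟩ := hG g
    rw [← hconst n, map_sub, hv, hw]
    abel
  · have hsh : ∀ n, IsShortExact (ρ.comp (f n)) ((translation G W).comp (f n))
        ((shift ρ).comp (f n)) (orbitMap ρ) (Submodule.mkQ _) := fun n =>
      ⟨orbitMap_injective ρ, Submodule.mkQ_surjective _,
        fun a => (Submodule.Quotient.mk_eq_zero _).mpr ⟨a, rfl⟩,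
        fun b hb => (Submodule.Quotient.mk_eq_zero _).mp hb,
        fun g a => (translation_orbitMap ρ (f n g) a).symm, fun _ _ => rfl⟩
    refine ⟨fun n => (hsh n).acyclic (hK n) (acyclic_translation_comp (f n) (hf n) W), ?_⟩
    intro u hu
    -- As `H¹` of the `n`-th subgroup vanishes, the invariant class `u n` lifts to an invariant
    -- function.
    have h1 : ∀ n, ∃ F : G → W, Submodule.mkQ _ F = u n ∧ ∀ x k, F (x * f n k) = F x := by
      intro n
      obtain ⟨F, hF⟩ := Submodule.mkQ_surjective _ (u n)
      have h2 : ∀ k, ∃ w, orbitMap ρ w = translation G W (f n k) F - F := by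
        intro k
        have h3 := hu n k
        rw [← hF] at h3
        have : translation G W (f n k) F - F ∈ LinearMap.range (orbitMap ρ) :=
          (Submodule.Quotient.mk_eq_zero _).mp (sub_eq_zero.mpr h3)
        exact this
      choose c hc using h2
      obtain ⟨w, hw⟩ := (hK n).h1Vanishes c (by
        intro k l
        apply orbitMap_injective ρ
        change _ = orbitMap ρ (c k + ρ (f n k) (c l))
        rw [map_add, ← translation_orbitMap, hc, hc, hc]
        simp)
      refine ⟨F - orbitMap ρ w, ?_, ?_⟩
      · rw [map_sub, hF, sub_eq_self]
        exact (Submodule.Quotient.mk_eq_zero _).mpr ⟨w, rfl⟩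
      · intro x k
        have h3 : ρ x (c k) = F (x * f n k) - F x := congrFun (hc k) x
        rw [hw k] at h3
        change ρ x (ρ (f n k) w - w) = _ at h3
        rw [map_sub, ← Module.End.mul_apply, ← map_mul] at h3
        simp only [Pi.sub_apply, orbitMap_apply]
        rw [sub_eq_sub_iff_add_eq_add] at h3 ⊢
        rw [add_comm (F x), h3]
    choose F hF hFinv using h1
    choose m hm using hG
    have hF1 : ∀ x n, m x ≤ n → F n x = F n 1 := by
      intro x n hn
      obtain ⟨k, hk⟩ := hmono' hn (hm x)
      have := hFinv n 1 k
      rwa [hk, one_mul] at this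
    -- The formal solution of `F n = v n - v (n + 1)` is the sum of all `F i` with `i ≥ n`.
    -- Subtracting the constants `F i 1` makes it finite, because `F i x = F i 1` once `x` lies in
    -- the `i`-th subgroup. The second sum restores the recursion.
    let v : ℕ → G → W := fun n x =>
      ∑ i ∈ Finset.Ico n (max n (m x)), (F i x - F i 1) - ∑ i ∈ Finset.range n, F i 1
    have hv : ∀ n x M, m x ≤ M → n ≤ M →
        v n x = ∑ i ∈ Finset.Ico n M, (F i x - F i 1) - ∑ i ∈ Finset.range n, F i 1 := by
      intro n x M hM hn
      simp only [v]
      congr 1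
      rw [← Finset.sum_Ico_consecutive _ (le_max_left n (m x)) (max_le hn hM), left_eq_add]
      apply Finset.sum_eq_zero
      intro i hi
      rw [hF1 x i ((le_max_right _ _).trans (Finset.mem_Ico.mp hi).1), sub_self]
    refine ⟨fun n => Submodule.mkQ _ (v n), ?_, ?_⟩
    · intro n k
      change Submodule.mkQ _ (translation G W (f n k) (v n)) = _
      congr 1
      ext x
      rw [translation_apply]
      set M := max n (max (m x) (m (x * f n k)))
      rw [hv n x M (by simp [M]) (by simp [M]), hv n (x * f n k) M (by simp [M]) (by simp [M])]
      congr 1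
      apply Finset.sum_congr rfl
      intro i hi
      obtain ⟨k', hk'⟩ := hmono' (Finset.mem_Ico.mp hi).1 (⟨k, rfl⟩ : f n k ∈ (f n).range)
      rw [← hk', hFinv]
    · intro n
      rw [← hF, ← map_sub]
      congr 1
      ext x
      set M := max (n + 1) (m x)
      rw [Pi.sub_apply, hv n x M (by simp [M]) (le_trans (Nat.le_succ n) (by simp [M])),
        hv (n + 1) x M (by simp [M]) (by simp [M]),
        Finset.sum_eq_sum_Ico_succ_bot (lt_of_lt_of_le (Nat.lt_succ_self n) (by simp [M])),
        Finset.sum_range_succ]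
      abel

end

end QGoodness

namespace QGoodness

open scoped commutatorElement

/-! ### Polynomial functions on groups -/

section Polynomial

variable {G : Type} [Group G]
variable {V : Type} [AddCommGroup V] [Module ℚ V]

variable (G V) in
/-- Polynomial functions `G → V` of degree less than `k`: those killed by the `k`-th power of the
augmentation ideal. -/
def polDeg : ℕ → Submodule ℚ (G → V)
  | 0 => ⊥
  | k + 1 => ⨅ g : G, (polDeg k).comap (translation G V g - LinearMap.id)

theorem mem_polDeg_zero {f : G → V} : f ∈ polDeg G V 0 ↔ f = 0 := Iff.rfl

theorem mem_polDeg_succ {k : ℕ} {f : G → V} :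
    f ∈ polDeg G V (k + 1) ↔ ∀ g, translation G V g f - f ∈ polDeg G V k := by
  simp [polDeg]

theorem polDeg_le_succ (k : ℕ) : polDeg G V k ≤ polDeg G V (k + 1) := by
  induction k with
  | zero => exact bot_le
  | succ k ih =>
    intro f hf
    rw [mem_polDeg_succ] at hf ⊢
    exact fun g => ih (hf g)

theorem polDeg_mono : Monotone (polDeg G V) := monotone_nat_of_le_succ polDeg_le_succ

theorem translation_mem_polDeg {k : ℕ} (g : G) : ∀ f ∈ polDeg G V k,
    translation G V g f ∈ polDeg G V k := by
  intro f hf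
  rw [← sub_add_cancel (translation G V g f) f]
  refine Submodule.add_mem _ ?_ hf
  exact mem_polDeg_succ.mp (polDeg_le_succ k hf) g

theorem const_mem_polDeg (v : V) (k : ℕ) : (fun _ => v) ∈ polDeg G V (k + 1) := by
  apply polDeg_mono (Nat.le_add_left 1 k)
  rw [mem_polDeg_succ]
  intro g
  rw [mem_polDeg_zero]
  ext x
  simp

/-- The degree is defined by right translations, which commute with left translations. Induction
therefore reduces to constant functions. -/
theorem left_sub_mem_polDeg {k : ℕ} {f : G → V} (hf : f ∈ polDeg G V (k + 1)) (g : G) :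
    (fun x => f (g * x) - f x) ∈ polDeg G V k := by
  induction k generalizing f with
  | zero =>
    rw [mem_polDeg_succ] at hf
    have h : ∀ x, f x = f 1 := fun x => by
      have := congrFun (mem_polDeg_zero.mp (hf x)) 1
      simpa [sub_eq_zero] using this
    rw [mem_polDeg_zero]
    ext x
    simp [h (g * x), h x]
  | succ k ih =>
    rw [mem_polDeg_succ] at hf ⊢
    intro h
    convert ih (hf h) using 1
    ext x
    simp [mul_assoc]
    abel

theorem bitranslate_sub_mem_polDeg {k : ℕ} {f : G → V} (hf : f ∈ polDeg G V (k + 1)) (l r : G) :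
    (fun x => f (l * x * r) - f x) ∈ polDeg G V k := by
  have h1 := left_sub_mem_polDeg (translation_mem_polDeg r f hf) l
  have h2 := mem_polDeg_succ.mp hf r
  convert Submodule.add_mem _ h1 h2 using 1
  ext x
  simp

/-- Polynomial functions can be pulled back along maps which turn right translations into
two-sided translations. -/
theorem comp_mem_polDeg {Γ : Type} [Group Γ] (φ : Γ → G) (l r : Γ → G)
    (hφ : ∀ x γ, φ (x * γ) = l γ * φ x * r γ) {k : ℕ} {f : G → V} (hf : f ∈ polDeg G V k) :
    (fun x => f (φ x)) ∈ polDeg Γ V k := by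
  induction k generalizing f with
  | zero => rw [mem_polDeg_zero] at hf ⊢; ext x; simp [hf]
  | succ k ih =>
    rw [mem_polDeg_succ]
    intro γ
    convert ih (bitranslate_sub_mem_polDeg hf (l γ) (r γ)) using 1
    ext x
    simp [hφ]

theorem comp_hom_mem_polDeg {Γ : Type} [Group Γ] (φ : Γ →* G) {k : ℕ} {f : G → V}
    (hf : f ∈ polDeg G V k) : (fun x => f (φ x)) ∈ polDeg Γ V k :=
  comp_mem_polDeg φ (fun _ => 1) φ (fun x γ => by simp) hf

theorem mem_polDeg_of_comp_surjective {Γ : Type} [Group Γ] {φ : Γ →* G}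
    (hφ : Function.Surjective φ) {k : ℕ} {f : G → V} (hf : (fun x => f (φ x)) ∈ polDeg Γ V k) :
    f ∈ polDeg G V k := by
  induction k generalizing f with
  | zero =>
    rw [mem_polDeg_zero] at hf ⊢
    ext x
    obtain ⟨x, rfl⟩ := hφ x
    exact congrFun hf x
  | succ k ih =>
    rw [mem_polDeg_succ] at hf ⊢
    intro g
    obtain ⟨g, rfl⟩ := hφ g
    apply ih
    convert hf g using 1
    ext x
    simp

theorem linearMap_comp_mem_polDeg {V' : Type} [AddCommGroup V'] [Module ℚ V'] (p : V →ₗ[ℚ] V')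
    {k : ℕ} {f : G → V} (hf : f ∈ polDeg G V k) : (fun x => p (f x)) ∈ polDeg G V' k := by
  induction k generalizing f with
  | zero => rw [mem_polDeg_zero] at hf ⊢; ext x; simp [hf]
  | succ k ih =>
    rw [mem_polDeg_succ] at hf ⊢
    intro g
    convert ih (hf g) using 1
    ext x
    simp

theorem mem_polDeg_of_linearMap_comp {V' : Type} [AddCommGroup V'] [Module ℚ V'] {p : V →ₗ[ℚ] V'}
    (hp : Function.Injective p) {k : ℕ} {f : G → V} (hf : (fun x => p (f x)) ∈ polDeg G V' k) :
    f ∈ polDeg G V k := by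
  induction k generalizing f with
  | zero =>
    rw [mem_polDeg_zero] at hf ⊢
    ext x
    apply hp
    simpa using congrFun hf x
  | succ k ih =>
    rw [mem_polDeg_succ] at hf ⊢
    intro g
    apply ih
    convert hf g using 1
    ext x
    simp

/-- The Leibniz rule: the increment of `u • f` is the increment of `u` times the translate of `f`,
plus `u` times the increment of `f`. -/
theorem smul_mem_polDeg (n : ℕ) {k l : ℕ} (hn : k + l ≤ n) {u : G → ℚ} {f : G → V}
    (hu : u ∈ polDeg G ℚ k) (hf : f ∈ polDeg G V l) : (fun x => u x • f x) ∈ polDeg G V n := by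
  induction n generalizing k l u f with
  | zero =>
    obtain rfl : k = 0 := by omega
    rw [mem_polDeg_zero] at hu ⊢
    ext x
    simp [hu]
  | succ n ih =>
    rcases k with _ | k
    · rw [mem_polDeg_zero] at hu
      convert Submodule.zero_mem _ using 1
      ext x
      simp [hu]
    rcases l with _ | l
    · rw [mem_polDeg_zero] at hf
      convert Submodule.zero_mem _ using 1
      ext x
      simp [hf]
    rw [mem_polDeg_succ]
    intro g
    convert Submodule.add_mem _
      (ih (by omega) (mem_polDeg_succ.mp hu g) (translation_mem_polDeg g f hf))
      (ih (by omega) hu (mem_polDeg_succ.mp hf g)) using 1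
    ext x
    simp [sub_smul, smul_sub]

variable (G V) in
/-- Polynomial functions `G → V`. -/
def pol : Submodule ℚ (G → V) where
  carrier := {f | ∃ k, f ∈ polDeg G V k}
  zero_mem' := ⟨0, Submodule.zero_mem _⟩
  add_mem' := by
    rintro f g ⟨k, hk⟩ ⟨l, hl⟩
    exact ⟨max k l, Submodule.add_mem _ (polDeg_mono (le_max_left k l) hk)
      (polDeg_mono (le_max_right k l) hl)⟩
  smul_mem' := by
    rintro a f ⟨k, hk⟩
    exact ⟨k, Submodule.smul_mem _ a hk⟩

theorem translation_mem_pol (g : G) : ∀ f ∈ pol G V, translation G V g f ∈ pol G V := by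
  rintro f ⟨k, hk⟩
  exact ⟨k, translation_mem_polDeg g f hk⟩

theorem smul_mem_pol {u : G → ℚ} {f : G → V} (hu : u ∈ pol G ℚ) (hf : f ∈ pol G V) :
    (fun x => u x • f x) ∈ pol G V := by
  obtain ⟨k, hk⟩ := hu
  obtain ⟨l, hl⟩ := hf
  exact ⟨k + l, smul_mem_polDeg _ le_rfl hk hl⟩

theorem const_mem_pol (v : V) : (fun _ => v) ∈ pol G V := ⟨1, const_mem_polDeg v 0⟩

theorem eval_mem_pol {u : G → ℚ} (hu : u ∈ pol G ℚ) (p : Polynomial ℚ) :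
    (fun x => p.eval (u x)) ∈ pol G ℚ := by
  induction p using Polynomial.induction_on' with
  | add p q hp hq =>
    convert Submodule.add_mem _ hp hq using 1
    ext x
    simp
  | monomial n a =>
    induction n generalizing a with
    | zero => simpa using const_mem_pol a
    | succ n ih =>
      convert smul_mem_pol hu (ih a) using 1
      ext x
      simp [pow_succ]
      ring

variable (G V) in
/-- The action of `G` on polynomial functions by right translation. -/
def polRep : Representation ℚ G (pol G V) := subRep (translation G V) (pol G V) translation_mem_pol

/-- `G` is good if its polynomial functions are acyclic. -/
def IsPolGood (G : Type) [Group G] : Prop :=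
  ∀ (V : Type) [AddCommGroup V] [Module ℚ V], Acyclic (polRep G V)

/-- The only subgroup of `G` which contains `S` and is closed under roots is `G`. -/
def IsRootGenerating (S : Set G) : Prop :=
  ∀ K : Subgroup G, S ⊆ K → (∀ (n : ℕ) (x : G), x ^ (n + 1) ∈ K → x ∈ K) → K = ⊤

variable (G) in
/-- `G` is the root closure of a finite set. -/
def IsRootFG : Prop := ∃ S : Set G, S.Finite ∧ IsRootGenerating S

theorem isRootFG_of_fg [Group.FG G] : IsRootFG G := by
  obtain ⟨S, hS⟩ := Group.fg_def.mp ‹Group.FG G›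
  refine ⟨S, S.finite_toSet, fun K hK _ => ?_⟩
  rw [eq_top_iff, ← hS, Subgroup.closure_le]
  exact hK

theorem isCrossed_sub (ρ : Representation ℚ G V) (w : V) : IsCrossed ρ fun g => ρ g w - w := by
  intro g h
  simp

/-- Increments in an invariant submodule: closure under roots. -/
theorem sub_mem_of_pow (D : Submodule ℚ (G → V)) (hD : ∀ g, ∀ f ∈ D, translation G V g f ∈ D)
    {g : G} {m : ℕ} (k : ℕ) {f : G → V} (hf : translation G V g f - f ∈ polDeg G V k)
    (h : translation G V (g ^ (m + 1)) f - f ∈ D) : translation G V g f - f ∈ D := by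
  induction k generalizing f with
  | zero =>
    rw [mem_polDeg_zero.mp hf]
    exact D.zero_mem
  | succ k ih =>
    set T := translation G V with hT
    have hc : IsCrossed T fun g => T g f - f := isCrossed_sub T f
    set e := T g f - f with he
    -- The induction applies to the increment `e`, which has smaller degree along `g`. Its increment
    -- along `g ^ (m + 1)` is in `D` because `D` is invariant.
    have h1 : T g e - e ∈ D := by
      apply ih (mem_polDeg_succ.mp hf g)
      have h2 : T (g ^ (m + 1)) e - e = T g (T (g ^ (m + 1)) f - f) - (T (g ^ (m + 1)) f - f) := by
        rw [he, map_sub, map_sub, ← Module.End.mul_apply, ← map_mul, ← Module.End.mul_apply,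
          ← map_mul, ← pow_succ, ← pow_succ']
        abel
      rw [h2]
      exact D.sub_mem (hD g _ h) h
    have h3 : ∀ i : ℕ, T (g ^ i) e - e ∈ D := fun i => by
      have h4 := (isCrossed_sub T e).preimage D hD
      have h5 : g ∈ (isCrossed_sub T e).preimage D hD := h1
      exact Subgroup.pow_mem _ h5 i
    -- Modulo `D`, powers of `g` fix `e`, so the increment of `f` along `g ^ i` is `i • e`. For `i =
    -- m + 1` one may divide, `D` being a rational subspace.
    have h6 : ∀ i : ℕ, T (g ^ i) f - f - (i : ℚ) • e ∈ D := by
      intro i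
      induction i with
      | zero => simp
      | succ i ihi =>
        have h7 : T (g ^ (i + 1)) f - f = (T (g ^ i) f - f) + T (g ^ i) e := by
          rw [pow_succ]; exact hc (g ^ i) g
        rw [h7]
        convert D.add_mem ihi (h3 i) using 1
        push_cast
        rw [add_smul, one_smul]
        abel
    have h8 : ((m + 1 : ℕ) : ℚ) • e ∈ D := by
      have := D.sub_mem h (h6 (m + 1))
      rwa [sub_sub_cancel] at this
    rwa [Submodule.smul_mem_iff _ (by positivity)] at h8

/-- The elements with increment in `D` form a subgroup by the crossed homomorphism identity, and
`sub_mem_of_pow` makes it closed under roots. -/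
theorem sub_mem_of_rootGenerating (D : Submodule ℚ (G → V))
    (hD : ∀ g, ∀ f ∈ D, translation G V g f ∈ D) {S : Set G} (hS : IsRootGenerating S) {f : G → V}
    (hf : ∀ g, translation G V g f - f ∈ pol G V) (h : ∀ g ∈ S, translation G V g f - f ∈ D)
    (g : G) : translation G V g f - f ∈ D := by
  have h1 : (isCrossed_sub (translation G V) f).preimage D hD = ⊤ := by
    apply hS _ (fun g hg => h g hg)
    intro n x hx
    obtain ⟨k, hk⟩ := hf x
    exact sub_mem_of_pow D hD k hk hx
  have : g ∈ (isCrossed_sub (translation G V) f).preimage D hD := h1 ▸ Subgroup.mem_top g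
  exact this

/-- A function with polynomial increments is polynomial. -/
theorem mem_pol_of_sub_mem (hG : IsRootFG G) {f : G → V}
    (hf : ∀ g, translation G V g f - f ∈ pol G V) : f ∈ pol G V := by
  obtain ⟨S, hfin, hS⟩ := hG
  choose k hk using hf
  -- Finitely many root generators give one degree bound for all increments.
  obtain ⟨K, hK⟩ := (hfin.image k).bddAbove
  refine ⟨K + 1, mem_polDeg_succ.mpr fun g => ?_⟩
  refine sub_mem_of_rootGenerating _ translation_mem_polDeg hS (fun g => ⟨k g, hk g⟩) ?_ g
  exact fun g hg => polDeg_mono (hK ⟨g, hg, rfl⟩) (hk g)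

/-- The values of a polynomial function are bounded with respect to an exhaustive filtration. -/
theorem exists_bound_of_mem_polDeg (hG : IsRootFG G) (D : ℕ → Submodule ℚ V) (hD : Monotone D)
    {k : ℕ} {f : G → V} (hf : f ∈ polDeg G V k) (h : ∀ x, ∃ d, f x ∈ D d) :
    ∃ d, ∀ x, f x ∈ D d := by
  induction k generalizing f with
  | zero =>
    refine ⟨0, fun x => ?_⟩
    rw [mem_polDeg_zero.mp hf]
    exact (D 0).zero_mem
  | succ k ih =>
    have h1 : ∀ g, ∃ d, ∀ x, (translation G V g f - f) x ∈ D d := by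
      intro g
      apply ih (mem_polDeg_succ.mp hf g)
      intro x
      obtain ⟨d, hd⟩ := h (x * g)
      obtain ⟨d', hd'⟩ := h x
      exact ⟨max d d', (D _).sub_mem (hD (le_max_left _ _) hd) (hD (le_max_right _ _) hd')⟩
    choose d hd using h1
    obtain ⟨d0, hd0⟩ := h 1
    obtain ⟨S, hfin, hS⟩ := hG
    obtain ⟨M, hM⟩ := (hfin.image d).bddAbove
    -- The functions with values in one step of the filtration form a translation invariant
    -- subspace. Bounding the increments along root generators therefore bounds all of them.
    let E : Submodule ℚ (G → V) := Submodule.pi Set.univ fun _ => D (max M d0)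
    have hE : ∀ f : G → V, f ∈ E ↔ ∀ x, f x ∈ D (max M d0) := fun f => by simp [E, Submodule.mem_pi]
    refine ⟨max M d0, fun x => ?_⟩
    have h2 := sub_mem_of_rootGenerating E (fun g f hf => by
        rw [hE] at hf ⊢
        exact fun x => hf (x * g)) hS (fun g => ⟨k, mem_polDeg_succ.mp hf g⟩) (fun g hg => by
        rw [hE]
        exact fun x => hD ((hM ⟨g, hg, rfl⟩).trans (le_max_left _ _)) (hd g x)) x
    rw [hE] at h2
    have h3 := h2 1
    simp only [Pi.sub_apply, translation_apply, one_mul] at h3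
    rw [← sub_add_cancel (f x) (f 1)]
    exact (D _).add_mem h3 (hD (le_max_right _ _) hd0)

/-- Currying of polynomial functions. -/
theorem curry_mem_polDeg {H : Type} [Group H] {k : ℕ} {f : H × G → V}
    (hf : f ∈ polDeg (H × G) V k) : (fun x h => f (h, x)) ∈ polDeg G (H → V) k := by
  induction k generalizing f with
  | zero => rw [mem_polDeg_zero] at hf ⊢; ext x; simp [hf]
  | succ k ih =>
    rw [mem_polDeg_succ] at hf ⊢
    intro g
    convert ih (hf (1, g)) using 1
    ext x
    simp

theorem curry_apply_mem_polDeg {H : Type} [Group H] {k : ℕ} {f : H × G → V}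
    (hf : f ∈ polDeg (H × G) V k) (x : G) : (fun h => f (h, x)) ∈ polDeg H V k :=
  comp_mem_polDeg (fun h => (h, x)) (fun _ => 1) (fun γ => (γ, 1)) (fun h γ => by simp) hf

/-- An increment along `(h, g)` is a translate of an increment along `g` plus an increment along
`h`. Each of them lowers one of the two degrees. -/
theorem uncurry_mem_polDeg {H : Type} [Group H] (n : ℕ) {k d : ℕ} (hn : k + d ≤ n)
    {F : G → H → V} (hF : F ∈ polDeg G (H → V) k) (hF' : ∀ x, F x ∈ polDeg H V d) :
    (fun p : H × G => F p.2 p.1) ∈ polDeg (H × G) V n := by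
  induction n generalizing k d F with
  | zero =>
    obtain rfl : k = 0 := by omega
    rw [mem_polDeg_zero] at hF ⊢
    ext x
    simp [hF]
  | succ n ih =>
    rcases k with _ | k
    · rw [mem_polDeg_zero] at hF
      convert Submodule.zero_mem _ using 1
      ext x
      simp [hF]
    rcases d with _ | d
    · convert Submodule.zero_mem _ using 1
      ext x
      exact congrFun (mem_polDeg_zero.mp (hF' x.2)) x.1
    rw [mem_polDeg_succ]
    rintro ⟨h, g⟩
    have h1 := ih (k := k) (d := d + 1) (by omega) (mem_polDeg_succ.mp hF g)
      fun x => Submodule.sub_mem _ (hF' (x * g)) (hF' x)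
    have h2 := translation_mem_polDeg (h, 1) _ h1
    have h3 := ih (k := k + 1) (d := d) (F := fun x => translation H V h (F x) - F x) (by omega)
      (linearMap_comp_mem_polDeg (translation H V h - LinearMap.id) hF)
      fun x => mem_polDeg_succ.mp (hF' x) h
    convert Submodule.add_mem _ h2 h3 using 1
    ext x
    simp

/-- Commutators of order `j` lower the degree by `j + 1`. -/
theorem sub_mem_polDeg_of_mem_lowerCentralSeries {j : ℕ} {γ : G}
    (hγ : γ ∈ (⊤ : Subgroup G).lowerCentralSeries j) {k : ℕ} {f : G → V}
    (hf : f ∈ polDeg G V (k + j + 1)) : translation G V γ f - f ∈ polDeg G V k := by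
  induction j generalizing γ k f with
  | zero => exact mem_polDeg_succ.mp hf γ
  | succ j ih =>
    have h2 : (⊤ : Subgroup G).lowerCentralSeries (j + 1) ≤
        (isCrossed_sub (translation G V) f).preimage (polDeg G V k) translation_mem_polDeg := by
      change ⁅_, _⁆ ≤ _
      rw [Subgroup.commutator_le]
      intro a ha b _
      change translation G V ⁅a, b⁆ f - f ∈ polDeg G V k
      set T := translation G V
      -- After this translation the increment along `⁅a, b⁆` becomes `(ab - ba) f'`. Here `ab - ba =
      -- (a - 1)(b - 1) - (b - 1)(a - 1)`, where `a - 1` lowers the degree by `j + 1` and `b - 1` by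
      -- one.
      set f' := T (b * a)⁻¹ f with hf'
      have h3 : f' ∈ polDeg G V (k + 1 + j + 1) := by
        apply translation_mem_polDeg
        convert hf using 2
        omega
      have h4 : T ⁅a, b⁆ f - f = T (a * b) f' - T (b * a) f' := by
        rw [hf', ← Module.End.mul_apply, ← map_mul, ← Module.End.mul_apply, ← map_mul]
        rw [mul_inv_cancel, map_one, Module.End.one_apply]
        congr 3
        rw [commutatorElement_def]
        group
      have h5 : T (a * b) f' - T (b * a) f' =
          (T a (T b f' - f') - (T b f' - f')) - (T b (T a f' - f') - (T a f' - f')) := by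
        simp only [map_mul, map_sub, Module.End.mul_apply]
        abel
      rw [h4, h5]
      apply Submodule.sub_mem
      · apply ih ha
        exact (mem_polDeg_succ (k := k + j + 1)).mp
          (by rwa [show k + j + 1 + 1 = k + 1 + j + 1 by omega]) b
      · exact mem_polDeg_succ.mp (ih ha h3) b
    exact h2 hγ

end Polynomial

end QGoodness

namespace QGoodness

open scoped commutatorElement

/-! ### Groups whose polynomial functions are acyclic -/

section Good

variable {G : Type} [Group G]

variable (V : Type) [AddCommGroup V] [Module ℚ V]

/-- Pullback of polynomial functions. -/
def polPull {Q : Type} [Group Q] (π : G →* Q) : pol Q V →ₗ[ℚ] pol G V :=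
  (LinearMap.funLeft ℚ V π).restrict (by
    rintro f ⟨k, hk⟩
    exact ⟨k, comp_hom_mem_polDeg π hk⟩)

variable {V}

@[simp]
theorem coe_polPull {Q : Type} [Group Q] (π : G →* Q) (f : pol Q V) (x : G) :
    (polPull V π f : G → V) x = (f : Q → V) (π x) := rfl

@[simp]
theorem coe_polRep_apply (g : G) (f : pol G V) (x : G) :
    (polRep G V g f : G → V) x = (f : G → V) (x * g) := rfl

/-- The polynomial functions on `G` invariant under `N` are exactly the polynomial functions on `Q`,
so `acyclic_of_extension` applies. -/
theorem isPolGood_of_extension {N Q : Type} [Group N] [Group Q] {ι : N →* G} {π : G →* Q}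
    (hι : Function.Injective ι) (hπ : Function.Surjective π) (hex : ι.range = π.ker)
    (hN : ∀ (V : Type) [AddCommGroup V] [Module ℚ V], Acyclic ((polRep G V).comp ι))
    (hQ : IsPolGood Q) : IsPolGood G := by
  intro V _ _
  refine acyclic_of_extension hι hπ hex (polPull V π) ?_ ?_ ?_ (hN V) (hQ V)
  · intro f f' h
    ext q
    obtain ⟨x, rfl⟩ := hπ q
    exact congrFun (congrArg Subtype.val h) x
  · intro g f
    ext x
    simp
  · intro f hf
    choose t ht using hπ
    have h1 : ∀ x, (f : G → V) (t (π x)) = (f : G → V) x := by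
      intro x
      have h2 : x⁻¹ * t (π x) ∈ ι.range := by
        rw [hex, MonoidHom.mem_ker]
        simp [ht]
      obtain ⟨n, hn⟩ := h2
      have h3 := congrFun (congrArg Subtype.val (hf n)) x
      rw [coe_polRep_apply, hn, mul_inv_cancel_left] at h3
      exact h3
    obtain ⟨k, hk⟩ := f.2
    refine ⟨⟨fun q => (f : G → V) (t q), k, mem_polDeg_of_comp_surjective (φ := π)
      (fun q => ⟨t q, ht q⟩) ?_⟩, ?_⟩
    · convert hk using 1
      ext x
      exact h1 x
    · ext x
      exact h1 x

theorem isPolGood_of_subsingleton [Subsingleton G] : IsPolGood G := by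
  intro V _ _
  have h : ∀ f : G → V, f ∈ pol G V := fun f => by
    convert const_mem_pol (G := G) (f 1)
  exact (acyclic_translation (G := G) V).of_equiv
    { toFun := fun f => ⟨f, h f⟩
      invFun := fun f => f
      left_inv := fun _ => rfl
      right_inv := fun _ => rfl
      map_add' := fun _ _ => rfl
      map_smul' := fun _ _ => rfl } fun _ _ => rfl

/-! #### Almost direct products -/

section Semidirect

variable {N Q : Type} [Group N] [Group Q] {φ : Q →* MulAut N}

/-- The primitive of a crossed homomorphism on `N` which vanishes on the complement. -/
def semidirectPrimitive (c : N → N ⋊[φ] Q → V) : N ⋊[φ] Q → V :=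
  fun x => c (φ x.right⁻¹ x.left) (SemidirectProduct.inr x.right)

/-- Every `x` is `inr q * inl m`, and the primitive takes there the value of `c m` at `inr q`. The
crossed homomorphism identity for a product in `N`, evaluated at `inr q`, is the claim. -/
theorem semidirectPrimitive_inl {c : N → N ⋊[φ] Q → V}
    (hc : IsCrossed ((translation (N ⋊[φ] Q) V).comp SemidirectProduct.inl) c) (m : N) :
    translation _ V (SemidirectProduct.inl m) (semidirectPrimitive c) - semidirectPrimitive c =
      c m := by
  ext x
  have h1 : x = SemidirectProduct.inr x.right * SemidirectProduct.inl (φ x.right⁻¹ x.left) := by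
    ext <;> simp
  simp only [semidirectPrimitive, Pi.sub_apply, translation_apply, SemidirectProduct.mul_left,
    SemidirectProduct.mul_right, SemidirectProduct.left_inl, SemidirectProduct.right_inl, mul_one,
    map_mul]
  have h2 : φ x.right⁻¹ (φ x.right m) = m := by simp
  rw [h2, hc]
  conv_rhs => rw [h1]
  simp

/-- Translation by the complement preserves vanishing on the complement, so it carries the primitive
of `c` to that of a conjugate of `c`. -/
theorem semidirectPrimitive_inr (c : N → N ⋊[φ] Q → V) (p : Q) :
    translation _ V (SemidirectProduct.inr p) (semidirectPrimitive c) =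
      semidirectPrimitive fun n => translation _ V (SemidirectProduct.inr p) (c (φ p⁻¹ n)) := by
  ext x
  simp [semidirectPrimitive]

/-- Increments along `N` are values of `c`. The increment along `p` in the complement is the
primitive of `c' - c`, where `c'` is a conjugate of `c`. This difference has one degree less, since
the leading part of `c` factors through the abelianization of `N`, on which `Q` acts trivially.
Induction on the degree concludes. -/
theorem semidirectPrimitive_mem_polDeg (hφ : ∀ q n, φ q n * n⁻¹ ∈ commutator N) (k : ℕ)
    {c : N → N ⋊[φ] Q → V}
    (hc : IsCrossed ((translation (N ⋊[φ] Q) V).comp SemidirectProduct.inl) c)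
    (hk : ∀ n, c n ∈ polDeg _ V k) : semidirectPrimitive c ∈ polDeg _ V (k + 1) := by
  induction k generalizing c with
  | zero =>
    convert Submodule.zero_mem _ using 1
    ext x
    simp [semidirectPrimitive, mem_polDeg_zero.mp (hk _)]
  | succ k ih =>
    rw [mem_polDeg_succ]
    intro g
    set A := (isCrossed_sub (translation _ V) (semidirectPrimitive c)).preimage _
      (translation_mem_polDeg (k := k + 1)) with hA
    have hmem : ∀ g, g ∈ A ↔ translation _ V g (semidirectPrimitive c) - semidirectPrimitive c ∈
      polDeg _ V (k + 1) := fun _ => Iff.rfl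
    rw [← hmem]
    rw [← SemidirectProduct.inl_left_mul_inr_right g]
    refine A.mul_mem ?_ ?_
    · rw [hmem, semidirectPrimitive_inl hc]
      exact hk _
    · set p := g.right
      rw [hmem, semidirectPrimitive_inr]
      set c' : N → N ⋊[φ] Q → V :=
        fun n => translation _ V (SemidirectProduct.inr p) (c (φ p⁻¹ n)) with hc'
      have h1 : semidirectPrimitive c' - semidirectPrimitive c =
        semidirectPrimitive fun n => c' n - c n := rfl
      rw [h1]
      apply ih
      · intro n m
        change c' (n * m) - c (n * m) = (c' n - c n) + translation _ V _ (c' m - c m)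
        have h2 : c' (n * m) = c' n + translation _ V (SemidirectProduct.inl n) (c' m) := by
          simp only [hc', map_mul, hc (φ p⁻¹ n), map_add]
          congr 1
          change translation _ V _ (translation _ V _ _) = translation _ V _ (translation _ V _ _)
          rw [← Module.End.mul_apply, ← map_mul, ← Module.End.mul_apply, ← map_mul]
          congr 2
          ext <;> simp
        rw [h2, hc n m, map_sub]
        change _ - (_ + translation _ V _ _) = _
        abel
      · intro n
        have h3 : c (φ p⁻¹ n) - c n ∈ polDeg _ V k := by
          -- Modulo lower degree, translations act trivially on the values of `c`, so the crossed
          -- homomorphism becomes a homomorphism to an abelian group.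
          let cbar : N →* Multiplicative ((N ⋊[φ] Q → V) ⧸ polDeg (N ⋊[φ] Q) V k) :=
            MonoidHom.mk' (fun n => Multiplicative.ofAdd (Submodule.mkQ _ (c n))) (by
              intro a b
              rw [← ofAdd_add, ← map_add]
              congr 1
              rw [hc a b, ← sub_eq_zero, ← map_sub]
              apply (Submodule.Quotient.mk_eq_zero _).mpr
              rw [add_sub_add_left_eq_sub]
              exact mem_polDeg_succ.mp (hk b) _)
          have h4 := Abelianization.commutator_subset_ker cbar (hφ p⁻¹ n)
          rw [MonoidHom.mem_ker, map_mul cbar, map_inv cbar, mul_inv_eq_one] at h4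
          apply (Submodule.Quotient.mk_eq_zero _).mp
          change Submodule.mkQ _ _ = 0
          rw [map_sub, sub_eq_zero]
          exact h4
        have h5 := mem_polDeg_succ.mp (hk (φ p⁻¹ n)) (SemidirectProduct.inr p)
        convert Submodule.add_mem _ h5 h3 using 1
        simp [hc']

/-- Almost direct products of a free group of finite rank and a good group are good. -/
theorem isPolGood_semidirectProduct {ι : Type} [Finite ι] {φ : Q →* MulAut (FreeGroup ι)}
    (hφ : ∀ q n, φ q n * n⁻¹ ∈ commutator (FreeGroup ι)) (hQ : IsPolGood Q) :
    IsPolGood (FreeGroup ι ⋊[φ] Q) := by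
  refine isPolGood_of_extension (ι := SemidirectProduct.inl) (π := SemidirectProduct.rightHom)
    SemidirectProduct.inl_injective SemidirectProduct.rightHom_surjective
    SemidirectProduct.range_inl_eq_ker_rightHom ?_ hQ
  intro V _ _
  apply acyclic_of_freeGroup
  intro c hc
  have hc' : IsCrossed ((translation (FreeGroup ι ⋊[φ] Q) V).comp SemidirectProduct.inl)
      fun n => (c n : FreeGroup ι ⋊[φ] Q → V) := fun n m => congrArg Subtype.val (hc n m)
  choose k hk using fun i => (c (FreeGroup.of i)).2
  -- Finite rank gives a common degree bound for `c` on the generators, and hence on the whole free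
  -- group.
  obtain ⟨K, hK⟩ := (Set.finite_range k).bddAbove
  have h1 : ∀ n, (c n : FreeGroup ι ⋊[φ] Q → V) ∈ polDeg _ V K := by
    have h2 : hc'.preimage (polDeg _ V K) (fun n => translation_mem_polDeg _) = ⊤ := by
      rw [eq_top_iff, ← FreeGroup.closure_range_of, Subgroup.closure_le]
      rintro _ ⟨i, rfl⟩
      exact polDeg_mono (hK ⟨i, rfl⟩) (hk i)
    intro n
    have : n ∈ hc'.preimage (polDeg _ V K) (fun n => translation_mem_polDeg _) :=
      h2 ▸ Subgroup.mem_top n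
    exact this
  refine ⟨⟨_, K + 1, semidirectPrimitive_mem_polDeg hφ K hc' h1⟩, fun n => ?_⟩
  apply Subtype.ext
  exact (semidirectPrimitive_inl hc' n).symm

end Semidirect

/-! #### Central extensions -/

section Central

/-- Bernoulli polynomials satisfy `B_{n+1}(x + 1) - B_{n+1}(x) = (n + 1) xⁿ`. -/
theorem exists_antidifference (p : Polynomial ℚ) :
    ∃ P : Polynomial ℚ, ∀ x, P.eval (x + 1) - P.eval x = p.eval x := by
  induction p using Polynomial.induction_on' with
  | add p q hp hq =>
    obtain ⟨P, hP⟩ := hp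
    obtain ⟨Q, hQ⟩ := hq
    refine ⟨P + Q, fun x => ?_⟩
    rw [Polynomial.eval_add, Polynomial.eval_add, Polynomial.eval_add, ← hP, ← hQ]
    ring
  | monomial n a =>
    refine ⟨Polynomial.C (a / (n + 1)) * Polynomial.bernoulli (n + 1), fun x => ?_⟩
    have h := Polynomial.bernoulli_eval_one_add (n + 1) x
    rw [add_comm 1 x] at h
    simp only [Polynomial.eval_mul, Polynomial.eval_C, Polynomial.eval_monomial, h]
    push_cast
    field_simp
    ring

/-- Summation by parts. If `P` is an antidifference of `p`, the increment of `P (t x) • h (x * a⁻¹)`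
is `p (t x) • h x` plus `P (t x) • (h x - h (x * a⁻¹))`. The error term involves a function of lower
degree than `h`. -/
theorem exists_translation_sub_eq {a : G} {t : G → ℚ} (ht : t ∈ pol G ℚ)
    (hta : ∀ x, t (x * a) = t x + 1) (m : ℕ) {h : G → V} (hh : h ∈ polDeg G V m)
    (p : Polynomial ℚ) : ∃ f ∈ pol G V, ∀ x, f (x * a) - f x = p.eval (t x) • h x := by
  induction m generalizing h p with
  | zero =>
    refine ⟨0, Submodule.zero_mem _, fun x => ?_⟩
    simp [mem_polDeg_zero.mp hh]
  | succ m ih =>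
    obtain ⟨P, hP⟩ := exists_antidifference p
    obtain ⟨f, hf, hfx⟩ := ih (mem_polDeg_succ.mp hh a⁻¹) P
    refine ⟨fun x => P.eval (t x) • h (x * a⁻¹) + f x, Submodule.add_mem _
      (smul_mem_pol (eval_mem_pol ht P) (translation_mem_pol a⁻¹ h ⟨_, hh⟩)) hf, fun x => ?_⟩
    have h1 := hfx x
    simp only [Pi.sub_apply, translation_apply, sub_eq_iff_eq_add] at h1
    simp only [h1, hta, mul_inv_cancel_right, ← hP]
    module

theorem IsUniquelyDivisible.zpow_injective {R : Type} [Group R]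
    (hR : IsUniquelyDivisible R) {z : R} (hz : z ≠ 1) :
    Function.Injective fun k : ℤ => z ^ k := by
  have h1 : ∀ n : ℕ, z ^ (n + 1) ≠ 1 := fun n h => hz (hR.pow_inj n (by rw [h, one_pow]))
  apply injective_zpow_iff_not_isOfFinOrder.mpr
  rw [isOfFinOrder_iff_pow_eq_one]
  rintro ⟨n, hn, h⟩
  obtain ⟨n, rfl⟩ := Nat.exists_eq_succ_of_ne_zero hn.ne'
  exact h1 n h

/-- Extending good groups by the root closure of a central element. -/
theorem isPolGood_of_central {R R' : Type} [Group R] [Group R'] (hR : IsUniquelyDivisible R)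
    (hfg : IsRootFG R) (hR' : IsPolGood R') {π : R →* R'} (hπ : Function.Surjective π) {z : R}
    (hz : z ∈ Subgroup.center R) (hz1 : z ≠ 1)
    (hker : ∀ a, π a = 1 ↔ ∃ (m : ℕ) (k : ℤ), a ^ (m + 1) = z ^ k) : IsPolGood R := by
  have hcen : ∀ a, π a = 1 → ∀ x, a * x = x * a := by
    intro a ha x
    obtain ⟨m, k, h⟩ := (hker a).mp ha
    refine hR.commute_of_pow m ?_
    rw [h]
    exact (Subgroup.mem_center_iff.mp (Subgroup.zpow_mem _ hz k) x).symm
  have hzinj := hR.zpow_injective hz1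
  -- The kernel embeds in `ℚ` with `z ↦ 1`. The value of `L` outside the kernel is irrelevant and
  -- set to `0`.
  have hL : ∃ L : R → ℚ, ∀ a (m : ℕ) (k : ℤ), a ^ (m + 1) = z ^ k → L a = k / (m + 1) := by
    classical
    refine ⟨fun a => if h : ∃ (m : ℕ) (k : ℤ), a ^ (m + 1) = z ^ k then
      (h.choose_spec.choose : ℚ) / (h.choose + 1) else 0, fun a m k h => ?_⟩
    have h' : ∃ (m : ℕ) (k : ℤ), a ^ (m + 1) = z ^ k := ⟨m, k, h⟩
    simp only [dif_pos h']
    have h1 := h'.choose_spec.choose_spec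
    set m' := h'.choose
    set k' := h'.choose_spec.choose
    have h2 : k' * (m + 1) = k * (m' + 1) := by
      apply hzinj
      change z ^ (k' * ((m : ℤ) + 1)) = z ^ (k * ((m' : ℤ) + 1))
      rw [zpow_mul, zpow_mul, ← h1, ← h]
      norm_cast
      rw [← pow_mul, ← pow_mul, mul_comm]
    rw [div_eq_div_iff (by positivity) (by positivity)]
    exact_mod_cast h2
  obtain ⟨L, hL⟩ := hL
  have hLmul : ∀ a b, π a = 1 → π b = 1 → L (a * b) = L a + L b := by
    intro a b ha hb
    obtain ⟨m, k, h⟩ := (hker a).mp ha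
    obtain ⟨m', k', h'⟩ := (hker b).mp hb
    have h1 : (a * b) ^ ((m + 1) * m' + m + 1) = z ^ (k * (m' + 1) + k' * (m + 1)) := by
      rw [(show Commute a b from hcen a ha b).mul_pow, zpow_add, zpow_mul, zpow_mul, ← h, ← h']
      norm_cast
      rw [← pow_mul, ← pow_mul]
      congr 2
      ring
    rw [hL _ _ _ h1, hL _ _ _ h, hL _ _ _ h']
    push_cast
    field_simp
    ring
  choose τ hτ using hπ
  have hτker : ∀ x, π ((τ (π x))⁻¹ * x) = 1 := fun x => by simp [hτ]
  -- a coordinate function which need not be polynomial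
  let s : R → ℚ := fun x => L ((τ (π x))⁻¹ * x)
  have hs : ∀ x a, π a = 1 → s (x * a) = s x + L a := by
    intro x a ha
    simp only [s, map_mul, ha, mul_one]
    rw [← mul_assoc, hLmul _ _ (hτker x) ha]
  -- As the kernel is central, the increments of `s` depend only on the image in `R'`.
  let d : R → R' → ℚ := fun g q => s (τ q * g) - s (τ q)
  have hd : ∀ g x, d g (π x) = s (x * g) - s x := by
    intro g x
    have h1 : x = τ (π x) * ((τ (π x))⁻¹ * x) := by group
    have h2 : x * g = τ (π x) * g * ((τ (π x))⁻¹ * x) := by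
      rw [mul_assoc (τ (π x)), ← hcen _ (hτker x) g]
      group
    have h3 : s x = s (τ (π x)) + L ((τ (π x))⁻¹ * x) := by
      conv_lhs => rw [h1]
      rw [hs _ _ (hτker x)]
    rw [h2, hs _ _ (hτker x), h3]
    simp only [d]
    ring
  have hdmul : ∀ g h q, d (g * h) q = d g q + d h (q * π g) := by
    intro g h q
    rw [← hτ q, ← map_mul, hd, hd, hd, mul_assoc]
    ring
  have hdker : ∀ a, π a = 1 → ∀ q, d a q = L a := by
    intro a ha q
    simp only [d, hs _ _ ha]
    ring
  -- Since `Fun(R', ℚ)` and its polynomial part are acyclic, so is the quotient. Modulo polynomials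
  -- the increments of `s` form a crossed homomorphism of `R'`. It is principal, given by `u`, and
  -- subtracting `u ∘ π` from `s` leaves polynomial increments.
  have hH1 : H1Vanishes (quotientRep (translation R' ℚ) (pol R' ℚ) translation_mem_pol) :=
    (acyclic_quotientRep (acyclic_translation ℚ) (pol R' ℚ) translation_mem_pol (hR' ℚ)).h1Vanishes
  obtain ⟨u, hu⟩ := hH1 (fun q => Submodule.mkQ _ (d (τ q))) (by
    intro q r
    change Submodule.mkQ _ (d (τ (q * r))) = Submodule.mkQ _ (d (τ q)) +
      Submodule.mkQ _ (translation R' ℚ q (d (τ r)))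
    rw [← map_add, ← sub_eq_zero, ← map_sub]
    apply (Submodule.Quotient.mk_eq_zero _).mpr
    convert const_mem_pol (G := R') (L ((τ q * τ r)⁻¹ * τ (q * r))) using 1
    ext x
    have h1 : τ (q * r) = τ q * τ r * ((τ q * τ r)⁻¹ * τ (q * r)) := by group
    have h2 : π ((τ q * τ r)⁻¹ * τ (q * r)) = 1 := by simp [hτ]
    simp only [Pi.sub_apply, Pi.add_apply, translation_apply]
    nth_rewrite 1 [h1]
    rw [hdmul, hdmul, hdker _ h2, hτ]
    ring)
  obtain ⟨u, rfl⟩ := Submodule.mkQ_surjective _ u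
  have hu' : ∀ g, (fun q => d g q - (u (q * π g) - u q)) ∈ pol R' ℚ := by
    intro g
    have h1 := sub_eq_zero.mpr (hu (π g))
    change Submodule.mkQ _ (d (τ (π g))) - (Submodule.mkQ _ (translation R' ℚ (π g) u) -
      Submodule.mkQ _ u) = 0 at h1
    rw [← map_sub, ← map_sub] at h1
    have h2 := (Submodule.Quotient.mk_eq_zero _).mp h1
    convert Submodule.add_mem _ h2 (const_mem_pol (G := R') (L ((τ (π g))⁻¹ * g))) using 1
    ext x
    have h3 : g = τ (π g) * ((τ (π g))⁻¹ * g) := by group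
    nth_rewrite 1 [h3]
    rw [hdmul, hdker _ (hτker g)]
    simp
    ring
  -- a polynomial coordinate function
  let t : R → ℚ := fun x => s x - u (π x)
  have ht : t ∈ pol R ℚ := by
    apply mem_pol_of_sub_mem hfg
    intro g
    convert (polPull ℚ π ⟨_, hu' g⟩).2 using 1
    ext x
    simp only [Pi.sub_apply, translation_apply, coe_polPull, hd, map_mul, t]
    ring
  have hta : ∀ x a, π a = 1 → t (x * a) = t x + L a := by
    intro x a ha
    simp only [t, hs _ _ ha, map_mul, ha, mul_one]
    ring
  -- exhausting the kernel by infinite cyclic groups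
  choose a ha using fun n : ℕ => (hR n.factorial n.factorial_ne_zero).2 z
  simp only at ha
  have hfac : ∀ n : ℕ, ∃ m, n.factorial = m + 1 := fun n =>
    Nat.exists_eq_succ_of_ne_zero n.factorial_ne_zero
  have hpow : ∀ (n : ℕ) {x y : R}, x ^ n.factorial = y ^ n.factorial → x = y := fun n x y h =>
    (hR _ n.factorial_ne_zero).1 h
  have haker : ∀ n, π (a n) = 1 := by
    intro n
    obtain ⟨m, hm⟩ := hfac n
    exact (hker _).mpr ⟨m, 1, by rw [← hm, ha, zpow_one]⟩
  have ha1 : ∀ n, a n ≠ 1 := fun n h => hz1 (by rw [← ha n, h, one_pow])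
  let f : ℕ → FreeGroup Unit →* π.ker := fun n => FreeGroup.lift fun _ => ⟨a n, haker n⟩
  have hf : ∀ n g, ∃ k : ℤ, g = FreeGroup.of () ^ k ∧ (f n g : R) = a n ^ k := by
    intro n g
    have h1 : g ∈ Subgroup.zpowers (FreeGroup.of ()) := by
      have h2 : Subgroup.zpowers (FreeGroup.of ()) = (⊤ : Subgroup (FreeGroup Unit)) := by
        rw [eq_top_iff, ← FreeGroup.closure_range_of, Subgroup.closure_le]
        rintro _ ⟨i, rfl⟩
        exact Subgroup.mem_zpowers _
      rw [h2]; trivial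
    obtain ⟨k, rfl⟩ := h1
    exact ⟨k, rfl, by simp [f]⟩
  have hmem : ∀ n (x : π.ker) (k : ℤ), (x : R) = a n ^ k → x ∈ (f n).range := by
    intro n x k hx
    refine ⟨FreeGroup.of () ^ k, Subtype.ext ?_⟩
    rw [hx]
    simp [f]
  refine isPolGood_of_extension (ι := π.ker.subtype) (π := π) (Subgroup.subtype_injective _)
    (fun q => ⟨τ q, hτ q⟩) (Subgroup.range_subtype _) ?_ hR'
  intro V _ _
  refine acyclic_of_iUnion f ?_ ?_ ?_ ?_ ?_
  · intro n
    rw [injective_iff_map_eq_one]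
    intro g hg
    obtain ⟨k, rfl, hk⟩ := hf n g
    rw [hg] at hk
    obtain rfl : k = 0 := by
      apply hR.zpow_injective (ha1 n)
      simpa using hk.symm
    rw [zpow_zero]
  · rintro n _ ⟨g, rfl⟩
    obtain ⟨k, -, hk⟩ := hf n g
    refine hmem _ _ ((n + 1 : ℕ) * k) ?_
    rw [hk, zpow_mul, zpow_natCast]
    congr 1
    apply hpow n
    rw [← pow_mul, ← Nat.factorial_succ, ha, ha]
  · rintro ⟨x, hx⟩
    obtain ⟨m, k, h⟩ := (hker x).mp hx
    refine ⟨m + 1, hmem _ _ (m.factorial * k) ?_⟩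
    apply hR.pow_inj m
    change x ^ (m + 1) = _
    rw [h, ← ha (m + 1), Nat.factorial_succ, ← zpow_natCast, ← zpow_natCast, ← zpow_mul, ← zpow_mul]
    congr 1
    push_cast
    ring
  · intro n
    apply acyclic_of_freeGroup
    rw [h1Vanishes_free_iff]
    intro v
    obtain ⟨m, hm⟩ := (v ()).2
    obtain ⟨m', hm'⟩ := hfac n
    -- Here `L (a n) = 1 / n!`, so the coordinate `n! • t` grows by one along `a n`.
    obtain ⟨w, hw, hw'⟩ := exists_translation_sub_eq (a := a n)
      (Submodule.smul_mem _ (n.factorial : ℚ) ht) (by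
        intro x
        simp only [Pi.smul_apply, hta x _ (haker n)]
        rw [hL (a n) m' 1 (by rw [← hm', ha, zpow_one]), hm']
        push_cast
        rw [smul_add, smul_eq_mul (b := ((1 : ℚ) / _)), mul_one_div_cancel (by positivity)])
      m hm 1
    refine ⟨⟨w, hw⟩, fun i => Subtype.ext ?_⟩
    obtain rfl : i = () := rfl
    ext x
    have h1 := hw' x
    rw [Polynomial.eval_one, one_smul] at h1
    rw [← h1]
    change _ = w (x * (f n (FreeGroup.of ()) : R)) - w x
    simp [f]
  · intro u hu
    -- Invariance under `a i` implies invariance under its power `z`. A polynomial function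
    -- invariant under `z` is invariant under every root of `z`. All subgroups in the union thus
    -- have the same invariants, and partial sums solve the `lim¹` problem.
    have h1 : ∀ i n (g : FreeGroup Unit), polRep R V (f n g : R) (u i) = u i := by
      intro i n g
      obtain ⟨⟨l, hl⟩⟩ : Nonempty {l : ℕ // (u i : R → V) ∈ polDeg R V l} :=
        let ⟨l, hl⟩ := (u i).2; ⟨⟨l, hl⟩⟩
      obtain ⟨m, hm⟩ := hfac n
      have h2 : translation R V (a i) (u i) = u i := by
        have h3 := congrArg Subtype.val (hu i (FreeGroup.of ()))
        change translation R V (f i (FreeGroup.of ()) : R) (u i) = u i at h3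
        simpa only [f, FreeGroup.lift_apply_of] using h3
      have h3 := isCrossed_sub (translation R V) (u i : R → V)
      have h4 : ∀ x, x ∈ h3.preimage ⊥ (by simp) ↔ translation R V x (u i) = u i := fun x =>
        (Submodule.mem_bot (R := ℚ)).trans sub_eq_zero
      have h5 : z ∈ h3.preimage ⊥ (by simp) := by
        rw [← ha i]
        exact Subgroup.pow_mem _ ((h4 _).mpr h2) _
      have h6 : a n ∈ h3.preimage ⊥ (by simp) := by
        refine sub_mem_of_pow ⊥ (by simp) (m := m) l ?_ ?_
        · exact Submodule.sub_mem _ (translation_mem_polDeg _ _ hl) hl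
        · rw [← hm, ha]; exact h5
      obtain ⟨k, -, hk⟩ := hf n g
      apply Subtype.ext
      change translation R V (f n g : R) (u i) = u i
      rw [← h4, hk]
      exact Subgroup.zpow_mem _ h6 _
    refine ⟨fun n => -∑ i ∈ Finset.range n, u i, fun n g => ?_, fun n => ?_⟩
    · rw [map_neg, map_sum]
      congr 1
      exact Finset.sum_congr rfl fun i _ => h1 i n g
    · simp only [Finset.sum_range_succ]
      abel

end Central

end Good

end QGoodness

namespace QGoodness

open scoped commutatorElement

/-! ### Uniquely divisible nilpotent groups are good -/

section

variable {R : Type} [Group R]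

/-- A subgroup closed under roots. -/
def IsRootClosed (K : Subgroup R) : Prop := ∀ (n : ℕ) (x : R), x ^ (n + 1) ∈ K → x ∈ K

/-- The smallest root closed subgroup containing `S`. -/
def rootClosure (S : Set R) : Subgroup R := sInf {K | S ⊆ K ∧ IsRootClosed K}

theorem subset_rootClosure (S : Set R) : S ⊆ rootClosure S := by
  intro x hx
  rw [SetLike.mem_coe, rootClosure, Subgroup.mem_sInf]
  exact fun K hK => hK.1 hx

theorem isRootClosed_rootClosure (S : Set R) : IsRootClosed (rootClosure S) := by
  intro n x hx
  rw [rootClosure, Subgroup.mem_sInf] at hx ⊢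
  exact fun K hK => hK.2 n x (hx K hK)

theorem rootClosure_le {S : Set R} {K : Subgroup R} (h : S ⊆ K) (hK : IsRootClosed K) :
    rootClosure S ≤ K := sInf_le ⟨h, hK⟩

theorem IsUniquelyDivisible.isRootClosed_bot (hR : IsUniquelyDivisible R) :
    IsRootClosed (⊥ : Subgroup R) := by
  intro n x hx
  rw [Subgroup.mem_bot] at hx ⊢
  exact hR.pow_inj n (by rw [hx, one_pow])

theorem IsUniquelyDivisible.isRootClosed_centralizer (hR : IsUniquelyDivisible R) (t : R) :
    IsRootClosed (Subgroup.centralizer {t}) := by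
  intro n x hx
  rw [Subgroup.mem_centralizer_singleton_iff] at hx ⊢
  exact (hR.commute_of_pow n hx).eq

theorem IsUniquelyDivisible.isRootClosed_center (hR : IsUniquelyDivisible R) :
    IsRootClosed (Subgroup.center R) := by
  intro n x hx
  rw [Subgroup.mem_center_iff] at hx ⊢
  exact fun g => (hR.commute_of_pow n (hx g).symm).eq.symm

theorem IsRootClosed.comap {R' : Type} [Group R'] {K : Subgroup R'} (hK : IsRootClosed K)
    (f : R →* R') : IsRootClosed (K.comap f) := by
  intro n x hx
  rw [Subgroup.mem_comap, map_pow] at hx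
  exact hK n _ hx

theorem IsRootGenerating.image {R' : Type} [Group R'] {S : Set R} (hS : IsRootGenerating S)
    {f : R →* R'} (hf : Function.Surjective f) : IsRootGenerating (f '' S) := by
  intro K hSK hK
  have h := hS (K.comap f) (fun s hs => hSK ⟨s, hs, rfl⟩) (IsRootClosed.comap hK f)
  rw [← Subgroup.map_comap_eq_self_of_surjective hf K, h, Subgroup.map_top_of_surjective f hf]

theorem IsRootFG.of_surjective {R' : Type} [Group R'] (hR : IsRootFG R) {f : R →* R'}
    (hf : Function.Surjective f) : IsRootFG R' := by
  obtain ⟨S, hfin, hS⟩ := hR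
  exact ⟨f '' S, hfin.image f, hS.image hf⟩

theorem normal_of_le_center {A : Subgroup R} (hA : A ≤ Subgroup.center R) : A.Normal :=
  ⟨fun a ha g => by rwa [Subgroup.mem_center_iff.mp (hA ha) g, mul_inv_cancel_right]⟩

theorem IsUniquelyDivisible.quotient (hR : IsUniquelyDivisible R) {A : Subgroup R} [A.Normal]
    (hA : A ≤ Subgroup.center R) (hA' : IsRootClosed A) : IsUniquelyDivisible (R ⧸ A) := by
  intro n hn
  obtain ⟨n, rfl⟩ := Nat.exists_eq_succ_of_ne_zero hn
  constructor
  · intro x y h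
    obtain ⟨x, rfl⟩ := QuotientGroup.mk_surjective x
    obtain ⟨y, rfl⟩ := QuotientGroup.mk_surjective y
    change (x : R ⧸ A) ^ (n + 1) = (y : R ⧸ A) ^ (n + 1) at h
    rw [← QuotientGroup.mk_pow, ← QuotientGroup.mk_pow, QuotientGroup.eq] at h
    obtain ⟨w, hw⟩ := (hR (n + 1) n.succ_ne_zero).2 ((x ^ (n + 1))⁻¹ * y ^ (n + 1))
    change w ^ (n + 1) = _ at hw
    have hwA : w ∈ A := hA' n w (hw ▸ h)
    have hxy : x * w = y := by
      apply hR.pow_inj n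
      have hc : Commute x w := Subgroup.mem_center_iff.mp (hA hwA) x
      rw [hc.mul_pow, hw, mul_inv_cancel_left]
    rw [QuotientGroup.eq, ← hxy, inv_mul_cancel_left]
    exact hwA
  · intro x
    obtain ⟨x, rfl⟩ := QuotientGroup.mk_surjective x
    obtain ⟨w, hw⟩ := (hR (n + 1) n.succ_ne_zero).2 x
    exact ⟨w, congrArg _ hw⟩

theorem acyclic_of_subsingleton_group {N : Type} [Group N] [Subsingleton N] {W : Type}
    [AddCommGroup W] [Module ℚ W] (ρ : Representation ℚ N W) : Acyclic ρ := by
  apply IsRelInjective.acyclic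
  refine ⟨LinearMap.proj 1, fun g F => ?_, fun w => by simp⟩
  rw [Subsingleton.elim g 1]
  simp

theorem isPolGood_of_bijective {Q : Type} [Group Q] {π : R →* Q} (hπ : Function.Bijective π)
    (hQ : IsPolGood Q) : IsPolGood R := by
  refine isPolGood_of_extension (ι := (1 : PUnit →* R)) (Function.injective_of_subsingleton _)
    hπ.2 ?_ (fun V _ _ => acyclic_of_subsingleton_group _) hQ
  rw [(MonoidHom.ker_eq_bot_iff π).mpr hπ.1]
  ext x
  simp

/-- The root closure of a central element. -/
def rootSpan (hR : IsUniquelyDivisible R) {z : R} (hz : z ∈ Subgroup.center R) : Subgroup R where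
  carrier := {a | ∃ (m : ℕ) (k : ℤ), a ^ (m + 1) = z ^ k}
  one_mem' := ⟨0, 0, by simp⟩
  mul_mem' := by
    rintro a b ⟨m, k, h⟩ ⟨m', k', h'⟩
    refine ⟨(m + 1) * m' + m, k * (m' + 1) + k' * (m + 1), ?_⟩
    have hc : Commute a b := by
      refine hR.commute_of_pow m ?_
      rw [h]
      exact (Subgroup.mem_center_iff.mp (Subgroup.zpow_mem _ hz k) b).symm
    rw [hc.mul_pow, zpow_add, zpow_mul, zpow_mul, ← h, ← h']
    norm_cast
    rw [← pow_mul, ← pow_mul]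
    congr 2
    ring
  inv_mem' := by
    rintro a ⟨m, k, h⟩
    exact ⟨m, -k, by rw [inv_pow, h, zpow_neg]⟩

theorem rootSpan_le_center (hR : IsUniquelyDivisible R) {z : R} (hz : z ∈ Subgroup.center R) :
    rootSpan hR hz ≤ Subgroup.center R := by
  rintro a ⟨m, k, h⟩
  exact hR.isRootClosed_center m a (h ▸ Subgroup.zpow_mem _ hz k)

theorem isRootClosed_rootSpan (hR : IsUniquelyDivisible R) {z : R} (hz : z ∈ Subgroup.center R) :
    IsRootClosed (rootSpan hR hz) := by
  rintro n a ⟨m, k, h⟩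
  refine ⟨(n + 1) * m + n, k, ?_⟩
  rw [← h, ← pow_mul]
  congr 1

/-- The root closures of the listed elements are divided out one at a time. Each stage is an
instance of `isPolGood_of_central`, with trivial elements skipped. -/
theorem isPolGood_of_central_list (d : ℕ) (l : List R) (hd : l.length = d)
    (hR : IsUniquelyDivisible R) (hfg : IsRootFG R)
    (hl : ∀ z ∈ l, z ∈ Subgroup.center R) {R' : Type} [Group R'] (hR' : IsPolGood R')
    {π : R →* R'} (hπ : Function.Surjective π) (hker : π.ker = rootClosure {z | z ∈ l}) :
    IsPolGood R := by
  induction d generalizing R with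
  | zero =>
    obtain rfl := List.length_eq_zero_iff.mp hd
    refine isPolGood_of_bijective ⟨?_, hπ⟩ hR'
    rw [← MonoidHom.ker_eq_bot_iff, hker, eq_bot_iff]
    exact rootClosure_le (by simp) hR.isRootClosed_bot
  | succ d ih =>
    obtain ⟨z, l, rfl⟩ := List.exists_cons_of_length_eq_add_one hd
    have hd' : l.length = d := by simpa using hd
    have hz := hl z (by simp)
    by_cases hz1 : z = 1
    · refine ih l hd' hR hfg (fun z hz => hl z (by simp [hz])) hπ ?_
      rw [hker]
      refine le_antisymm (rootClosure_le ?_ (isRootClosed_rootClosure _))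
        (rootClosure_le ?_ (isRootClosed_rootClosure _))
      · rintro x hx
        rcases List.mem_cons.mp hx with rfl | hx
        · rw [hz1]; exact Subgroup.one_mem _
        · exact subset_rootClosure _ hx
      · exact fun x hx => subset_rootClosure _ (List.mem_cons_of_mem _ hx)
    · set A := rootSpan hR hz with hA
      have hAc : A ≤ Subgroup.center R := rootSpan_le_center hR hz
      have hAr : IsRootClosed A := isRootClosed_rootSpan hR hz
      have hAn : A.Normal := normal_of_le_center hAc
      have hAπ : A ≤ π.ker := by
        rintro a ⟨m, k, h⟩
        rw [hker]
        refine isRootClosed_rootClosure _ m a ?_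
        rw [h]
        exact Subgroup.zpow_mem _ (subset_rootClosure _ (by simp)) k
      have hzA : z ∈ A := ⟨0, 1, by simp⟩
      have hQ := hR.quotient hAc hAr
      have hgood : IsPolGood (R ⧸ A) := by
        refine ih (R := R ⧸ A) (l.map (QuotientGroup.mk' A)) (by simpa using hd') hQ
          (hfg.of_surjective (QuotientGroup.mk'_surjective A)) ?_
          (π := QuotientGroup.lift A π hAπ) ?_ ?_
        · intro x hx
          obtain ⟨y, hy, rfl⟩ := List.mem_map.mp hx
          have hyc := Subgroup.mem_center_iff.mp (hl y (List.mem_cons_of_mem _ hy))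
          rw [Subgroup.mem_center_iff]
          intro g
          obtain ⟨g, rfl⟩ := QuotientGroup.mk'_surjective A g
          rw [← map_mul, ← map_mul, hyc]
        · intro q
          obtain ⟨x, rfl⟩ := hπ q
          exact ⟨QuotientGroup.mk' A x, rfl⟩
        · apply le_antisymm
          · intro x hx
            obtain ⟨x, rfl⟩ := QuotientGroup.mk'_surjective A x
            have hx' : x ∈ π.ker := hx
            rw [hker] at hx'
            rw [← Subgroup.mem_comap]
            refine rootClosure_le ?_ ((isRootClosed_rootClosure _).comap _) hx'
            intro y hy
            rw [SetLike.mem_coe, Subgroup.mem_comap]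
            rcases List.mem_cons.mp hy with rfl | hy
            · rw [QuotientGroup.mk'_apply, (QuotientGroup.eq_one_iff _).mpr hzA]
              exact Subgroup.one_mem _
            · exact subset_rootClosure _ (List.mem_map_of_mem hy)
          · refine rootClosure_le ?_ ?_
            · intro x hx
              obtain ⟨y, hy, rfl⟩ := List.mem_map.mp hx
              have : y ∈ π.ker := by
                rw [hker]; exact subset_rootClosure _ (List.mem_cons_of_mem _ hy)
              exact this
            · intro n x hx
              obtain ⟨x, rfl⟩ := QuotientGroup.mk'_surjective A x
              have hx' : x ^ (n + 1) ∈ π.ker := hx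
              rw [hker] at hx'
              have := isRootClosed_rootClosure _ n x hx'
              rw [← hker] at this
              exact this
      refine isPolGood_of_central hR hfg hgood (QuotientGroup.mk'_surjective A) hz hz1 fun a => ?_
      rw [← MonoidHom.mem_ker, QuotientGroup.ker_mk']
      rfl

/-- Left normed commutators of `i + 1` elements of `S`. -/
def iteratedCommutators (S : Set R) : ℕ → Set R
  | 0 => S
  | i + 1 => Set.image2 (fun t s => ⁅t, s⁆) (iteratedCommutators S i) S

theorem iteratedCommutators_finite {S : Set R} (hS : S.Finite) (i : ℕ) :
    (iteratedCommutators S i).Finite := by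
  induction i with
  | zero => exact hS
  | succ i ih => exact ih.image2 _ hS

theorem iteratedCommutators_image {R' : Type} [Group R'] (f : R →* R') (S : Set R) (i : ℕ) :
    iteratedCommutators (f '' S) i = f '' iteratedCommutators S i := by
  induction i with
  | zero => rfl
  | succ i ih =>
    simp only [iteratedCommutators, ih, Set.image2_image_left, Set.image2_image_right,
      Set.image_image2, map_commutatorElement]

theorem iteratedCommutators_subset (S : Set R) (i : ℕ) :
    iteratedCommutators S i ⊆ (⊤ : Subgroup R).lowerCentralSeries i := by
  induction i with
  | zero => exact fun _ _ => Subgroup.mem_top _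
  | succ i ih =>
    rintro _ ⟨t, ht, s, -, rfl⟩
    exact Subgroup.commutator_mem_commutator (ih ht) (Subgroup.mem_top s)

/-- Uniquely divisible groups of finite type whose generators have trivial long commutators are
good. -/
theorem isPolGood_of_iteratedCommutators (i : ℕ) (hR : IsUniquelyDivisible R) {S : Set R}
    (hfin : S.Finite) (hS : IsRootGenerating S) (hi : iteratedCommutators S i ⊆ {1}) :
    IsPolGood R := by
  induction i generalizing R with
  | zero =>
    have h : (⊥ : Subgroup R) = ⊤ :=
      hS ⊥ (fun s hs => by simpa using hi hs) hR.isRootClosed_bot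
    have : Subsingleton R := Subgroup.subsingleton_iff.mp (subsingleton_of_bot_eq_top h)
    exact isPolGood_of_subsingleton
  | succ i ih =>
    -- The longest surviving commutators commute with the root generators. Centralizers are root
    -- closed, so these commutators are central, and dividing by their root closure shortens the
    -- commutator length.
    have hcen : ∀ t ∈ iteratedCommutators S i, t ∈ Subgroup.center R := by
      intro t ht
      have h1 : Subgroup.centralizer {t} = ⊤ := by
        apply hS
        · intro s hs
          rw [SetLike.mem_coe, Subgroup.mem_centralizer_singleton_iff]
          have h2 : ⁅t, s⁆ = 1 := hi ⟨t, ht, s, hs, rfl⟩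
          rw [commutatorElement_eq_one_iff_commute] at h2
          exact h2.symm.eq
        · exact hR.isRootClosed_centralizer t
      rw [Subgroup.mem_center_iff]
      intro g
      have h3 : g ∈ Subgroup.centralizer {t} := h1 ▸ Subgroup.mem_top g
      exact Subgroup.mem_centralizer_singleton_iff.mp h3
    have hTfin := iteratedCommutators_finite hfin i
    set K := rootClosure (iteratedCommutators S i) with hK
    have hKc : K ≤ Subgroup.center R := rootClosure_le hcen hR.isRootClosed_center
    have hKn : K.Normal := normal_of_le_center hKc
    have hgood : IsPolGood (R ⧸ K) := by
      refine ih (hR.quotient hKc (isRootClosed_rootClosure _)) (hfin.image (QuotientGroup.mk' K))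
        (hS.image (QuotientGroup.mk'_surjective K)) ?_
      rw [iteratedCommutators_image]
      rintro _ ⟨t, ht, rfl⟩
      exact (QuotientGroup.eq_one_iff _).mpr (subset_rootClosure _ ht)
    refine isPolGood_of_central_list _ hTfin.toFinset.toList rfl hR ⟨S, hfin, hS⟩ ?_ hgood
      (QuotientGroup.mk'_surjective K) ?_
    · intro z hz
      exact hcen z (by simpa using hz)
    · rw [QuotientGroup.ker_mk', hK]
      congr 1
      ext z
      simp

/-- The images of generators of `G` root generate. Their commutators of `k + 1` entries come from
`Γᵏ`, because the series starts in degree `0`. -/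
theorem exists_rootGenerating_malcev (G : Type) [Group G] [Group.FG G] (k : ℕ) :
    ∃ S : Set (Rationalization (LcsQuotient G k)), S.Finite ∧ IsRootGenerating S ∧
      iteratedCommutators S k ⊆ {1} := by
  obtain ⟨S, hS⟩ := Group.fg_def.mp ‹Group.FG G›
  refine ⟨toMalcev G k '' S, S.finite_toSet.image _, ?_, ?_⟩
  · intro K hSK hK
    refine Rationalization.isRootDense_of K (fun g => ?_) hK
    obtain ⟨g, rfl⟩ := QuotientGroup.mk_surjective g
    exact hS.ge.trans ((Subgroup.closure_le (K.comap (toMalcev G k))).mpr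
      fun s hs => hSK ⟨s, hs, rfl⟩) (Subgroup.mem_top g)
  · rw [iteratedCommutators_image]
    rintro _ ⟨g, hg, rfl⟩
    have h1 : (QuotientGroup.mk' _ g : LcsQuotient G k) = 1 :=
      (QuotientGroup.eq_one_iff _).mpr (iteratedCommutators_subset _ k hg)
    change Rationalization.of (QuotientGroup.mk' _ g) = 1
    rw [h1, map_one]

theorem isRootFG_malcev (G : Type) [Group G] [Group.FG G] (k : ℕ) :
    IsRootFG (Rationalization (LcsQuotient G k)) := by
  obtain ⟨S, hfin, hS, -⟩ := exists_rootGenerating_malcev G k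
  exact ⟨S, hfin, hS⟩

theorem isPolGood_malcev (G : Type) [Group G] [Group.FG G] (k : ℕ) :
    IsPolGood (Rationalization (LcsQuotient G k)) := by
  obtain ⟨S, hfin, hS, hk⟩ := exists_rootGenerating_malcev G k
  exact isPolGood_of_iteratedCommutators k (Rationalization.isUniquelyDivisible _) hfin hS hk

end

end QGoodness

namespace QGoodness

/-! ### Polynomial cochains -/

section Cochains

variable {G : Type} [Group G]

/-- Inhomogeneous cochains with trivial coefficients. -/
def trivD (n : ℕ) : ((Fin n → G) → ℚ) →ₗ[ℚ] (Fin (n + 1) → G) → ℚ where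
  toFun f g := f (fun i => g i.succ) +
    ∑ j : Fin (n + 1), (-1 : ℚ) ^ ((j : ℕ) + 1) • f (Fin.contractNth j (· * ·) g)
  map_add' f f' := by
    ext g
    simp only [Pi.add_apply, smul_add, Finset.sum_add_distrib]
    abel
  map_smul' a f := by
    ext g
    simp only [Pi.smul_apply, smul_add, Finset.smul_sum, RingHom.id_apply, smul_comm _ a]

/-- Inhomogeneous cochains with values in the coinduced representation `Fun(G, ℚ)`. -/
def coindD (n : ℕ) : ((Fin n → G) × G → ℚ) →ₗ[ℚ] (Fin (n + 1) → G) × G → ℚ where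
  toFun f p := f (fun i => p.1 i.succ, p.2 * p.1 0) +
    ∑ j : Fin (n + 1), (-1 : ℚ) ^ ((j : ℕ) + 1) • f (Fin.contractNth j (· * ·) p.1, p.2)
  map_add' f f' := by
    ext g
    simp only [Pi.add_apply, smul_add, Finset.sum_add_distrib]
    abel
  map_smul' a f := by
    ext g
    simp only [Pi.smul_apply, smul_add, Finset.smul_sum, RingHom.id_apply, smul_comm _ a]

theorem trivD_apply (n : ℕ) (f : (Fin n → G) → ℚ) (g : Fin (n + 1) → G) :
    trivD n f g = f (fun i => g i.succ) +
      ∑ j : Fin (n + 1), (-1 : ℚ) ^ ((j : ℕ) + 1) • f (Fin.contractNth j (· * ·) g) := rfl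

theorem coindD_apply (n : ℕ) (f : (Fin n → G) × G → ℚ) (p : (Fin (n + 1) → G) × G) :
    coindD n f p = f (fun i => p.1 i.succ, p.2 * p.1 0) +
      ∑ j : Fin (n + 1), (-1 : ℚ) ^ ((j : ℕ) + 1) • f (Fin.contractNth j (· * ·) p.1, p.2) := rfl

theorem coindD_comp_fst (n : ℕ) (f : (Fin n → G) → ℚ) :
    coindD n (fun p => f p.1) = fun p => trivD n f p.1 := rfl

theorem inhomogeneousCochains_d_d (A : Rep.{0} ℚ G) (n : ℕ) (f : (Fin n → G) → A) :
    (inhomogeneousCochains.d A (n + 1)).hom ((inhomogeneousCochains.d A n).hom f) = 0 := by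
  have h := (groupCohomology.inhomogeneousCochains A).d_comp_d n (n + 1) (n + 2)
  rw [groupCohomology.inhomogeneousCochains.d_def, groupCohomology.inhomogeneousCochains.d_def] at h
  exact congrArg (fun φ => φ.hom f) h

theorem coindD_coindD (n : ℕ) (f : (Fin n → G) × G → ℚ) : coindD (n + 1) (coindD n f) = 0 := by
  have h := inhomogeneousCochains_d_d (Rep.of (translation G ℚ)) n (fun g x => f (g, x))
  ext ⟨g, x⟩
  have h1 := congrFun (congrFun h g) x
  have h2 : ∀ (n : ℕ) (f : (Fin n → G) → G → ℚ) g x,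
      (inhomogeneousCochains.d (Rep.of (translation G ℚ)) n).hom f g x =
        coindD n (fun p => f p.1 p.2) (g, x) := by
    intro n f g x
    rw [inhomogeneousCochains.d_hom_apply, coindD_apply]
    simp only [Pi.add_apply, Finset.sum_apply, Pi.smul_apply]
    rfl
  rw [h2] at h1
  refine Eq.trans (congrFun (congrArg _ ?_) _) h1
  ext p
  exact (h2 n (fun g x => f (g, x)) p.1 p.2).symm

/-- The contracting homotopy of the complex of cochains with coinduced coefficients. -/
def coindH (n : ℕ) : ((Fin (n + 1) → G) × G → ℚ) →ₗ[ℚ] (Fin n → G) × G → ℚ :=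
  LinearMap.funLeft ℚ ℚ fun p => (Fin.cons p.2 p.1, 1)

theorem coindH_apply (n : ℕ) (f : (Fin (n + 1) → G) × G → ℚ) (p : (Fin n → G) × G) :
    coindH n f p = f (Fin.cons p.2 p.1, 1) := rfl

theorem contractNth_zero_cons {n : ℕ} (x : G) (g : Fin (n + 1) → G) :
    Fin.contractNth 0 (· * ·) (Fin.cons x g : Fin (n + 2) → G) =
      Fin.cons (x * g 0) fun i => g i.succ := by
  ext k
  refine Fin.cases ?_ (fun k => ?_) k
  · simp [Fin.contractNth]
  · simp [Fin.contractNth]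

theorem contractNth_succ_cons {n : ℕ} (x : G) (g : Fin (n + 1) → G) (j : Fin (n + 1)) :
    Fin.contractNth j.succ (· * ·) (Fin.cons x g : Fin (n + 2) → G) =
      Fin.cons x (Fin.contractNth j (· * ·) g) := by
  ext k
  refine Fin.cases ?_ (fun k => ?_) k
  · simp [Fin.contractNth]
  · simp [Fin.contractNth]

theorem coindH_coindD_zero (f : (Fin 0 → G) × G → ℚ) :
    coindH 0 (coindD 0 f) = f - fun _ => f (default, 1) := by
  ext ⟨g, x⟩
  rw [coindH_apply, coindD_apply]
  simp [Subsingleton.elim _ (default : Fin 0 → G), sub_eq_add_neg]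

/-- The extra degeneracy of the bar construction: prepending the coinduction variable contracts the
complex. It also preserves polynomials, see `coindH_mem_pol`. -/
theorem coindH_coindD_succ (n : ℕ) (f : (Fin (n + 1) → G) × G → ℚ) :
    coindD n (coindH n f) + coindH (n + 1) (coindD (n + 1) f) = f := by
  ext ⟨g, x⟩
  have h1 : coindH (n + 1) (coindD (n + 1) f) (g, x) = f (g, x) +
      (-f (Fin.cons (x * g 0) fun i => g i.succ, 1) + ∑ j : Fin (n + 1),
        -((-1 : ℚ) ^ ((j : ℕ) + 1) • f (Fin.cons x (Fin.contractNth j (· * ·) g), 1))) := by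
    rw [coindH_apply, coindD_apply, Fin.sum_univ_succ]
    simp only [contractNth_zero_cons, contractNth_succ_cons, Fin.cons_succ, Fin.cons_zero, one_mul,
      Fin.val_zero, Fin.val_succ, zero_add, pow_one, neg_smul, one_smul, pow_succ _ (_ + 1),
      mul_neg, mul_one]
  rw [Pi.add_apply, h1, coindD_apply]
  simp only [coindH_apply, Finset.sum_neg_distrib]
  ring

/-- The residual action of `G` on cochains with coinduced coefficients. -/
def leftRep (n : ℕ) : Representation ℚ G ((Fin n → G) × G → ℚ) where
  toFun g := LinearMap.funLeft ℚ ℚ fun p => (p.1, g⁻¹ * p.2)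
  map_one' := by ext; simp [LinearMap.funLeft_apply]
  map_mul' g h := by ext; simp [LinearMap.funLeft_apply, mul_assoc]

@[simp]
theorem leftRep_apply (n : ℕ) (g : G) (f : (Fin n → G) × G → ℚ) (p : (Fin n → G) × G) :
    leftRep n g f p = f (p.1, g⁻¹ * p.2) := rfl

theorem coindD_leftRep (n : ℕ) (g : G) (f : (Fin n → G) × G → ℚ) :
    coindD n (leftRep n g f) = leftRep (n + 1) g (coindD n f) := by
  ext p
  simp [coindD_apply, mul_assoc]

theorem acyclic_leftRep (n : ℕ) : Acyclic (leftRep (G := G) n) :=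
  acyclic_of_free _ (fun p g => (p.1, g⁻¹ * p.2)) (fun _ _ _ => by simp [mul_assoc])
    (fun _ _ _ => rfl) (fun p => p.2⁻¹) fun _ _ => by simp

theorem comp_mem_pol {Γ : Type} [Group Γ] (φ : Γ → G) (l r : Γ → G)
    (hφ : ∀ x γ, φ (x * γ) = l γ * φ x * r γ) {V : Type} [AddCommGroup V] [Module ℚ V] {f : G → V}
    (hf : f ∈ pol G V) : (fun x => f (φ x)) ∈ pol Γ V := by
  obtain ⟨k, hk⟩ := hf
  exact ⟨k, comp_mem_polDeg φ l r hφ hk⟩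

theorem leftRep_mem_pol (n : ℕ) (g : G) : ∀ f ∈ pol ((Fin n → G) × G) ℚ,
    leftRep n g f ∈ pol ((Fin n → G) × G) ℚ := fun _ hf =>
  comp_mem_pol (fun p : (Fin n → G) × G => (p.1, g⁻¹ * p.2)) (fun _ => 1) id
    (fun x γ => by ext <;> simp [mul_assoc]) hf

theorem snd_inv_mem_pol {H : Type} [Group H] {V : Type} [AddCommGroup V] [Module ℚ V]
    {f : H × G → V} (hf : f ∈ pol (H × G) V) : (fun p => f (p.1, p.2⁻¹)) ∈ pol (H × G) V :=
  comp_mem_pol (fun p : H × G => (p.1, p.2⁻¹)) (fun γ => (1, γ.2⁻¹)) (fun γ => (γ.1, 1))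
    (fun x γ => by ext <;> simp) hf

/-- The product of adjacent entries does not turn right translations into two-sided ones, but `g_j⁻¹
g_{j+1}` does. The contraction is therefore composed with two inversions of the `j`-th entry, each
step being covered by `comp_mem_pol`. -/
theorem contractNth_mem_pol {H : Type} [Group H] {n : ℕ} (j : Fin (n + 1))
    {f : (Fin n → G) × H → ℚ} (hf : f ∈ pol _ ℚ) :
    (fun p : (Fin (n + 1) → G) × H => f (Fin.contractNth j (· * ·) p.1, p.2)) ∈ pol _ ℚ := by
  have h1 := comp_mem_pol (Γ := (Fin (n + 1) → G) × H)
    (fun p => (Fin.contractNth j (· * ·) (fun i => if i = j then (p.1 i)⁻¹ else p.1 i), p.2))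
    (fun γ => (fun k => if (k : ℕ) = j then (γ.1 k.castSucc)⁻¹ else 1, 1))
    (fun γ => (fun k => if (k : ℕ) < j then γ.1 k.castSucc else γ.1 k.succ, γ.2))
    (fun x γ => by
      ext k
      · have e1 : k.castSucc = j ↔ (k : ℕ) = j := by simp [Fin.ext_iff]
        have e2 : k.succ = j ↔ (k : ℕ) + 1 = j := by simp [Fin.ext_iff]
        rcases lt_trichotomy (k : ℕ) j with h | h | h
        · simp [Fin.contractNth, h, h.ne, e1]
        · simp [Fin.contractNth, h, e1, e2, mul_assoc]
        · have h3 : ¬ (k : ℕ) + 1 = j := by omega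
          simp [Fin.contractNth, h.ne', not_lt.mpr h.le, e2, h3]
      · simp) hf
  have h2 := comp_mem_pol (Γ := (Fin (n + 1) → G) × H)
    (fun p => (fun i => if i = j then (p.1 i)⁻¹ else p.1 i, p.2))
    (fun γ => (fun i => if i = j then (γ.1 i)⁻¹ else 1, 1))
    (fun γ => (fun i => if i = j then 1 else γ.1 i, γ.2))
    (fun x γ => by
      ext i
      · by_cases h : i = j <;> simp [h]
      · simp) h1
  convert h2 using 1
  ext p
  congr 3
  ext i
  by_cases h : i = j <;> simp [h]

theorem coindD_mem_pol (n : ℕ) {f : (Fin n → G) × G → ℚ} (hf : f ∈ pol _ ℚ) :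
    coindD n f ∈ pol _ ℚ := by
  have h1 := comp_mem_pol (Γ := (Fin (n + 1) → G) × G)
    (fun p => ((fun i => p.1 i.succ : Fin n → G), p.2⁻¹ * p.1 0))
    (fun γ => ((1 : Fin n → G), γ.2⁻¹))
    (fun γ => ((fun i => γ.1 i.succ : Fin n → G), γ.1 0))
    (fun x γ => by ext <;> simp [mul_assoc]) hf
  have h2 := snd_inv_mem_pol h1
  simp only [inv_inv] at h2
  have h3 : ∑ j : Fin (n + 1), (-1 : ℚ) ^ ((j : ℕ) + 1) •
      (fun p : (Fin (n + 1) → G) × G => f (Fin.contractNth j (· * ·) p.1, p.2)) ∈ pol _ ℚ :=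
    Submodule.sum_mem _ fun j _ => Submodule.smul_mem _ _ (contractNth_mem_pol j hf)
  convert Submodule.add_mem _ h2 h3 using 1
  ext p
  simp [coindD_apply]

theorem coindH_mem_pol (n : ℕ) {f : (Fin (n + 1) → G) × G → ℚ} (hf : f ∈ pol _ ℚ) :
    coindH n f ∈ pol _ ℚ :=
  comp_mem_pol (fun p : (Fin n → G) × G => ((Fin.cons p.2 p.1 : Fin (n + 1) → G), (1 : G)))
    (fun _ => 1) (fun γ => (Fin.cons γ.2 γ.1, 1)) (fun x γ => by
      ext k
      · refine Fin.cases ?_ (fun k => ?_) k <;> simp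
      · simp) hf

theorem fst_mem_pol {H : Type} [Group H] {V : Type} [AddCommGroup V] [Module ℚ V] {f : H → V}
    (hf : f ∈ pol H V) : (fun p : H × G => f p.1) ∈ pol (H × G) V :=
  (polPull V (MonoidHom.fst H G) ⟨f, hf⟩).2

theorem mem_pol_of_fst {H : Type} [Group H] {V : Type} [AddCommGroup V] [Module ℚ V] {f : H → V}
    (hf : (fun p : H × G => f p.1) ∈ pol (H × G) V) : f ∈ pol H V := by
  obtain ⟨k, hk⟩ := hf
  exact ⟨k, mem_polDeg_of_comp_surjective (φ := MonoidHom.fst H G) (fun h => ⟨(h, 1), rfl⟩) hk⟩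

/-- Currying `Pol(H × G) ≅ Pol(G, Pol(H))`, composed with inversion on `G`. -/
def polCurry (H : Type) [Group H] : pol (H × G) ℚ →ₗ[ℚ] pol G (pol H ℚ) where
  toFun f := ⟨fun y => ⟨fun h => (f : H × G → ℚ) (h, y⁻¹), by
      obtain ⟨k, hk⟩ := f.2
      exact ⟨k, curry_apply_mem_polDeg hk y⁻¹⟩⟩, by
    obtain ⟨k, hk⟩ := snd_inv_mem_pol f.2
    exact ⟨k, mem_polDeg_of_linearMap_comp (p := (pol H ℚ).subtype) (pol H ℚ).injective_subtype
      (curry_mem_polDeg hk)⟩⟩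
  map_add' _ _ := rfl
  map_smul' _ _ := rfl

/-- For surjectivity, a polynomial function with values in `Pol(H)` must have values of bounded
degree. This is where root finite generation enters. -/
theorem polCurry_bijective (hG : IsRootFG G) (H : Type) [Group H] :
    Function.Bijective (polCurry (G := G) H) := by
  constructor
  · intro f f' h
    ext ⟨a, x⟩
    have := congrFun (congrArg Subtype.val (congrFun (congrArg Subtype.val h) x⁻¹)) a
    simpa [polCurry] using this
  · intro F
    obtain ⟨k, hk⟩ := F.2
    obtain ⟨d, hd⟩ := exists_bound_of_mem_polDeg hG
      (fun d => (polDeg H ℚ d).comap (pol H ℚ).subtype)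
      (fun _ _ h => Submodule.comap_mono (polDeg_mono h)) hk fun x => ((F : G → pol H ℚ) x).2
    have h1 := uncurry_mem_polDeg (H := H) (k + d) le_rfl
      (linearMap_comp_mem_polDeg (pol H ℚ).subtype hk) hd
    refine ⟨⟨_, snd_inv_mem_pol ⟨_, h1⟩⟩, ?_⟩
    apply Subtype.ext
    funext y
    apply Subtype.ext
    funext h
    simp [polCurry]

/-- Inversion and currying turn this module into `Pol(G, Pol(Gⁿ))` with right translation. Goodness
is needed here with the infinite dimensional coefficients `Pol(Gⁿ)`. -/
theorem acyclic_pol_leftRep (hG : IsPolGood G) (hfg : IsRootFG G) (n : ℕ) :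
    Acyclic (subRep (leftRep n) (pol ((Fin n → G) × G) ℚ) (leftRep_mem_pol n)) := by
  let e := LinearEquiv.ofBijective _ (polCurry_bijective hfg (Fin n → G))
  refine (hG (pol (Fin n → G) ℚ)).of_equiv e.symm fun g F => ?_
  rw [LinearEquiv.symm_apply_eq]
  obtain ⟨f, rfl⟩ := e.surjective F
  rw [LinearEquiv.symm_apply_apply]
  apply Subtype.ext
  funext y
  apply Subtype.ext
  funext h
  change (f : _ → ℚ) (h, (y * g)⁻¹) = (f : _ → ℚ) (h, g⁻¹ * y⁻¹)
  rw [mul_inv_rev]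

/-- The action on cochains modulo polynomial cochains. -/
def modPolRep (n : ℕ) : Representation ℚ G (((Fin n → G) × G → ℚ) ⧸ pol ((Fin n → G) × G) ℚ) :=
  quotientRep (leftRep n) _ (leftRep_mem_pol n)

variable (G) in
/-- The differential modulo polynomial cochains. -/
def modPolD (n : ℕ) : (((Fin n → G) × G → ℚ) ⧸ pol ((Fin n → G) × G) ℚ) →ₗ[ℚ]
    (((Fin (n + 1) → G) × G → ℚ) ⧸ pol ((Fin (n + 1) → G) × G) ℚ) :=
  Submodule.mapQ _ _ (coindD n) fun _ h => coindD_mem_pol n h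

theorem modPolD_modPolRep (n : ℕ) (g : G) (q) :
    modPolD G n (modPolRep n g q) = modPolRep (n + 1) g (modPolD G n q) := by
  obtain ⟨f, rfl⟩ := Submodule.mkQ_surjective _ q
  exact congrArg (Submodule.mkQ _) (coindD_leftRep n g f)

theorem modPolRep_mem_ker (n : ℕ) (g : G) : ∀ q ∈ LinearMap.ker (modPolD G n),
    modPolRep n g q ∈ LinearMap.ker (modPolD G n) := by
  intro q hq
  rw [LinearMap.mem_ker] at hq ⊢
  rw [modPolD_modPolRep, hq, map_zero]

theorem modPolD_modPolD (n : ℕ) (q) : modPolD G (n + 1) (modPolD G n q) = 0 := by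
  obtain ⟨f, rfl⟩ := Submodule.mkQ_surjective _ q
  change Submodule.mkQ _ (coindD (n + 1) (coindD n f)) = 0
  rw [coindD_coindD, map_zero]

theorem mkQ_mem_ker_modPolD {n : ℕ} {f : (Fin n → G) × G → ℚ} :
    Submodule.mkQ (pol _ ℚ) f ∈ LinearMap.ker (modPolD G n) ↔ coindD n f ∈ pol _ ℚ :=
  Submodule.Quotient.mk_eq_zero _

/-- The contracting homotopy preserves polynomial cochains, so it descends to the quotient complex.
-/
theorem exists_modPolD_eq (n : ℕ) {q} (hq : q ∈ LinearMap.ker (modPolD G (n + 1))) :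
    ∃ q', modPolD G n q' = q := by
  obtain ⟨f, rfl⟩ := Submodule.mkQ_surjective _ q
  have h := coindH_mem_pol _ (mkQ_mem_ker_modPolD.mp hq)
  refine ⟨Submodule.mkQ _ (coindH n f), ?_⟩
  change Submodule.mkQ _ (coindD n (coindH n f)) = _
  rw [← sub_eq_zero, ← map_sub, ← neg_eq_zero, ← map_neg, neg_sub]
  apply (Submodule.Quotient.mk_eq_zero _).mpr
  nth_rewrite 1 [← coindH_coindD_succ n f]
  rwa [add_sub_cancel_left]

/-- With `Cⁿ` the cochains modulo polynomial ones and `Zⁿ` the cocycles, there are exact sequences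
`0 → Zⁿ → Cⁿ → Zⁿ⁺¹ → 0`. Each `Cⁿ` is acyclic and `Z⁰ = 0`. -/
theorem acyclic_ker_modPolD (hG : IsPolGood G) (hfg : IsRootFG G) (n : ℕ) :
    Acyclic (subRep (modPolRep n) (LinearMap.ker (modPolD G n)) (modPolRep_mem_ker n)) := by
  induction n with
  | zero =>
    have : Subsingleton (LinearMap.ker (modPolD G 0)) := by
      rw [Submodule.subsingleton_iff_eq_bot, eq_bot_iff]
      intro q hq
      obtain ⟨f, rfl⟩ := Submodule.mkQ_surjective _ q
      have h := coindH_mem_pol _ (mkQ_mem_ker_modPolD.mp hq)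
      rw [coindH_coindD_zero] at h
      apply (Submodule.Quotient.mk_eq_zero _).mpr
      have h2 := Submodule.add_mem _ h (const_mem_pol (f (default, 1)))
      rwa [sub_add_cancel] at h2
    exact acyclic_of_subsingleton _
  | succ n ih =>
    refine IsShortExact.acyclic (ρB := modPolRep n) (f := Submodule.subtype _)
      (p := (modPolD G n).codRestrict (LinearMap.ker (modPolD G (n + 1))) (modPolD_modPolD n))
      ⟨Submodule.injective_subtype _, ?_, ?_, ?_, fun _ _ => rfl, ?_⟩ ih
      (acyclic_quotientRep (acyclic_leftRep n) _ _ (acyclic_pol_leftRep hG hfg n))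
    · rintro ⟨q, hq⟩
      obtain ⟨q', rfl⟩ := exists_modPolD_eq n hq
      exact ⟨q', rfl⟩
    · rintro ⟨q, hq⟩
      exact Subtype.ext hq
    · intro q hq
      exact ⟨⟨q, congrArg Subtype.val hq⟩, rfl⟩
    · intro g q
      exact Subtype.ext (modPolD_modPolRep n g q)

/-- Cochains modulo polynomial cochains are exact. -/
theorem exists_sub_trivD_mem_pol (hG : IsPolGood G) (hfg : IsRootFG G) (n : ℕ)
    {f : (Fin (n + 1) → G) → ℚ} (hf : trivD (n + 1) f ∈ pol (Fin (n + 2) → G) ℚ) :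
    ∃ h : (Fin n → G) → ℚ, f - trivD n h ∈ pol (Fin (n + 1) → G) ℚ := by
  -- Cochains with trivial coefficients are the coinduced cochains invariant under `leftRep`.
  set f' : (Fin (n + 1) → G) × G → ℚ := fun p => f p.1 with hf'
  have h1 : Submodule.mkQ (pol _ ℚ) f' ∈ LinearMap.ker (modPolD G (n + 1)) := by
    rw [mkQ_mem_ker_modPolD, hf', coindD_comp_fst]
    exact fst_mem_pol hf
  obtain ⟨q, hq⟩ := exists_modPolD_eq n h1
  have h2 : ∀ g, modPolRep n g q - q ∈ LinearMap.ker (modPolD G n) := by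
    intro g
    rw [LinearMap.mem_ker, map_sub, modPolD_modPolRep, hq, sub_eq_zero]
    rfl
  -- The failure of the primitive `q` to be invariant is a crossed homomorphism into the cocycles
  -- modulo polynomials. Since it is principal, subtracting `z` makes `q` invariant modulo
  -- polynomials.
  obtain ⟨z, hz⟩ := (acyclic_ker_modPolD hG hfg n).h1Vanishes (fun g => ⟨_, h2 g⟩)
    fun g g' => Subtype.ext (isCrossed_sub (modPolRep n) q g g')
  obtain ⟨h, hh⟩ := Submodule.mkQ_surjective _ (q - z.1)
  have h3 : ∀ g, leftRep n g h - h ∈ pol ((Fin n → G) × G) ℚ := by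
    intro g
    apply (Submodule.Quotient.mk_eq_zero _).mp
    change modPolRep n g (Submodule.mkQ _ h) - Submodule.mkQ _ h = 0
    have h4 := congrArg Subtype.val (hz g)
    change modPolRep n g q - q = modPolRep n g z - z at h4
    rw [hh, map_sub, sub_sub_sub_comm, h4, sub_self]
  -- A second correction, by a polynomial cochain, achieves strict invariance because `H¹` with
  -- polynomial coefficients vanishes.
  obtain ⟨p, hp⟩ := (acyclic_pol_leftRep hG hfg n).h1Vanishes (fun g => ⟨_, h3 g⟩)
    fun g g' => Subtype.ext (isCrossed_sub (leftRep n) h g g')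
  have h5 : ∀ g a x, h (a, g⁻¹ * x) - h (a, x) = p.1 (a, g⁻¹ * x) - p.1 (a, x) :=
    fun g a x => congrFun (congrArg Subtype.val (hp g)) (a, x)
  refine ⟨fun a => h (a, 1) - p.1 (a, 1), ?_⟩
  apply mem_pol_of_fst (G := G)
  have h6 : (fun x : (Fin n → G) × G => h (x.1, 1) - p.1 (x.1, 1)) = h - p.1 := by
    ext ⟨a, x⟩
    have := h5 x a x
    rw [inv_mul_cancel] at this
    simp only [Pi.sub_apply]
    linarith
  have h7 : (fun x : (Fin (n + 1) → G) × G =>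
      (f - trivD n fun a => h (a, 1) - p.1 (a, 1)) x.1) = f' - coindD n (h - p.1) := by
    rw [← h6]
    rfl
  rw [h7]
  apply (Submodule.Quotient.mk_eq_zero _).mp
  change Submodule.mkQ _ _ = 0
  rw [map_sub, sub_eq_zero]
  change _ = modPolD G n (Submodule.mkQ _ (h - p.1))
  have h8 : Submodule.mkQ (pol ((Fin n → G) × G) ℚ) p.1 = 0 :=
    (Submodule.Quotient.mk_eq_zero _).mpr p.2
  have h9 : modPolD G n z.1 = 0 := z.2
  rw [map_sub, h8, sub_zero, hh, map_sub, h9, sub_zero, hq]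

end Cochains

end QGoodness

namespace QGoodness

/-! ### Extension of polynomial functions to rationalizations -/

section Extension

/-- `f : G → A` is a universal map from `G` to a uniquely divisible group. -/
structure IsRationalization {G A : Type} [Group G] [Group A] (f : G →* A) : Prop where
  uniquelyDivisible : IsUniquelyDivisible A
  rootDense : IsRootDense f
  exists_lift {B : Type} [Group B] (hB : IsUniquelyDivisible B) (φ : G →* B) :
    ∃ ψ : A →* B, ψ.comp f = φ

theorem isRationalization_of (G : Type) [Group G] :
    IsRationalization (Rationalization.of : G →* Rationalization G) :=
  ⟨Rationalization.isUniquelyDivisible G, Rationalization.isRootDense_of,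
    fun hB φ => ⟨Rationalization.lift hB φ, Rationalization.lift_comp_of hB φ⟩⟩

theorem IsRootDense.hom_ext {G A B : Type} [Group G] [Group A] [Group B] {f : G →* A}
    (hf : IsRootDense f) (hB : IsUniquelyDivisible B) {φ ψ : A →* B}
    (h : φ.comp f = ψ.comp f) : φ = ψ := by
  have hK : φ.eqLocus ψ = ⊤ := by
    apply hf
    · exact fun x => DFunLike.congr_fun h x
    · intro n x hx
      apply hB.pow_inj n
      rw [← map_pow, ← map_pow]
      exact hx
  ext x
  have : x ∈ φ.eqLocus ψ := hK ▸ Subgroup.mem_top x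
  exact this

/-! ### Rationalization of finite powers -/

section Pi

variable {ι G A : Type} [Finite ι] [Group G] [Group A] {f : G →* A}

theorem IsRootDense.pi (hf : IsRootDense f) : IsRootDense (f.compLeft ι) := by
  classical
  have := Fintype.ofFinite ι
  intro K hK hr
  have h1 : ∀ i, K.comap (MonoidHom.mulSingle (fun _ : ι => A) i) = ⊤ := by
    intro i
    apply hf
    · intro g
      have := hK (Pi.mulSingle i g)
      rw [Subgroup.mem_comap]
      convert this using 1
      ext j
      simp [Pi.mulSingle_apply, apply_ite f]
    · intro n x hx
      rw [Subgroup.mem_comap] at hx ⊢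
      rw [map_pow] at hx
      exact hr n _ hx
  rw [eq_top_iff]
  intro x _
  refine Subgroup.pi_mem_of_mulSingle_mem x fun i => ?_
  have : x i ∈ K.comap (MonoidHom.mulSingle (fun _ : ι => A) i) := h1 i ▸ Subgroup.mem_top _
  exact this

theorem IsUniquelyDivisible.pi {ι : Type} (hA : IsUniquelyDivisible A) :
    IsUniquelyDivisible (ι → A) := by
  intro n hn
  constructor
  · intro x y h
    ext i
    exact (hA n hn).1 (congrFun h i)
  · intro x
    choose y hy using fun i => (hA n hn).2 (x i)
    exact ⟨y, funext hy⟩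

/-- A homomorphism on a finite power is a family of homomorphisms with commuting images. The
extensions of the family still commute, as centralizers in `B` are root closed. -/
theorem IsRationalization.pi (hf : IsRationalization f) : IsRationalization (f.compLeft ι) := by
  classical
  have := Fintype.ofFinite ι
  refine ⟨hf.1.pi, hf.2.pi, fun {B} _ hB φ => ?_⟩
  choose ψ hψ using fun i => hf.exists_lift hB (φ.comp (MonoidHom.mulSingle (fun _ : ι => G) i))
  have hcomm : ∀ (K : A →* B) (b : B), (∀ g, Commute (K (f g)) b) → ∀ a, Commute (K a) b := by
    intro K b h a
    have h1 : (Subgroup.centralizer {b}).comap K = ⊤ := by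
      apply hf.rootDense
      · intro g
        rw [Subgroup.mem_comap, Subgroup.mem_centralizer_singleton_iff]
        exact (h g).eq
      · intro n x hx
        rw [Subgroup.mem_comap] at hx ⊢
        rw [map_pow] at hx
        exact hB.isRootClosed_centralizer b n _ hx
    have h2 : a ∈ (Subgroup.centralizer {b}).comap K := h1 ▸ Subgroup.mem_top _
    rw [Subgroup.mem_comap, Subgroup.mem_centralizer_singleton_iff] at h2
    exact h2
  have h1 : Pairwise fun i j => ∀ x y, Commute (ψ i x) (ψ j y) := by
    intro i j hij x y
    refine hcomm _ _ (fun g => (hcomm _ _ (fun g' => ?_) y).symm) x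
    rw [← MonoidHom.comp_apply, ← MonoidHom.comp_apply, hψ, hψ]
    exact (Pi.mulSingle_commute hij.symm g' g).map φ
  refine ⟨MonoidHom.noncommPiCoprod ψ h1, ?_⟩
  apply MonoidHom.pi_ext
  intro i g
  have h2 : f.compLeft ι (Pi.mulSingle i g) = Pi.mulSingle i (f g) := by
    ext j
    simp [Pi.mulSingle_apply, apply_ite f]
  rw [MonoidHom.comp_apply, h2, MonoidHom.noncommPiCoprod_mulSingle, ← MonoidHom.comp_apply, hψ]
  rfl

end Pi

variable {G A : Type} [Group G] [Group A] {f : G →* A} {V : Type} [AddCommGroup V] [Module ℚ V]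

/-- By induction on the degree, the increments along the image of `f` vanish. The elements with
vanishing increment form a root closed subgroup, so `F` is constant. -/
theorem IsRootDense.eq_zero_of_mem_polDeg (hf : IsRootDense f) (k : ℕ) {F : A → V}
    (hF : F ∈ polDeg A V k) (h : ∀ g, F (f g) = 0) : F = 0 := by
  induction k generalizing F with
  | zero => exact mem_polDeg_zero.mp hF
  | succ k ih =>
    have h1 : (isCrossed_sub (translation A V) F).preimage ⊥
        (fun g f hf => by rw [Submodule.mem_bot] at hf ⊢; rw [hf, map_zero]) = ⊤ := by
      apply hf
      · intro g
        change _ ∈ (⊥ : Submodule ℚ (A → V))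
        rw [Submodule.mem_bot]
        apply ih (mem_polDeg_succ.mp hF (f g))
        intro g'
        simp only [Pi.sub_apply, translation_apply]
        rw [← map_mul, h, h, sub_zero]
      · intro n x hx
        exact sub_mem_of_pow ⊥
          (fun g f hf => by rw [Submodule.mem_bot] at hf ⊢; rw [hf, map_zero]) k
          (mem_polDeg_succ.mp hF x) hx
    ext x
    have h2 : x ∈ (isCrossed_sub (translation A V) F).preimage ⊥ _ := h1 ▸ Subgroup.mem_top x
    have h3 := congrFun ((Submodule.mem_bot ℚ).mp h2) 1
    simp only [Pi.sub_apply, translation_apply, one_mul] at h3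
    rw [sub_eq_zero.mp h3, ← map_one f, h]
    rfl

theorem IsRootDense.eq_of_mem_pol (hf : IsRootDense f) {F F' : A → V} (hF : F ∈ pol A V)
    (hF' : F' ∈ pol A V) (h : ∀ g, F (f g) = F' (f g)) : F = F' := by
  obtain ⟨k, hk⟩ := Submodule.sub_mem _ hF hF'
  exact sub_eq_zero.mp (hf.eq_zero_of_mem_polDeg k hk fun g => sub_eq_zero.mpr (h g))

/-- The action on a module, as automorphisms of its additive group. -/
def repMulAut {W : Type} [AddCommGroup W] [Module ℚ W] (ρ : Representation ℚ A W) :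
    A →* MulAut (Multiplicative W) where
  toFun a :=
    { toFun := fun w => Multiplicative.ofAdd (ρ a w.toAdd)
      invFun := fun w => Multiplicative.ofAdd (ρ a⁻¹ w.toAdd)
      left_inv := fun w => by simp
      right_inv := fun w => by simp
      map_mul' := fun w w' => by simp }
  map_one' := by ext; simp
  map_mul' a b := by ext; simp

theorem repMulAut_apply {W : Type} [AddCommGroup W] [Module ℚ W] (ρ : Representation ℚ A W)
    (a : A) (w : Multiplicative W) :
    repMulAut ρ a w = Multiplicative.ofAdd (ρ a w.toAdd) := rfl

/-- The polynomial `1 + X + ⋯ + Xⁿ⁻¹` has the nonzero value `n` at `1`, so it is coprime to `(X -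
1)ᵏ` and its value at `T` is invertible. -/
theorem bijective_geom_sum_of_unipotent {W : Type} [AddCommGroup W] [Module ℚ W] {T : W →ₗ[ℚ] W}
    {k : ℕ} (hT : (T - 1) ^ k = 0) {n : ℕ} (hn : n ≠ 0) :
    Function.Bijective (∑ i ∈ Finset.range n, T ^ i : W →ₗ[ℚ] W) := by
  have h1 : IsCoprime (∑ i ∈ Finset.range n, (Polynomial.X : Polynomial ℚ) ^ i)
      ((Polynomial.X - Polynomial.C 1) ^ k) := by
    refine (IsCoprime.pow_left ?_).symm
    rw [(Polynomial.irreducible_X_sub_C (1 : ℚ)).coprime_iff_not_dvd, Polynomial.dvd_iff_isRoot]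
    simp [Polynomial.IsRoot, Polynomial.eval_finsetSum, hn]
  obtain ⟨a, b, hab⟩ := h1
  have h2 := congrArg (Polynomial.aeval T) hab
  simp only [map_add, map_mul, map_sum, map_pow, Polynomial.aeval_X, map_sub, map_one] at h2
  rw [hT, mul_zero, add_zero] at h2
  have h3 : Commute (Polynomial.aeval T a) (∑ i ∈ Finset.range n, T ^ i) := by
    have h := Commute.all a (∑ i ∈ Finset.range n, (Polynomial.X : Polynomial ℚ) ^ i)
    have := h.map (Polynomial.aeval T)
    simpa using this
  constructor
  · intro x y h
    have := congrArg (Polynomial.aeval T a) h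
    rw [← Module.End.mul_apply, ← Module.End.mul_apply, h2] at this
    exact this
  · intro x
    refine ⟨Polynomial.aeval T a x, ?_⟩
    rw [← Module.End.mul_apply, ← h3.eq, h2]
    rfl

/-- The `n`-th power of `(w, a)` is `((1 + T + ⋯ + Tⁿ⁻¹) w, aⁿ)` with `T = ρ a` unipotent, so roots
are found first in `A` and then in `W`. -/
theorem IsUniquelyDivisible.semidirectProduct (hA : IsUniquelyDivisible A) {W : Type}
    [AddCommGroup W] [Module ℚ W] (ρ : Representation ℚ A W) {k : ℕ}
    (hρ : ∀ a, (ρ a - 1) ^ k = 0) :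
    IsUniquelyDivisible (Multiplicative W ⋊[repMulAut ρ] A) := by
  have h1 : ∀ (x : Multiplicative W ⋊[repMulAut ρ] A) (n : ℕ), x ^ n =
      ⟨Multiplicative.ofAdd ((∑ i ∈ Finset.range n, ρ x.right ^ i) x.left.toAdd), x.right ^ n⟩ := by
    intro x n
    induction n with
    | zero => simp
    | succ n ih =>
      rw [pow_succ, ih]
      refine SemidirectProduct.ext ?_ (pow_succ _ _).symm
      rw [SemidirectProduct.mul_left, repMulAut_apply, Finset.sum_range_succ, map_pow,
        LinearMap.add_apply]
      rfl
  intro n hn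
  constructor
  · intro x y h
    simp only [h1] at h
    have h2 : x.right = y.right := (hA n hn).1 (congrArg SemidirectProduct.right h)
    have h3 := congrArg SemidirectProduct.left h
    simp only [h2] at h3
    have h4 := (bijective_geom_sum_of_unipotent (hρ y.right) hn).1
      (Multiplicative.ofAdd.injective h3)
    exact SemidirectProduct.ext (Multiplicative.toAdd.injective h4) h2
  · intro x
    obtain ⟨r, hr⟩ := (hA n hn).2 x.right
    obtain ⟨m, hm⟩ := (bijective_geom_sum_of_unipotent (hρ r) hn).2 x.left.toAdd
    refine ⟨⟨Multiplicative.ofAdd m, r⟩, ?_⟩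
    simp only [h1]
    exact SemidirectProduct.ext (congrArg Multiplicative.ofAdd hm) hr

theorem translation_sub_one_pow {k l : ℕ} (a : A) {F : A → V} (hF : F ∈ polDeg A V (k + l)) :
    ((translation A V a - 1) ^ k) F ∈ polDeg A V l := by
  induction k generalizing F with
  | zero => simpa using hF
  | succ k ih =>
    rw [pow_succ, Module.End.mul_apply]
    apply ih
    rw [Nat.succ_add_eq_add_succ] at hF
    exact mem_polDeg_succ.mp hF a

/-- Polynomial functions extend to rationalizations. -/
theorem IsRationalization.exists_extension (hf : IsRationalization f) (k : ℕ) {F : G → V}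
    (hF : F ∈ polDeg G V k) : ∃ F' ∈ polDeg A V k, ∀ g, F' (f g) = F g := by
  induction k generalizing F with
  | zero =>
    rw [mem_polDeg_zero] at hF
    exact ⟨0, Submodule.zero_mem _, fun g => by rw [hF]; rfl⟩
  | succ k ih =>
    choose c hc hcf using fun g => ih (mem_polDeg_succ.mp hF g)
    let ρ := subRep (translation A V) (polDeg A V k) translation_mem_polDeg
    have hρ : ∀ a, (ρ a - 1) ^ k = 0 := by
      intro a
      have h1 : ∀ (n : ℕ) (x : polDeg A V k),
          (((ρ a - 1) ^ n) x : A → V) = ((translation A V a - 1) ^ n) x := by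
        intro n
        induction n with
        | zero => intro x; rfl
        | succ n ih =>
          intro x
          rw [pow_succ, pow_succ, Module.End.mul_apply, Module.End.mul_apply, ih]
          rfl
      ext x
      rw [h1]
      have := translation_sub_one_pow (l := 0) a x.2
      rw [mem_polDeg_zero.mp this]
      rfl
    have hcc : ∀ g g', c (g * g') = c g + translation A V (f g) (c g') := by
      intro g g'
      refine hf.rootDense.eq_of_mem_pol ⟨k, hc _⟩
        ⟨k, Submodule.add_mem _ (hc _) (translation_mem_polDeg _ _ (hc _))⟩ fun x => ?_
      rw [Pi.add_apply, translation_apply, ← map_mul, hcf, hcf, hcf]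
      simp [mul_assoc]
    -- The extended increments form a crossed homomorphism along `f`, by uniqueness of extensions.
    -- This amounts to a homomorphism into a semidirect product, which is uniquely divisible, so the
    -- universal property extends it to `A`.
    let φ : G →* Multiplicative (polDeg A V k) ⋊[repMulAut ρ] A :=
      MonoidHom.mk' (fun g => ⟨Multiplicative.ofAdd ⟨c g, hc g⟩, f g⟩) fun g g' => by
        ext1
        · exact congrArg Multiplicative.ofAdd (Subtype.ext (hcc g g'))
        · exact map_mul f g g'
    obtain ⟨ψ, hψ⟩ := hf.exists_lift (hf.uniquelyDivisible.semidirectProduct ρ hρ) φ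
    have h1 : SemidirectProduct.rightHom.comp ψ = MonoidHom.id A := by
      apply hf.rootDense.hom_ext hf.uniquelyDivisible
      rw [MonoidHom.comp_assoc, hψ]
      rfl
    have hr : ∀ a, (ψ a).right = a := fun a => DFunLike.congr_fun h1 a
    have hl : ∀ a b, ((ψ (a * b)).left.toAdd : A → V) =
        (ψ a).left.toAdd + translation A V a (ψ b).left.toAdd := by
      intro a b
      rw [map_mul, SemidirectProduct.mul_left, hr]
      rfl
    -- The extension is recovered from its value at `1` and its increment along `a` evaluated at
    -- `1`.
    refine ⟨fun a => F 1 + ((ψ a).left.toAdd : A → V) 1, ?_, ?_⟩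
    · rw [mem_polDeg_succ]
      intro a
      convert (ψ a).left.toAdd.2 using 1
      ext x
      simp only [Pi.sub_apply, translation_apply]
      rw [hl, Pi.add_apply, translation_apply, one_mul]
      abel
    · intro g
      have h2 : ψ (f g) = φ g := DFunLike.congr_fun hψ g
      change F 1 + ((ψ (f g)).left.toAdd : A → V) 1 = F g
      rw [h2]
      change F 1 + c g 1 = F g
      rw [← map_one f, hcf]
      simp

/-- A function of degree less than `k` is invariant under the `k`-th term of the lower central
series, which for a finite power is taken entrywise. It descends to the quotients and then extends
to their rationalization. -/
theorem exists_polDeg_malcev (G : Type) [Group G] {ι : Type} [Finite ι] {k : ℕ} {F : (ι → G) → ℚ}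
    (hF : F ∈ polDeg (ι → G) ℚ k) :
    ∃ F' ∈ polDeg (ι → Rationalization (LcsQuotient G k)) ℚ k,
      ∀ g : ι → G, F' (fun i => toMalcev G k (g i)) = F g := by
  have h1 : ∀ g γ : ι → G, (∀ i, γ i ∈ (⊤ : Subgroup G).lowerCentralSeries k) →
      F (g * γ) = F g := by
    intro g γ hγ
    have h2 : γ ∈ (⊤ : Subgroup (ι → G)).lowerCentralSeries k := by
      rw [Subgroup.top_lowerCentralSeries_pi_of_finite]
      exact fun i _ => hγ i
    have h3 := sub_mem_polDeg_of_mem_lowerCentralSeries h2 (k := 0) (f := F)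
      (polDeg_mono (by omega) hF)
    exact sub_eq_zero.mp (congrFun (mem_polDeg_zero.mp h3) g)
  let π : (ι → G) →* ι → LcsQuotient G k := (QuotientGroup.mk' _).compLeft ι
  have hπ : Function.Surjective π := (QuotientGroup.mk'_surjective _).comp_left
  have h2 : ∀ g g', π g = π g' → F g = F g' := by
    intro g g' h
    rw [← h1 g (g⁻¹ * g') fun i => QuotientGroup.eq.mp (congrFun h i), mul_inv_cancel_left]
  have h3 : ∀ g, F (Function.surjInv hπ (π g)) = F g := fun g =>
    h2 _ _ (Function.surjInv_eq hπ _)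
  have h4 : (fun x => F (Function.surjInv hπ x)) ∈ polDeg (ι → LcsQuotient G k) ℚ k := by
    apply mem_polDeg_of_comp_surjective hπ
    simpa only [h3] using hF
  obtain ⟨F', hF', h5⟩ := (isRationalization_of (LcsQuotient G k)).pi.exists_extension k h4
  exact ⟨F', hF', fun g => (h5 (π g)).trans (h3 g)⟩

theorem isRootDense_toMalcev (G : Type) [Group G] (k : ℕ) : IsRootDense (toMalcev G k) := by
  intro K hK hr
  apply Rationalization.isRootDense_of K _ hr
  intro x
  obtain ⟨x, rfl⟩ := QuotientGroup.mk'_surjective _ x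
  exact hK x

end Extension

end QGoodness

namespace QGoodness

/-! ### Rational cohomology classes -/

section RatClass

variable {G H : Type} [Group G] [Group H]

theorem trivD_trivD (n : ℕ) (f : (Fin n → G) → ℚ) : trivD (n + 1) (trivD n f) = 0 := by
  have h := coindD_coindD n (fun p : (Fin n → G) × G => f p.1)
  ext g
  exact congrFun h (g, 1)

theorem trivD_mem_pol (n : ℕ) {f : (Fin n → G) → ℚ} (hf : f ∈ pol (Fin n → G) ℚ) :
    trivD n f ∈ pol (Fin (n + 1) → G) ℚ :=
  mem_pol_of_fst (coindD_mem_pol n (fst_mem_pol hf))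

theorem trivD_comp (φ : G →* H) (n : ℕ) (f : (Fin n → H) → ℚ) :
    trivD n (fun g => f (φ ∘ g)) = fun g => trivD n f (φ ∘ g) := by
  ext g
  simp only [trivD_apply, Fin.comp_contractNth, map_mul]
  rfl

/-- `f` is a coboundary. -/
def IsTrivCoboundary : ∀ n : ℕ, ((Fin n → G) → ℚ) → Prop
  | 0, f => f = 0
  | n + 1, f => ∃ h, trivD n h = f

theorem d_trivial (n : ℕ) (f : (Fin n → G) → ℚ) :
    (inhomogeneousCochains.d (Rep.trivial ℚ G ℚ) n).hom f = trivD n f := by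
  ext g
  rw [inhomogeneousCochains.d_hom_apply, trivD_apply]
  rfl

/-- The class of a cocycle in rational cohomology. -/
noncomputable def ratClass {n : ℕ} (f : (Fin n → G) → ℚ) (hf : trivD n f = 0) :
    (ratCohomology n).obj (op (GrpCat.of G)) :=
  (groupCohomology.π (Rep.trivial ℚ G ℚ) n).hom
    (groupCohomology.cocyclesMk (A := Rep.trivial ℚ G ℚ) f ((d_trivial n f).trans hf))

theorem exists_ratClass {n : ℕ} (x : (ratCohomology n).obj (op (GrpCat.of G))) :
    ∃ (f : (Fin n → G) → ℚ) (hf : trivD n f = 0), ratClass f hf = x := by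
  refine groupCohomology_induction_on (A := Rep.trivial ℚ G ℚ) x fun z => ?_
  let f : (Fin n → G) → ℚ := (groupCohomology.iCocycles (Rep.trivial ℚ G ℚ) n).hom z
  have hf : trivD n f = 0 := by
    rw [← d_trivial, ← groupCohomology.inhomogeneousCochains.d_def]
    have := (groupCohomology.inhomogeneousCochains (Rep.trivial ℚ G ℚ)).iCycles_d n (n + 1)
    exact congrArg (fun φ => φ.hom z) this
  refine ⟨f, hf, congrArg (groupCohomology.π (Rep.trivial ℚ G ℚ) n).hom ?_⟩
  apply (ModuleCat.mono_iff_injective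
    (groupCohomology.iCocycles (Rep.trivial ℚ G ℚ) n)).mp inferInstance
  exact groupCohomology.iCocycles_mk (A := Rep.trivial ℚ G ℚ) f ((d_trivial n f).trans hf)

theorem ratClass_eq_zero_iff {n : ℕ} {f : (Fin n → G) → ℚ} (hf : trivD n f = 0) :
    ratClass f hf = 0 ↔ IsTrivCoboundary n f := by
  let K := groupCohomology.inhomogeneousCochains (Rep.trivial ℚ G ℚ)
  let i := (ComplexShape.up ℕ).prev n
  have hex : (ShortComplex.mk (K.toCycles i n) (K.homologyπ n)
      (K.toCycles_comp_homologyπ i n)).Exact :=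
    ShortComplex.exact_of_g_is_cokernel _ (K.homologyIsCokernel i n rfl)
  have h1 : ratClass f hf = 0 ↔ ∃ y, (K.d i n).hom y = f := by
    rw [ShortComplex.moduleCat_exact_iff] at hex
    constructor
    · intro h
      obtain ⟨y, hy⟩ := hex _ h
      refine ⟨y, ?_⟩
      have h2 := congrArg (K.iCycles n).hom hy
      have h3 := congrArg (fun φ => φ.hom y) (K.toCycles_i i n)
      refine (h3.symm.trans h2).trans ?_
      exact groupCohomology.iCocycles_mk (A := Rep.trivial ℚ G ℚ) f ((d_trivial n f).trans hf)
    · rintro ⟨y, hy⟩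
      have h2 : (K.toCycles i n).hom y =
          groupCohomology.cocyclesMk (A := Rep.trivial ℚ G ℚ) f ((d_trivial n f).trans hf) := by
        apply (ModuleCat.mono_iff_injective (K.iCycles n)).mp inferInstance
        refine (congrArg (fun φ => φ.hom y) (K.toCycles_i i n)).trans (hy.trans ?_)
        exact (groupCohomology.iCocycles_mk (A := Rep.trivial ℚ G ℚ) f
          ((d_trivial n f).trans hf)).symm
      have h3 := congrArg (fun φ => φ.hom y) (K.toCycles_comp_homologyπ i n)
      rw [ratClass, ← h2]
      exact h3
  rw [h1]
  cases n with
  | zero =>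
    -- There is no differential into degree `0`, so only the zero cochain is a coboundary there.
    have h2 : K.d i 0 = 0 := K.shape _ _ (by simp [i])
    rw [h2]
    exact ⟨fun ⟨_, h⟩ => h.symm, fun h => ⟨0, h.symm⟩⟩
  | succ m =>
    have h2 : i = m := by simp [i]
    clear_value i
    subst h2
    have h3 : ∀ y, (K.d i (i + 1)).hom y = trivD i y := fun y => by
      rw [← d_trivial, ← groupCohomology.inhomogeneousCochains.d_def]
    simp only [h3]
    rfl

theorem ratCohomology_map_ratClass (φ : G →* H) {n : ℕ} (f : (Fin n → H) → ℚ)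
    (hf : trivD n f = 0) :
    (ratCohomology n).map (GrpCat.ofHom φ).op (ratClass f hf) =
      ratClass (fun g => f (φ ∘ g)) (by rw [trivD_comp, hf]; rfl) := by
  have h1 := groupCohomology.π_map_apply (A := Rep.trivial ℚ H ℚ) (B := Rep.trivial ℚ G ℚ) φ
    (𝟙 (Rep.trivial ℚ G ℚ)) n
    (groupCohomology.cocyclesMk (A := Rep.trivial ℚ H ℚ) f ((d_trivial n f).trans hf))
  refine h1.trans (congrArg (groupCohomology.π (Rep.trivial ℚ G ℚ) n).hom ?_)
  apply (ModuleCat.mono_iff_injective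
    (groupCohomology.iCocycles (Rep.trivial ℚ G ℚ) n)).mp inferInstance
  refine Eq.trans ?_ (groupCohomology.iCocycles_mk (A := Rep.trivial ℚ G ℚ) _ _).symm
  have h2 := HomologicalComplex.cyclesMap_i (groupCohomology.cochainsMap (A := Rep.trivial ℚ H ℚ)
    (B := Rep.trivial ℚ G ℚ) φ (𝟙 (Rep.trivial ℚ G ℚ))) n
  refine (congrArg (fun ψ => ψ.hom (groupCohomology.cocyclesMk (A := Rep.trivial ℚ H ℚ) f
    ((d_trivial n f).trans hf))) h2).trans ?_
  have h3 := groupCohomology.iCocycles_mk (A := Rep.trivial ℚ H ℚ) f ((d_trivial n f).trans hf)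
  exact congrArg ((groupCohomology.cochainsMap (A := Rep.trivial ℚ H ℚ)
    (B := Rep.trivial ℚ G ℚ) φ (𝟙 (Rep.trivial ℚ G ℚ))).f n).hom h3

theorem ratClass_add {n : ℕ} (f f' : (Fin n → G) → ℚ) (hf : trivD n f = 0) (hf' : trivD n f' = 0) :
    ratClass f hf + ratClass f' hf' = ratClass (f + f') (by rw [map_add, hf, hf', add_zero]) := by
  refine (map_add (groupCohomology.π (Rep.trivial ℚ G ℚ) n).hom _ _).symm.trans ?_
  refine congrArg (groupCohomology.π (Rep.trivial ℚ G ℚ) n).hom ?_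
  apply (ModuleCat.mono_iff_injective
    (groupCohomology.iCocycles (Rep.trivial ℚ G ℚ) n)).mp inferInstance
  refine Eq.trans ?_ (groupCohomology.iCocycles_mk (A := Rep.trivial ℚ G ℚ) _ _).symm
  refine (map_add _ _ _).trans ?_
  exact congrArg₂ _ (groupCohomology.iCocycles_mk (A := Rep.trivial ℚ G ℚ) _ _)
    (groupCohomology.iCocycles_mk (A := Rep.trivial ℚ G ℚ) _ _)

end RatClass

/-! ### Cocycles and coboundaries in the Malcev tower -/

section Tower

variable (G : Type) [Group G]

theorem malcev_polynomial_ext {G : Type} [Group G] {n k : ℕ}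
    {F F' : (Fin n → Rationalization (LcsQuotient G k)) → ℚ} (hF : F ∈ pol _ ℚ)
    (hF' : F' ∈ pol _ ℚ) (h : ∀ g : Fin n → G, F (toMalcev G k ∘ g) = F' (toMalcev G k ∘ g)) :
    F = F' :=
  (isRootDense_toMalcev G k).pi.eq_of_mem_pol hF hF' h

variable {G}

/-- A cocycle is cohomologous to a polynomial one, which extends to some stage. The extension is
again a cocycle because a polynomial vanishing on the image of `G` vanishes. -/
theorem exists_malcev_cocycle (hG : IsPolGood G) (hfg : IsRootFG G) (n : ℕ)
    {f : (Fin n → G) → ℚ} (hf : trivD n f = 0) :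
    ∃ (k : ℕ) (F : (Fin n → Rationalization (LcsQuotient G k)) → ℚ), trivD n F = 0 ∧
      IsTrivCoboundary n (f - fun g => F (toMalcev G k ∘ g)) := by
  cases n with
  | zero =>
    refine ⟨0, fun _ => f default, ?_, ?_⟩
    · ext g
      simp [trivD_apply]
    · change _ = _
      ext g
      simp [Subsingleton.elim g default]
  | succ m =>
    obtain ⟨h, k, hk⟩ := exists_sub_trivD_mem_pol hG hfg m (hf ▸ Submodule.zero_mem _)
    obtain ⟨F, hF, hFk⟩ := exists_polDeg_malcev G hk
    refine ⟨k, F, ?_, h, ?_⟩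
    · apply malcev_polynomial_ext (trivD_mem_pol _ ⟨k, hF⟩) (Submodule.zero_mem _)
      intro g
      have h1 := congrFun (trivD_comp (toMalcev G k) (m + 1) F) g
      have h2 : (fun g => F (toMalcev G k ∘ g)) = f - trivD m h := funext hFk
      rw [h2, map_sub, hf, trivD_trivD, sub_zero] at h1
      exact h1.symm
    · have h2 : (fun g => F (toMalcev G k ∘ g)) = f - trivD m h := funext hFk
      rw [h2, sub_sub_cancel]

theorem exists_mem_pol_trivD_eq (hG : IsPolGood G) (hfg : IsRootFG G) (n : ℕ)
    {h : (Fin n → G) → ℚ} (hh : trivD n h ∈ pol (Fin (n + 1) → G) ℚ) :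
    ∃ h' ∈ pol (Fin n → G) ℚ, trivD n h' = trivD n h := by
  cases n with
  | zero =>
    refine ⟨h, ?_, rfl⟩
    have : h = fun _ => h default := funext fun g => by rw [Subsingleton.elim g default]
    rw [this]
    exact const_mem_pol _
  | succ m =>
    obtain ⟨h', hh'⟩ := exists_sub_trivD_mem_pol hG hfg m hh
    exact ⟨_, hh', by rw [map_sub, trivD_trivD, sub_zero]⟩

/-- Goodness of the stage replaces `F` by a cohomologous polynomial cocycle. On `G` this bounds,
hence bounds a polynomial cochain, by goodness of `G`. That cochain extends to a stage determined by
its degree, and the equation extends by uniqueness. -/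
theorem exists_malcev_coboundary [Group.FG G] (hG : IsPolGood G) (n k : ℕ)
    {F : (Fin n → Rationalization (LcsQuotient G k)) → ℚ} (hF : trivD n F = 0)
    (hFG : IsTrivCoboundary n fun g => F (toMalcev G k ∘ g)) :
    ∃ (l : ℕ) (h : k ≤ l), IsTrivCoboundary n fun g => F (malcevTransition G h ∘ g) := by
  cases n with
  | zero =>
    refine ⟨k, le_rfl, ?_⟩
    change _ = _
    ext g
    have := congrFun hFG default
    rw [Subsingleton.elim (_ ∘ g) (toMalcev G k ∘ default)]
    exact this
  | succ m =>
    obtain ⟨h0, hp⟩ := exists_sub_trivD_mem_pol (isPolGood_malcev G k) (isRootFG_malcev G k) m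
      (hF ▸ Submodule.zero_mem _)
    obtain ⟨h, hh⟩ := hFG
    have hpull : ∀ {l : ℕ} {A : Type} [Group A] (φ : A →* Rationalization (LcsQuotient G l))
        {F : (Fin (m + 1) → Rationalization (LcsQuotient G l)) → ℚ}, F ∈ pol _ ℚ →
        (fun g => F (φ ∘ g)) ∈ pol (Fin (m + 1) → A) ℚ := fun φ F hF =>
      comp_mem_pol (φ.compLeft (Fin (m + 1))) (fun _ => 1) (φ.compLeft _) (fun x γ => by simp) hF
    have h1 : trivD m (h - fun g => h0 (toMalcev G k ∘ g)) =
        fun g => (F - trivD m h0) (toMalcev G k ∘ g) := by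
      rw [map_sub, hh, trivD_comp]
      rfl
    obtain ⟨h2, ⟨l, hl⟩, h3⟩ := exists_mem_pol_trivD_eq hG isRootFG_of_fg m
      (h := h - fun g => h0 (toMalcev G k ∘ g)) (h1 ▸ hpull (toMalcev G k) hp)
    have hkl : k ≤ max k l := le_max_left k l
    obtain ⟨h4, h4m, h4e⟩ := exists_polDeg_malcev G (polDeg_mono (le_max_right k l) hl)
    refine ⟨max k l, hkl, h4 + fun g => h0 (malcevTransition G hkl ∘ g), ?_⟩
    have h5 : trivD m h4 = fun g => (F - trivD m h0) (malcevTransition G hkl ∘ g) := by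
      apply malcev_polynomial_ext (trivD_mem_pol m ⟨_, h4m⟩) (hpull (malcevTransition G hkl) hp)
      intro g
      have h6 := congrFun (trivD_comp (toMalcev G (max k l)) m h4) g
      have h7 : (fun g => h4 (toMalcev G (max k l) ∘ g)) = h2 := funext h4e
      rw [h7, h3, h1] at h6
      exact h6.symm
    rw [map_add, h5, trivD_comp]
    ext g
    simp

end Tower

/-! ### Completions -/

section Completion

/-- Filtered colimits of modules are computed on underlying sets, and linearity reduces injectivity
to the kernel. -/
theorem isRatCohomologyIso_of_bijective {J : Type} [SmallCategory J] [IsCofiltered J]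
    {X : J ⥤ GrpCat.{0}} (c : Limits.Cone X)
    (hsurj : ∀ (i : ℕ) (x : (ratCohomology i).obj (op c.pt)),
      ∃ (j : J) (y : (ratCohomology i).obj (op (X.obj j))),
        (ratCohomology i).map (c.π.app j).op y = x)
    (hinj : ∀ (i : ℕ) (j : J) (y : (ratCohomology i).obj (op (X.obj j))),
      (ratCohomology i).map (c.π.app j).op y = 0 →
        ∃ (j' : J) (f : j' ⟶ j), (ratCohomology i).map (X.map f).op y = 0) :
    IsRatCohomologyIso c := by
  intro i
  have : Limits.ReflectsColimitsOfShape Jᵒᵖ (forget (ModuleCat.{0} ℚ)) :=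
    Limits.reflectsColimitsOfShape_of_reflectsIsomorphisms
  refine ⟨Limits.isColimitOfReflects (forget (ModuleCat.{0} ℚ)) ?_⟩
  refine Limits.Types.FilteredColimit.isColimitOf' _ _ ?_ ?_
  · intro x
    obtain ⟨j, y, h⟩ := hsurj i x
    exact ⟨op j, y, h.symm⟩
  · intro j y y' h
    obtain ⟨j', f, hf⟩ := hinj i j.unop (y - y') (by
      rw [map_sub, sub_eq_zero]
      exact h)
    rw [map_sub, sub_eq_zero] at hf
    exact ⟨op j', f.op, hf⟩

theorem IsRatCohomologyIso.surjective {J : Type} [SmallCategory J] [IsCofiltered J]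
    {X : J ⥤ GrpCat.{0}} {c : Limits.Cone X} (h : IsRatCohomologyIso c) (i : ℕ)
    (x : (ratCohomology i).obj (op c.pt)) :
    ∃ (j : J) (y : (ratCohomology i).obj (op (X.obj j))),
      (ratCohomology i).map (c.π.app j).op y = x := by
  obtain ⟨h⟩ := h i
  obtain ⟨j, y, hy⟩ := Limits.Types.jointly_surjective_of_isColimit
    (Limits.isColimitOfPreserves (forget (ModuleCat.{0} ℚ)) h) x
  exact ⟨j.unop, y, hy⟩

theorem IsRatCohomologyIso.injective {J : Type} [SmallCategory J] [IsCofiltered J]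
    {X : J ⥤ GrpCat.{0}} {c : Limits.Cone X} (h : IsRatCohomologyIso c) (i : ℕ)
    (j : J) (y : (ratCohomology i).obj (op (X.obj j)))
    (hy : (ratCohomology i).map (c.π.app j).op y = 0) :
    ∃ (j' : J) (f : j' ⟶ j), (ratCohomology i).map (X.map f).op y = 0 := by
  obtain ⟨h⟩ := h i
  have h0 : (ratCohomology i).map (c.π.app j).op 0 = 0 := map_zero _
  obtain ⟨j', f, hf⟩ := (Limits.Types.FilteredColimit.isColimit_eq_iff'
    (Limits.isColimitOfPreserves (forget (ModuleCat.{0} ℚ)) h) (i := op j) y 0).mp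
      (hy.trans h0.symm)
  have h1 : (ratCohomology i).map (X.map f.unop).op 0 = 0 := map_zero _
  exact ⟨j'.unop, f.unop, Eq.trans hf h1⟩

theorem ratCohomology_map_map {G H K : GrpCat.{0}} (f : G ⟶ H) (g : H ⟶ K) (i : ℕ)
    (x : (ratCohomology i).obj (op K)) :
    (ratCohomology i).map f.op ((ratCohomology i).map g.op x) =
      (ratCohomology i).map (f ≫ g).op x := by
  rw [op_comp, Functor.map_comp, ConcreteCategory.comp_apply]

theorem IsQCompletion.exists_factor {J : Type} [SmallCategory J] {X : J ⥤ GrpCat.{0}}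
    {c : Limits.Cone X} (h : IsQCompletion c) {N : GrpCat.{0}} (hN : IsQUnipotent N)
    (φ : c.pt ⟶ N) : ∃ (j : J) (ψ : X.obj j ⟶ N), c.π.app j ≫ ψ = φ := by
  obtain ⟨h⟩ := h.bijective N hN
  obtain ⟨j, y, hy⟩ := Limits.Types.jointly_surjective_of_isColimit h φ
  exact ⟨j.unop, y, hy⟩

theorem IsQCompletion.exists_map_eq {J : Type} [SmallCategory J] {X : J ⥤ GrpCat.{0}}
    {c : Limits.Cone X} (h : IsQCompletion c) {N : GrpCat.{0}} (hN : IsQUnipotent N) {j : J}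
    {ψ ψ' : X.obj j ⟶ N} (hψ : c.π.app j ≫ ψ = c.π.app j ≫ ψ') :
    ∃ (j' : J) (f : j' ⟶ j), X.map f ≫ ψ = X.map f ≫ ψ' := by
  have := h.isCofiltered
  obtain ⟨h⟩ := h.bijective N hN
  obtain ⟨j', f, hf⟩ := (Limits.Types.FilteredColimit.isColimit_eq_iff' h (i := op j) ψ ψ').mp hψ
  exact ⟨j'.unop, f.unop, hf⟩

theorem isQCompletion_of_bijective {J : Type} [SmallCategory J] [IsCofiltered J]
    {X : J ⥤ GrpCat.{0}} {c : Limits.Cone X} (hX : ∀ j, IsQUnipotent (X.obj j))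
    (hsurj : ∀ (N : GrpCat.{0}) (_ : IsQUnipotent N) (φ : c.pt ⟶ N),
      ∃ (j : J) (ψ : X.obj j ⟶ N), c.π.app j ≫ ψ = φ)
    (hinj : ∀ (N : GrpCat.{0}) (_ : IsQUnipotent N) (j : J) (ψ ψ' : X.obj j ⟶ N),
      c.π.app j ≫ ψ = c.π.app j ≫ ψ' → ψ = ψ') : IsQCompletion c := by
  refine ⟨inferInstance, hX, fun N hN => ⟨?_⟩⟩
  refine Limits.Types.FilteredColimit.isColimitOf' _ _ ?_ ?_
  · intro φ
    obtain ⟨j, ψ, h⟩ := hsurj N hN φ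
    exact ⟨op j, ψ, h.symm⟩
  · intro j ψ ψ' h
    exact ⟨j, 𝟙 j, congrArg _ (hinj N hN j.unop ψ ψ' h)⟩

/-- Whether `BG ⟶ B(G^)` is a rational cohomology isomorphism does not depend on the diagram
representing the completion. -/
theorem IsRatCohomologyIso.of_isQCompletion {G : GrpCat.{0}} {I J : Type} [SmallCategory I]
    [SmallCategory J] {Y : I ⥤ GrpCat.{0}} {X : J ⥤ GrpCat.{0}}
    {ρ : (Functor.const I).obj G ⟶ Y} {π : (Functor.const J).obj G ⟶ X}
    (hρ : IsQCompletion (Limits.Cone.mk G ρ)) (hπ : IsQCompletion (Limits.Cone.mk G π))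
    (h : IsRatCohomologyIso (Limits.Cone.mk G ρ)) : IsRatCohomologyIso (Limits.Cone.mk G π) := by
  have := hρ.isCofiltered
  have := hπ.isCofiltered
  apply isRatCohomologyIso_of_bijective
  · intro i x
    -- Every stage of either diagram is `ℚ`-unipotent, so the map from `G` to it factors through a
    -- stage of the other diagram. Classes are transported along these factorizations.
    obtain ⟨k, y, hy⟩ := h.surjective i x
    obtain ⟨j, ψ, hψ⟩ := hπ.exists_factor (hρ.isQUnipotent k) (ρ.app k)
    refine ⟨j, (ratCohomology i).map ψ.op y, ?_⟩
    rw [ratCohomology_map_map, hψ]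
    exact hy
  · intro i j y hy
    obtain ⟨k, ψ, hψ⟩ := hρ.exists_factor (hπ.isQUnipotent j) (π.app j)
    obtain ⟨l, f, hf⟩ := h.injective i k ((ratCohomology i).map ψ.op y) (by
      rw [ratCohomology_map_map, hψ]
      exact hy)
    obtain ⟨j', θ, hθ⟩ := hπ.exists_factor (hρ.isQUnipotent l) (ρ.app l)
    have h1 := π.naturality (IsCofiltered.minToLeft j j')
    have h2 := π.naturality (IsCofiltered.minToRight j j')
    have h3 := ρ.naturality f
    simp only [Functor.const_obj_obj, Functor.const_obj_map, Category.id_comp] at h1 h2 h3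
    -- The transition map to `X j` and the detour through `Y` agree on `G`, hence agree after
    -- passing to a further stage. The detour kills `y`.
    obtain ⟨m, a, ha⟩ := hπ.exists_map_eq (hπ.isQUnipotent j) (j := IsCofiltered.min j j')
      (ψ := X.map (IsCofiltered.minToLeft j j'))
      (ψ' := X.map (IsCofiltered.minToRight j j') ≫ θ ≫ Y.map f ≫ ψ) (by
        change π.app _ ≫ _ = π.app _ ≫ _
        change π.app _ ≫ θ = ρ.app l at hθ
        change ρ.app _ ≫ ψ = π.app j at hψ
        rw [← h1, ← Category.assoc, ← h2, ← Category.assoc, hθ, ← Category.assoc, ← h3, hψ])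
    refine ⟨m, a ≫ IsCofiltered.minToLeft j j', ?_⟩
    rw [Functor.map_comp, ha]
    simp only [← ratCohomology_map_map]
    rw [hf, map_zero, map_zero, map_zero]

open TensorProduct in
-- The class of an element in `H₁` is additive, so the elements with class in the span of the
-- classes of the root generators form a root closed subgroup.
theorem finiteDimensional_H1 {R : Type} [Group R] (hR : IsRootFG R) :
    FiniteDimensional ℚ (groupHomology (Rep.trivial ℚ R ℚ) 1) := by
  let e := groupHomology.H1AddEquivOfIsTrivial (Rep.trivial ℚ R ℚ)
  let θ : R → groupHomology.H1 (Rep.trivial ℚ R ℚ) := fun g =>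
    e.symm (Additive.ofMul (Abelianization.of g) ⊗ₜ[ℤ] (1 : ℚ))
  have hθ : ∀ g h, θ (g * h) = θ g + θ h := by
    intro g h
    simp only [θ]
    rw [map_mul, ofMul_mul, TensorProduct.add_tmul, map_add]
  obtain ⟨S, hfin, hS⟩ := hR
  let D := Submodule.span ℚ (θ '' S)
  let K : Subgroup R :=
    { carrier := {g | θ g ∈ D}
      one_mem' := by
        have := hθ 1 1
        rw [mul_one, left_eq_add] at this
        change θ 1 ∈ D
        rw [this]
        exact D.zero_mem
      mul_mem' := fun {g h} hg hh => by
        change θ _ ∈ D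
        rw [hθ]
        exact D.add_mem hg hh
      inv_mem' := fun {g} hg => by
        have h1 := hθ 1 1
        have h2 := hθ g⁻¹ g
        rw [mul_one, left_eq_add] at h1
        rw [inv_mul_cancel, h1] at h2
        change θ _ ∈ D
        rw [eq_neg_of_add_eq_zero_left h2.symm]
        exact D.neg_mem hg }
  have hpow : ∀ (n : ℕ) (x : R), θ (x ^ (n + 1)) = ((n : ℚ) + 1) • θ x := by
    intro n x
    induction n with
    | zero => simp
    | succ n ih =>
      rw [pow_succ, hθ, ih]
      push_cast
      rw [add_smul ((n : ℚ) + 1), one_smul]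
  have hK : K = ⊤ := by
    apply hS
    · exact fun s hs => Submodule.subset_span ⟨s, hs, rfl⟩
    · intro n x hx
      change θ _ ∈ D at hx
      rw [hpow] at hx
      exact (Submodule.smul_mem_iff _ (by positivity)).mp hx
  have hD : D = ⊤ := by
    rw [eq_top_iff]
    intro x _
    obtain ⟨t, rfl⟩ := e.symm.surjective x
    induction t using TensorProduct.induction_on with
    | zero => rw [map_zero]; exact D.zero_mem
    | add s t hs ht => rw [map_add]; exact D.add_mem (hs trivial) (ht trivial)
    | tmul g a =>
      obtain ⟨g, rfl⟩ := Additive.ofMul.surjective g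
      obtain ⟨g, rfl⟩ := QuotientGroup.mk_surjective g
      change e.symm (Additive.ofMul (Abelianization.of g) ⊗ₜ[ℤ] a) ∈ D
      have h1 : e.symm (Additive.ofMul (Abelianization.of g) ⊗ₜ[ℤ] a) = a • θ g := by
        simp only [θ, e]
        rw [groupHomology.H1AddEquivOfIsTrivial_symm_tmul,
          groupHomology.H1AddEquivOfIsTrivial_symm_tmul, ← map_smul, ← map_smul,
          Finsupp.smul_single, smul_eq_mul, mul_one]
      rw [h1]
      have : g ∈ K := hK ▸ Subgroup.mem_top g
      exact D.smul_mem a this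
  exact ⟨hD ▸ Submodule.fg_span (hfin.image θ)⟩

theorem isQUnipotent_malcev (G : Type) [Group G] [Group.FG G] (k : ℕ) :
    IsQUnipotent (Rationalization (LcsQuotient G k)) where
  nilpotent := by
    have : Group.IsNilpotent (LcsQuotient G k) := by
      rw [Subgroup.nilpotent_iff_lowerCentralSeries]
      refine ⟨k, ?_⟩
      rw [← Subgroup.map_top_of_surjective _ (QuotientGroup.mk'_surjective _),
        ← Subgroup.map_lowerCentralSeries, Subgroup.map_eq_bot_iff, QuotientGroup.ker_mk']
    exact Rationalization.isNilpotent _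
  uniquelyDivisible := Rationalization.isUniquelyDivisible _
  finite_H1 := finiteDimensional_H1 (isRootFG_malcev G k)

/-- A homomorphism to a nilpotent group kills some `Γᵏ` and, by unique divisibility of the target,
extends to the rationalization. Uniqueness holds already at each stage, by root density. -/
theorem isQCompletion_malcevCone (G : Type) [Group G] [Group.FG G] :
    IsQCompletion (malcevCone G) := by
  apply isQCompletion_of_bijective
  · exact fun j => isQUnipotent_malcev G j.unop
  · intro N hN φ
    obtain ⟨k, hk⟩ := Subgroup.nilpotent_iff_lowerCentralSeries.mp hN.nilpotent
    let φ' : G →* N := φ.hom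
    have h1 : ∀ g ∈ (⊤ : Subgroup G).lowerCentralSeries k, φ' g = 1 := by
      intro g hg
      have h2 := Subgroup.mem_map_of_mem φ' hg
      rw [Subgroup.map_lowerCentralSeries] at h2
      have h3 : φ' g ∈ (⊤ : Subgroup N).lowerCentralSeries k :=
        Subgroup.lowerCentralSeries_mono k (le_top : (⊤ : Subgroup G).map φ' ≤ ⊤) h2
      rwa [hk, Subgroup.mem_bot] at h3
    refine ⟨op k, GrpCat.ofHom (Rationalization.lift hN.uniquelyDivisible
      (QuotientGroup.lift _ φ' h1)), ?_⟩
    ext g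
    rfl
  · intro N hN j ψ ψ' h
    ext1
    apply (isRootDense_toMalcev G j.unop).hom_ext hN.uniquelyDivisible
    exact congrArg GrpCat.Hom.hom h

theorem isRatCohomologyIso_malcevCone {G : Type} [Group G] [Group.FG G] (hG : IsPolGood G) :
    IsRatCohomologyIso (malcevCone G) := by
  apply isRatCohomologyIso_of_bijective
  · intro i x
    obtain ⟨f, hf, rfl⟩ := exists_ratClass (G := G) x
    obtain ⟨k, F, hF, hc⟩ := exists_malcev_cocycle hG isRootFG_of_fg i hf
    refine ⟨op k, ratClass F hF, ?_⟩
    refine (ratCohomology_map_ratClass (toMalcev G k) F hF).trans ?_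
    have h1 : trivD i (fun g => F (toMalcev G k ∘ g)) = 0 := by rw [trivD_comp, hF]; rfl
    have h2 := ratClass_add _ (f - fun g => F (toMalcev G k ∘ g)) h1
      (by rw [map_sub, hf, h1, sub_zero])
    rw [(ratClass_eq_zero_iff _).mpr hc, add_zero] at h2
    simp only [add_sub_cancel] at h2
    exact h2
  · intro i j y hy
    obtain ⟨F, hF, rfl⟩ := exists_ratClass (G := Rationalization (LcsQuotient G j.unop)) y
    have h1 := (ratCohomology_map_ratClass (toMalcev G j.unop) F hF).symm.trans hy
    obtain ⟨l, hl, h⟩ := exists_malcev_coboundary hG i j.unop hF ((ratClass_eq_zero_iff _).mp h1)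
    refine ⟨op l, (homOfLE hl).op, ?_⟩
    refine (ratCohomology_map_ratClass (malcevTransition G hl) F hF).trans ?_
    exact (ratClass_eq_zero_iff _).mpr h

theorem isQGood_of_isPolGood {G : Type} [Group G] [Group.FG G] (hG : IsPolGood G) :
    IsQGood (GrpCat.of G) := by
  refine ⟨⟨ℕᵒᵖ, inferInstance, malcevTower G, (malcevCone G).π, isQCompletion_malcevCone G⟩, ?_⟩
  intro J _ X π hπ
  exact IsRatCohomologyIso.of_isQCompletion (isQCompletion_malcevCone G) hπ
    (isRatCohomologyIso_malcevCone hG)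

end Completion

end QGoodness

namespace QGoodness

/-! ### Artin's action of braid groups on free groups -/

section BraidAut

theorem mulAut_freeGroup_ext {α : Type} {f g : MulAut (FreeGroup α)}
    (h : ∀ k, f (FreeGroup.of k) = g (FreeGroup.of k)) : f = g := by
  have : f.toMonoidHom = g.toMonoidHom := FreeGroup.ext_hom _ _ h
  ext x
  exact DFunLike.congr_fun this x

variable {α : Type} [DecidableEq α]

/-- The endomorphism `a ↦ b`, `b ↦ b⁻¹ a b` of a free group. -/
def braidEnd (a b : α) : FreeGroup α →* FreeGroup α :=
  FreeGroup.lift fun k => if k = a then FreeGroup.of b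
    else if k = b then (FreeGroup.of b)⁻¹ * FreeGroup.of a * FreeGroup.of b else FreeGroup.of k

/-- The inverse of `braidEnd a b`. -/
def braidEndInv (a b : α) : FreeGroup α →* FreeGroup α :=
  FreeGroup.lift fun k => if k = b then FreeGroup.of a
    else if k = a then FreeGroup.of a * FreeGroup.of b * (FreeGroup.of a)⁻¹ else FreeGroup.of k

/-- The automorphism `a ↦ b`, `b ↦ b⁻¹ a b` of a free group. -/
def braidAut {a b : α} (h : a ≠ b) : MulAut (FreeGroup α) :=
  MonoidHom.toMulEquiv (braidEnd a b) (braidEndInv a b)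
    (by
      ext k
      by_cases h1 : k = a
      · simp [braidEnd, braidEndInv, h1]
      · by_cases h2 : k = b
        · simp [braidEnd, braidEndInv, h2, h, h.symm, mul_assoc]
        · simp [braidEnd, braidEndInv, h1, h2])
    (by
      ext k
      by_cases h1 : k = a
      · simp [braidEnd, braidEndInv, h1, h, h.symm, mul_assoc]
      · by_cases h2 : k = b
        · simp [braidEnd, braidEndInv, h2]
        · simp [braidEnd, braidEndInv, h1, h2])

theorem braidAut_of_left {a b : α} (h : a ≠ b) :
    braidAut h (FreeGroup.of a) = FreeGroup.of b := by
  simp [braidAut, braidEnd]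

theorem braidAut_of_right {a b : α} (h : a ≠ b) : braidAut h (FreeGroup.of b) =
    (FreeGroup.of b)⁻¹ * FreeGroup.of a * FreeGroup.of b := by
  simp [braidAut, braidEnd, h.symm]

theorem braidAut_of_ne {a b k : α} (h : a ≠ b) (ha : k ≠ a) (hb : k ≠ b) :
    braidAut h (FreeGroup.of k) = FreeGroup.of k := by
  simp [braidAut, braidEnd, ha, hb]

theorem braidAut_comm {a b c d : α} (hab : a ≠ b) (hcd : c ≠ d) (hac : a ≠ c) (had : a ≠ d)
    (hbc : b ≠ c) (hbd : b ≠ d) :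
    braidAut hab * braidAut hcd = braidAut hcd * braidAut hab := by
  apply mulAut_freeGroup_ext
  intro k
  simp only [MulAut.mul_apply]
  by_cases h1 : k = a
  · subst h1
    rw [braidAut_of_ne hcd hac had, braidAut_of_left, braidAut_of_ne hcd hbc hbd]
  by_cases h2 : k = b
  · subst h2
    simp only [braidAut_of_ne hcd hbc hbd, braidAut_of_right, map_mul, map_inv,
      braidAut_of_ne hcd hac had]
  by_cases h3 : k = c
  · subst h3
    rw [braidAut_of_left, braidAut_of_ne hab had.symm hbd.symm, braidAut_of_ne hab h1 h2,
      braidAut_of_left]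
  by_cases h4 : k = d
  · subst h4
    simp only [braidAut_of_ne hab h1 h2, braidAut_of_right, map_mul, map_inv,
      braidAut_of_ne hab hac.symm hbc.symm]
  rw [braidAut_of_ne hcd h3 h4, braidAut_of_ne hab h1 h2, braidAut_of_ne hcd h3 h4]

theorem braidAut_braid {a b c : α} (hab : a ≠ b) (hbc : b ≠ c) (hac : a ≠ c) :
    braidAut hab * braidAut hbc * braidAut hab = braidAut hbc * braidAut hab * braidAut hbc := by
  apply mulAut_freeGroup_ext
  intro k
  simp only [MulAut.mul_apply]
  by_cases h1 : k = a
  · subst h1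
    simp only [braidAut_of_left, braidAut_of_ne hbc hab hac, braidAut_of_ne hab hac.symm hbc.symm]
  by_cases h2 : k = b
  · subst h2
    simp only [braidAut_of_left, braidAut_of_right, map_mul, map_inv, braidAut_of_ne hbc hab hac,
      braidAut_of_ne hab hac.symm hbc.symm]
  by_cases h3 : k = c
  · subst h3
    simp only [braidAut_of_left, braidAut_of_right, map_mul, map_inv, braidAut_of_ne hbc hab hac,
      braidAut_of_ne hab hac.symm hbc.symm, mul_inv_rev, inv_inv, mul_assoc,
      mul_inv_cancel_left]
  simp only [braidAut_of_ne hab h1 h2, braidAut_of_ne hbc h2 h3]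

/-- The conjugation in `b ↦ b⁻¹ a b` disappears, leaving the transposition of `a` and `b`. -/
theorem abelianization_braidAut {a b : α} (h : a ≠ b) (x : FreeGroup α) :
    Abelianization.of (braidAut h x) =
      Abelianization.of (FreeGroup.map (Equiv.swap a b) x) := by
  have : Abelianization.of.comp (braidAut h).toMonoidHom =
      Abelianization.of.comp (FreeGroup.map (Equiv.swap a b)) := by
    ext k
    simp only [MonoidHom.comp_apply, FreeGroup.map.of]
    change Abelianization.of (braidAut h (FreeGroup.of k)) = _
    by_cases h1 : k = a
    · subst h1
      rw [braidAut_of_left, Equiv.swap_apply_left]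
    by_cases h2 : k = b
    · subst h2
      rw [braidAut_of_right, Equiv.swap_apply_right, map_mul, map_mul, map_inv, mul_comm,
        mul_inv_cancel_left]
    rw [braidAut_of_ne h h1 h2, Equiv.swap_apply_of_ne_of_ne h1 h2]
  exact DFunLike.congr_fun this x

end BraidAut

/-! ### The braid group and Artin's representation -/

section BraidGroup

/-- The generator `σ_i` of the braid group, or `1` if `i` is out of range. -/
def braidGen (m i : ℕ) : BraidGroup m :=
  if h : i < m - 1 then PresentedGroup.of ⟨i, h⟩ else 1

theorem of_eq_braidGen {m : ℕ} (i : Fin (m - 1)) :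
    (PresentedGroup.of i : BraidGroup m) = braidGen m i := by
  simp [braidGen]

theorem braidGen_comm (m : ℕ) {i j : ℕ} (h : i + 2 ≤ j) :
    braidGen m i * braidGen m j = braidGen m j * braidGen m i := by
  by_cases hj : j < m - 1
  · have hi : i < m - 1 := by omega
    have h1 := PresentedGroup.one_of_mem (rels := {r | IsBraidRelator m r})
      (IsBraidRelator.comm ⟨i, hi⟩ ⟨j, hj⟩ h)
    rw [map_mul, map_inv, mul_inv_eq_one, map_mul, map_mul] at h1
    simp only [braidGen, hi, hj, dif_pos]
    exact h1
  · simp [braidGen, hj]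

theorem braidGen_braid {m i : ℕ} (h : i + 2 < m) :
    braidGen m i * braidGen m (i + 1) * braidGen m i =
      braidGen m (i + 1) * braidGen m i * braidGen m (i + 1) := by
  have hi : i < m - 1 := by omega
  have hj : i + 1 < m - 1 := by omega
  have h1 := PresentedGroup.one_of_mem (rels := {r | IsBraidRelator m r})
    (IsBraidRelator.braid ⟨i, hi⟩ ⟨i + 1, hj⟩ rfl)
  rw [map_mul, map_inv, mul_inv_eq_one, map_mul, map_mul, map_mul, map_mul] at h1
  simp only [braidGen, hi, hj, dif_pos]
  exact h1

variable {K : Type} [Group K]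

/-- The universal property of braid groups. -/
def braidLift {m : ℕ} (f : Fin (m - 1) → K)
    (hcomm : ∀ i j : Fin (m - 1), (i : ℕ) + 2 ≤ j → f i * f j = f j * f i)
    (hbraid : ∀ i j : Fin (m - 1), (i : ℕ) + 1 = j → f i * f j * f i = f j * f i * f j) :
    BraidGroup m →* K :=
  PresentedGroup.toGroup (f := f) (by
    rintro r (⟨i, j, h⟩ | ⟨i, j, h⟩)
    · simp only [map_mul, map_inv, FreeGroup.lift_apply_of]
      rw [mul_inv_eq_one, hcomm i j h]
    · simp only [map_mul, map_inv, FreeGroup.lift_apply_of]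
      rw [mul_inv_eq_one, hbraid i j h])

theorem braidLift_braidGen {m : ℕ} {f : Fin (m - 1) → K} {hcomm hbraid} {i : ℕ}
    (hi : i < m - 1) : braidLift f hcomm hbraid (braidGen m i) = f ⟨i, hi⟩ := by
  rw [braidGen, dif_pos hi]
  exact PresentedGroup.toGroup.of _

theorem braidGroup_eq_top {m : ℕ} {S : Subgroup (BraidGroup m)}
    (h : ∀ i, i < m - 1 → braidGen m i ∈ S) (g : BraidGroup m) : g ∈ S := by
  apply PresentedGroup.generated_by
  intro j
  rw [of_eq_braidGen]
  exact h j j.2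

theorem braidPerm_braidGen {m i : ℕ} (hi : i < m - 1) :
    braidPerm m (braidGen m i) = strandSwap m ⟨i, hi⟩ := by
  rw [braidGen, dif_pos hi]
  exact PresentedGroup.toGroup.of _

/-- Artin's action of the braid group on the free group. -/
def artinAction (n : ℕ) : BraidGroup n →* MulAut (FreeGroup (Fin n)) :=
  braidLift (fun i => braidAut (a := (⟨i, by omega⟩ : Fin n)) (b := ⟨i + 1, by omega⟩) (by simp))
    (fun i j h => by
      apply braidAut_comm <;> simp only [ne_eq, Fin.mk.injEq] <;> omega)
    (fun i j h => by
      obtain ⟨j, hj⟩ := j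
      simp only at h
      subst h
      apply braidAut_braid
      simp only [ne_eq, Fin.mk.injEq]
      omega)

theorem abelianization_artinAction (n : ℕ) (b : BraidGroup n) (x : FreeGroup (Fin n)) :
    Abelianization.of (artinAction n b x) =
      Abelianization.of (FreeGroup.map (braidPerm n b) x) := by
  let S : Subgroup (BraidGroup n) :=
    { carrier := {b | ∀ x, Abelianization.of (artinAction n b x) =
        Abelianization.of (FreeGroup.map (braidPerm n b) x)}
      one_mem' := fun x => by
        rw [map_one, map_one]
        change _ = Abelianization.of (FreeGroup.map id x)
        rw [FreeGroup.map.id]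
        rfl
      mul_mem' := fun {b b'} hb hb' x => by
        rw [map_mul, MulAut.mul_apply, hb, map_mul, Equiv.Perm.coe_mul, ← FreeGroup.map.comp]
        have h := congrArg (Abelianization.map (FreeGroup.map (braidPerm n b))) (hb' x)
        simpa only [Abelianization.map_of] using h
      inv_mem' := fun {b} hb x => by
        have h := hb (artinAction n b⁻¹ x)
        rw [← MulAut.mul_apply, ← map_mul, mul_inv_cancel, map_one, MulAut.one_apply] at h
        have h' := congrArg (Abelianization.map (FreeGroup.map (braidPerm n b⁻¹))) h
        simp only [Abelianization.map_of] at h'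
        rw [h', FreeGroup.map.comp, ← Equiv.Perm.coe_mul, ← map_mul, inv_mul_cancel, map_one]
        change _ = Abelianization.of (FreeGroup.map id _)
        rw [FreeGroup.map.id] }
  have hS : b ∈ S := by
    apply braidGroup_eq_top
    intro i hi x
    rw [artinAction, braidLift_braidGen hi, abelianization_braidAut, braidPerm_braidGen hi]
    rfl
  exact hS x

/-- On the abelianization, a braid acts through its permutation. This is the condition that makes
`F_n ⋊ P_n` an almost direct product. -/
theorem artinAction_mul_inv_mem_commutator {n : ℕ} {b : BraidGroup n} (hb : braidPerm n b = 1)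
    (x : FreeGroup (Fin n)) : artinAction n b x * x⁻¹ ∈ commutator (FreeGroup (Fin n)) := by
  rw [← Abelianization.ker_of, MonoidHom.mem_ker, map_mul, map_inv, mul_inv_eq_one,
    abelianization_artinAction, hb]
  change Abelianization.of (FreeGroup.map id x) = _
  rw [FreeGroup.map.id]

end BraidGroup

/-! ### Coset representatives `τ_j` and the loops `A_j` -/

section Tau

variable (n : ℕ)

/-- `σ_{n-1} σ_{n-2} ⋯ σ_{n-k}`. -/
def braidTail : ℕ → BraidGroup (n + 1)
  | 0 => 1
  | k + 1 => braidTail k * braidGen (n + 1) (n - (k + 1))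

/-- `τ_j = σ_{n-1} σ_{n-2} ⋯ σ_j`, which moves the strand `j` to the last position. -/
def braidTau (j : ℕ) : BraidGroup (n + 1) := braidTail n (n - j)

theorem braidTau_self : braidTau n n = 1 := by
  rw [braidTau, Nat.sub_self]
  rfl

variable {n}

theorem braidTau_eq {j : ℕ} (h : j < n) :
    braidTau n j = braidTau n (j + 1) * braidGen (n + 1) j := by
  obtain ⟨k, rfl⟩ : ∃ k, n = j + (k + 1) := ⟨n - j - 1, by omega⟩
  have h1 : j + (k + 1) - j = k + 1 := by omega
  have h2 : j + (k + 1) - (j + 1) = k := by omega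
  have h3 : j + (k + 1) - (k + 1) = j := by omega
  rw [braidTau, braidTau, h1, h2, braidTail, h3]

theorem commute_braidTau {i j : ℕ} (h : i + 2 ≤ j) (hj : j ≤ n) :
    Commute (braidGen (n + 1) i) (braidTau n j) := by
  induction hj using Nat.decreasingInduction with
  | self => rw [braidTau_self]; exact Commute.one_right _
  | of_succ k hk ih =>
    rw [braidTau_eq hk]
    exact (ih (by omega)).mul_right (braidGen_comm _ h)

/-- For `j = p` this is the braid relation together with commutation past `τ_{p+2}`. Smaller `j`
only append generators that commute with `σ_{p+1}`. -/
theorem braidTau_mul_braidGen {p j : ℕ} (hj : j ≤ p) (hp : p + 1 < n) :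
    braidTau n j * braidGen (n + 1) (p + 1) = braidGen (n + 1) p * braidTau n j := by
  induction hj using Nat.decreasingInduction with
  | self =>
    rw [braidTau_eq (by omega : p < n), braidTau_eq hp, mul_assoc, mul_assoc,
      ← mul_assoc (braidGen (n + 1) (p + 1)), ← braidGen_braid (by omega), ← mul_assoc, ← mul_assoc,
      ← (commute_braidTau (by omega) (by omega)).eq]
    simp only [mul_assoc]
  | of_succ k hk ih =>
    rw [braidTau_eq (by omega), mul_assoc, braidGen_comm _ (by omega), ← mul_assoc, ih, mul_assoc]

/-- The pure braid `A_j = τ_{j+1} σ_j² τ_{j+1}⁻¹`. -/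
def braidLoop (n j : ℕ) : BraidGroup (n + 1) :=
  braidTau n (j + 1) * (braidGen (n + 1) j * braidGen (n + 1) j) * (braidTau n (j + 1))⁻¹

theorem conj_conj_of_commute {K : Type} [Group K] {a t : K} (h : Commute a t) (x : K) :
    a * (t * x * t⁻¹) * a⁻¹ = t * (a * x * a⁻¹) * t⁻¹ := by
  have h1 : a * (t * x * t⁻¹) * a⁻¹ = a * t * x * (a * t)⁻¹ := by
    simp only [mul_assoc, mul_inv_rev]
  rw [h1, h.eq]
  simp only [mul_assoc, mul_inv_rev]

theorem conj_of_braid {K : Type} [Group K] {a b : K} (h : a * b * a = b * a * b) :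
    a * (b * (a * a) * b⁻¹) * a⁻¹ = b * b := by
  have h1 : a * b * (a * a) = b * b * (a * b) := by
    calc a * b * (a * a) = a * b * a * a := by simp only [mul_assoc]
      _ = b * a * b * a := by rw [h]
      _ = b * (a * b * a) := by simp only [mul_assoc]
      _ = b * (b * a * b) := by rw [h]
      _ = b * b * (a * b) := by simp only [mul_assoc]
  rw [← mul_assoc, ← mul_assoc, h1]
  simp only [mul_assoc, mul_inv_cancel, mul_one]

theorem conj_of_braid' {K : Type} [Group K] {a b : K} (h : a * b * a = b * a * b) :
    a * (b * b) * a⁻¹ = (b * b)⁻¹ * (b * (a * a) * b⁻¹) * (b * b) := by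
  have h1 : b * (a * (b * b)) = a * a * (b * a) := by
    calc b * (a * (b * b)) = b * a * b * b := by simp only [mul_assoc]
      _ = a * b * a * b := by rw [h]
      _ = a * (b * a * b) := by simp only [mul_assoc]
      _ = a * (a * b * a) := by rw [h]
      _ = a * a * (b * a) := by simp only [mul_assoc]
  rw [mul_inv_eq_iff_eq_mul, mul_assoc, mul_assoc, eq_inv_mul_iff_mul_eq, mul_assoc, h1]
  simp only [mul_assoc, inv_mul_cancel_left]

theorem braidLoop_eq {i : ℕ} (h : i + 1 < n) : braidLoop n i = braidTau n (i + 2) *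
    (braidGen (n + 1) (i + 1) * (braidGen (n + 1) i * braidGen (n + 1) i) *
      (braidGen (n + 1) (i + 1))⁻¹) * (braidTau n (i + 2))⁻¹ := by
  rw [braidLoop, braidTau_eq h]
  simp only [mul_assoc, mul_inv_rev]

/-- With `braidGen_conj_braidLoop_right` and `braidGen_conj_braidLoop_of_ne`, this shows that
conjugation by `σ_i` on the loops follows the formulas of `braidAut`. -/
theorem braidGen_conj_braidLoop_left {i : ℕ} (h : i + 1 < n) :
    braidGen (n + 1) i * braidLoop n i * (braidGen (n + 1) i)⁻¹ = braidLoop n (i + 1) := by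
  rw [braidLoop_eq h, conj_conj_of_commute (commute_braidTau le_rfl h),
    conj_of_braid (braidGen_braid (by omega)), braidLoop]

theorem braidGen_conj_braidLoop_right {i : ℕ} (h : i + 1 < n) :
    braidGen (n + 1) i * braidLoop n (i + 1) * (braidGen (n + 1) i)⁻¹ =
      (braidLoop n (i + 1))⁻¹ * braidLoop n i * braidLoop n (i + 1) := by
  rw [braidLoop_eq h, braidLoop, conj_conj_of_commute (commute_braidTau le_rfl h),
    conj_of_braid' (braidGen_braid (by omega))]
  simp only [mul_assoc, mul_inv_rev, inv_inv, inv_mul_cancel_left]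

theorem braidGen_conj_braidLoop_of_ne {i k : ℕ} (h : i + 1 < n) (hk : k < n) (h1 : k ≠ i)
    (h2 : k ≠ i + 1) :
    braidGen (n + 1) i * braidLoop n k * (braidGen (n + 1) i)⁻¹ = braidLoop n k := by
  rw [mul_inv_eq_iff_eq_mul]
  rcases Nat.lt_or_ge k i with h3 | h3
  · have h4 := braidTau_mul_braidGen (n := n) (p := i) (j := k + 1) h3 h
    have h5 : Commute _ _ := braidGen_comm (n + 1) (i := k) (j := i + 1) (by omega)
    have h6 : (braidTau n (k + 1))⁻¹ * braidGen (n + 1) i =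
        braidGen (n + 1) (i + 1) * (braidTau n (k + 1))⁻¹ := by
      rw [inv_mul_eq_iff_eq_mul, ← mul_assoc, h4, mul_inv_cancel_right]
    rw [braidLoop, mul_assoc _ _ (braidGen (n + 1) i), h6, ← mul_assoc, ← mul_assoc, ← h4,
      mul_assoc (braidTau n (k + 1)) (braidGen (n + 1) (i + 1)), ← (h5.mul_left h5).eq]
    simp only [mul_assoc]
  · have h4 := commute_braidTau (n := n) (i := i) (j := k + 1) (by omega) (by omega)
    have h5 : Commute _ _ := braidGen_comm (n + 1) (i := i) (j := k) (by omega)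
    exact ((h4.mul_right (h5.mul_right h5)).mul_right h4.inv_right).eq

end Tau

/-! ### The homomorphism from `F_n ⋊ B_n` to `B_{n+1}` -/

section PointPush

variable (n : ℕ)

/-- The semidirect product `F_n ⋊ B_n`. -/
abbrev ArtinSemidirect : Type := FreeGroup (Fin n) ⋊[artinAction n] BraidGroup n

/-- The inclusion `B_n → B_{n+1}`. -/
def braidInclusion : BraidGroup n →* BraidGroup (n + 1) :=
  braidLift (fun i => braidGen (n + 1) i) (fun _ _ h => braidGen_comm _ h) (by
    intro i j h
    rw [← h]
    exact braidGen_braid (by omega))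

variable {n}

theorem braidInclusion_braidGen {i : ℕ} (hi : i + 1 < n) :
    braidInclusion n (braidGen n i) = braidGen (n + 1) i :=
  braidLift_braidGen (i := i) (by omega)

variable (n) in
/-- The homomorphism from the free group on the last strand. -/
def pointPush : FreeGroup (Fin n) →* BraidGroup (n + 1) :=
  FreeGroup.lift fun j => braidLoop n j

/-- The compatibility needed to map out of the semidirect product. It is multiplicative in the
braid, so the conjugation formulas for the loops suffice. -/
theorem pointPush_artinAction (b : BraidGroup n) (x : FreeGroup (Fin n)) :
    pointPush n (artinAction n b x) =
      braidInclusion n b * pointPush n x * (braidInclusion n b)⁻¹ := by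
  let S : Subgroup (BraidGroup n) :=
    { carrier := {b | ∀ x, pointPush n (artinAction n b x) =
        braidInclusion n b * pointPush n x * (braidInclusion n b)⁻¹}
      one_mem' := fun x => by simp
      mul_mem' := fun {b b'} hb hb' x => by
        rw [map_mul, MulAut.mul_apply, hb, hb', map_mul]
        simp only [mul_assoc, mul_inv_rev]
      inv_mem' := fun {b} hb x => by
        have h := hb (artinAction n b⁻¹ x)
        rw [← MulAut.mul_apply, ← map_mul, mul_inv_cancel, map_one, MulAut.one_apply] at h
        rw [h, map_inv (braidInclusion n)]
        simp only [mul_assoc, inv_inv, inv_mul_cancel_left, inv_mul_cancel, mul_one] }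
  have hS : b ∈ S := by
    apply braidGroup_eq_top
    intro i hi x
    have h1 : (pointPush n).comp (artinAction n (braidGen n i)).toMonoidHom =
        (MulAut.conj (braidInclusion n (braidGen n i))).toMonoidHom.comp (pointPush n) := by
      ext k
      simp only [MonoidHom.comp_apply, MulEquiv.coe_toMonoidHom, MulAut.conj_apply]
      rw [braidInclusion_braidGen (by omega), artinAction, braidLift_braidGen hi]
      by_cases hk : k = ⟨i, by omega⟩
      · rw [hk, braidAut_of_left]
        simp only [pointPush, FreeGroup.lift_apply_of]
        exact (braidGen_conj_braidLoop_left (by omega)).symm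
      by_cases hk' : k = ⟨i + 1, by omega⟩
      · rw [hk', braidAut_of_right]
        simp only [pointPush, FreeGroup.lift_apply_of, map_mul, map_inv]
        exact (braidGen_conj_braidLoop_right (by omega)).symm
      rw [braidAut_of_ne _ hk hk']
      simp only [pointPush, FreeGroup.lift_apply_of]
      refine (braidGen_conj_braidLoop_of_ne (by omega) k.2 ?_ ?_).symm
      · simpa [Fin.ext_iff] using hk
      · simpa [Fin.ext_iff] using hk'
    exact DFunLike.congr_fun h1 x
  exact hS x

variable (n) in
/-- The homomorphism `F_n ⋊ B_n → B_{n+1}`. -/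
def artinToBraid : ArtinSemidirect n →* BraidGroup (n + 1) :=
  SemidirectProduct.lift (pointPush n) (braidInclusion n) fun b => by
    apply MonoidHom.ext
    intro x
    exact pointPush_artinAction b x

end PointPush

end QGoodness

namespace QGoodness

/-! ### The structure of pure braid groups -/

section Wreath

variable (n : ℕ)

/-- The generator `x_i` of the free group, or `1` if `i` is out of range. -/
def freeGen (i : ℕ) : FreeGroup (Fin n) := if h : i < n then FreeGroup.of ⟨i, h⟩ else 1

/-- The element `x_i` of `F_n ⋊ B_n`. -/
def pushGen (i : ℕ) : ArtinSemidirect n := SemidirectProduct.inl (freeGen n i)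

/-- The element `σ_i` of `F_n ⋊ B_n`. -/
def swapGen (i : ℕ) : ArtinSemidirect n := SemidirectProduct.inr (braidGen n i)

variable {n}

theorem swapGen_mul_pushGen (i k : ℕ) : swapGen n i * pushGen n k =
    SemidirectProduct.inl (artinAction n (braidGen n i) (freeGen n k)) * swapGen n i := by
  rw [SemidirectProduct.inl_aut, swapGen, pushGen]
  simp only [mul_assoc, ← map_mul, inv_mul_cancel, map_one, mul_one]

theorem artinAction_freeGen_left {i : ℕ} (h : i + 1 < n) :
    artinAction n (braidGen n i) (freeGen n i) = freeGen n (i + 1) := by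
  rw [artinAction, braidLift_braidGen (by omega), freeGen, freeGen, dif_pos (by omega), dif_pos h,
    braidAut_of_left]

theorem artinAction_freeGen_right {i : ℕ} (h : i + 1 < n) :
    artinAction n (braidGen n i) (freeGen n (i + 1)) =
      (freeGen n (i + 1))⁻¹ * freeGen n i * freeGen n (i + 1) := by
  rw [artinAction, braidLift_braidGen (by omega), freeGen, freeGen, dif_pos h,
    dif_pos (by omega : i < n), braidAut_of_right]

theorem artinAction_freeGen_of_ne {i k : ℕ} (h : i + 1 < n) (h1 : k ≠ i) (h2 : k ≠ i + 1) :
    artinAction n (braidGen n i) (freeGen n k) = freeGen n k := by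
  rw [artinAction, braidLift_braidGen (by omega), freeGen]
  split_ifs
  · exact braidAut_of_ne _ (by simpa [Fin.ext_iff]) (by simpa [Fin.ext_iff])
  · exact map_one _

theorem swapGen_mul_pushGen_left {i : ℕ} (h : i + 1 < n) :
    swapGen n i * pushGen n i = pushGen n (i + 1) * swapGen n i := by
  rw [swapGen_mul_pushGen, artinAction_freeGen_left h, pushGen]

theorem swapGen_mul_pushGen_pair {i : ℕ} (h : i + 1 < n) :
    swapGen n i * pushGen n i * pushGen n (i + 1) =
      pushGen n i * pushGen n (i + 1) * swapGen n i := by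
  rw [swapGen_mul_pushGen_left h, mul_assoc, swapGen_mul_pushGen, artinAction_freeGen_right h,
    ← mul_assoc, pushGen, pushGen, ← map_mul, ← map_mul]
  simp only [mul_assoc, mul_inv_cancel_left]

theorem swapGen_mul_pushGen_of_ne {i k : ℕ} (h : i + 1 < n) (h1 : k ≠ i) (h2 : k ≠ i + 1) :
    swapGen n i * pushGen n k = pushGen n k * swapGen n i := by
  rw [swapGen_mul_pushGen, artinAction_freeGen_of_ne h h1 h2, pushGen]

theorem swapGen_comm {i j : ℕ} (h : i + 2 ≤ j) :
    swapGen n i * swapGen n j = swapGen n j * swapGen n i := by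
  rw [swapGen, swapGen, ← map_mul, braidGen_comm n h, map_mul]

theorem swapGen_braid {i : ℕ} (h : i + 2 < n) :
    swapGen n i * swapGen n (i + 1) * swapGen n i =
      swapGen n (i + 1) * swapGen n i * swapGen n (i + 1) := by
  rw [swapGen, swapGen, ← map_mul, ← map_mul, braidGen_braid h, map_mul, map_mul]

variable (n) in
/-- The label of the strand `j` in the generator `σ_i` of `B_{n+1}`: the element `h` of `F_n ⋊ B_n`
with `τ_j σ_i = h τ_{σ_i(j)}`. -/
def braidLabel (i j : ℕ) : ArtinSemidirect n :=
  if i + 1 < j then swapGen n i else if j = i + 1 then 1 else if j = i then pushGen n i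
    else swapGen n (i - 1)

theorem braidLabel_of_lt {i j : ℕ} (h : i + 1 < j) : braidLabel n i j = swapGen n i := if_pos h

theorem braidLabel_succ (i : ℕ) : braidLabel n i (i + 1) = 1 := by simp [braidLabel]

theorem braidLabel_self (i : ℕ) : braidLabel n i i = pushGen n i := by simp [braidLabel]

theorem braidLabel_of_gt {i j : ℕ} (h : j ≤ i) : braidLabel n (i + 1) j = swapGen n i := by
  rw [braidLabel, if_neg (by omega), if_neg (by omega), if_neg (by omega), Nat.add_sub_cancel]

/-- The transposition of `i` and `i + 1`. -/
def natSwap (i j : ℕ) : ℕ := if j = i then i + 1 else if j = i + 1 then i else j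

theorem natSwap_self (i : ℕ) : natSwap i i = i + 1 := by simp [natSwap]

theorem natSwap_succ (i : ℕ) : natSwap i (i + 1) = i := by simp [natSwap]

theorem natSwap_of_ne {i j : ℕ} (h : j ≠ i) (h' : j ≠ i + 1) : natSwap i j = j := by
  simp [natSwap, h, h']

/-- With `braidLabel_braid`, this is the first component of Artin's relations in the wreath product.
The cases follow the position of the strand `j` relative to the crossings. -/
theorem braidLabel_comm {i k j : ℕ} (h : i + 2 ≤ k) (hk : k < n) :
    braidLabel n i j * braidLabel n k (natSwap i j) =
      braidLabel n k j * braidLabel n i (natSwap k j) := by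
  obtain ⟨k, rfl⟩ : ∃ k', k = k' + 1 := ⟨k - 1, by omega⟩
  rcases lt_trichotomy j i with h1 | rfl | h1
  · obtain ⟨i, rfl⟩ : ∃ i', i = i' + 1 := ⟨i - 1, by omega⟩
    rw [natSwap_of_ne (by omega) (by omega), natSwap_of_ne (by omega) (by omega),
      braidLabel_of_gt (by omega), braidLabel_of_gt (by omega), swapGen_comm (by omega)]
  · rw [natSwap_self, natSwap_of_ne (by omega) (by omega), braidLabel_self,
      braidLabel_of_gt (by omega), braidLabel_of_gt (by omega),
      swapGen_mul_pushGen_of_ne hk (by omega) (by omega)]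
  rcases Nat.lt_or_ge (i + 1) j with h2 | h2
  swap
  · obtain rfl : j = i + 1 := by omega
    rw [natSwap_succ, natSwap_of_ne (by omega) (by omega), braidLabel_succ,
      braidLabel_of_gt (by omega), braidLabel_of_gt (by omega), one_mul, mul_one]
  rw [natSwap_of_ne (by omega) (by omega), braidLabel_of_lt h2]
  rcases lt_trichotomy j (k + 1) with h3 | rfl | h3
  · rw [natSwap_of_ne (by omega) (by omega), braidLabel_of_gt (by omega), braidLabel_of_lt h2,
      swapGen_comm (by omega)]
  · rw [natSwap_self, braidLabel_self, braidLabel_of_lt (by omega),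
      swapGen_mul_pushGen_of_ne (by omega) (by omega) (by omega)]
  rcases Nat.lt_or_ge (k + 2) j with h4 | h4
  · rw [natSwap_of_ne (by omega) (by omega), braidLabel_of_lt (by omega), braidLabel_of_lt h2,
      swapGen_comm (by omega)]
  · obtain rfl : j = k + 1 + 1 := by omega
    rw [natSwap_succ, braidLabel_succ, braidLabel_of_lt (by omega), one_mul, mul_one]

theorem braidLabel_braid {i j : ℕ} (h : i + 1 < n) (hj : j ≤ n) :
    braidLabel n i j * braidLabel n (i + 1) (natSwap i j) *
        braidLabel n i (natSwap (i + 1) (natSwap i j)) =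
      braidLabel n (i + 1) j * braidLabel n i (natSwap (i + 1) j) *
        braidLabel n (i + 1) (natSwap i (natSwap (i + 1) j)) := by
  rcases lt_trichotomy j i with h1 | rfl | h1
  · obtain ⟨i, rfl⟩ : ∃ i', i = i' + 1 := ⟨i - 1, by omega⟩
    have e1 : natSwap (i + 1) j = j := natSwap_of_ne (by omega) (by omega)
    have e2 : natSwap (i + 1 + 1) j = j := natSwap_of_ne (by omega) (by omega)
    rw [e1, e2, e1, braidLabel_of_gt (by omega), braidLabel_of_gt (by omega),
      swapGen_braid (by omega)]
  · rw [natSwap_self, natSwap_self, natSwap_of_ne (i := j + 1) (by omega) (by omega), natSwap_self,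
      braidLabel_self, braidLabel_self, braidLabel_of_lt (by omega), braidLabel_of_gt le_rfl,
      swapGen_mul_pushGen_pair h]
  rcases lt_trichotomy j (i + 2) with h2 | rfl | h2
  · obtain rfl : j = i + 1 := by omega
    rw [natSwap_succ, natSwap_self, natSwap_of_ne (i := i + 1) (by omega) (by omega),
      natSwap_of_ne (i := i) (by omega) (by omega), braidLabel_succ, braidLabel_succ,
      braidLabel_self, braidLabel_self, braidLabel_of_lt (i := i) (j := i + 1 + 1) (by omega),
      braidLabel_of_gt le_rfl, one_mul, mul_one, swapGen_mul_pushGen_left h]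
  · rw [natSwap_of_ne (i := i) (j := i + 2) (by omega) (by omega), natSwap_succ, natSwap_succ,
      braidLabel_succ, braidLabel_succ, braidLabel_of_lt (i := i) (j := i + 2) (by omega),
      braidLabel_of_gt le_rfl, one_mul, one_mul, mul_one, mul_one]
  · have e1 : natSwap i j = j := natSwap_of_ne (by omega) (by omega)
    have e2 : natSwap (i + 1) j = j := natSwap_of_ne (by omega) (by omega)
    rw [e1, e2, e1, braidLabel_of_lt (by omega), braidLabel_of_lt (by omega),
      swapGen_braid (by omega)]

theorem strandSwap_val {m : ℕ} (i : Fin (m - 1)) (j : Fin m) :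
    (strandSwap m i j : ℕ) = natSwap i j := by
  rw [strandSwap, Equiv.swap_apply_def, natSwap]
  simp only [Fin.ext_iff]
  split_ifs <;> rfl

theorem strandSwap_inv {m : ℕ} (i : Fin (m - 1)) : (strandSwap m i)⁻¹ = strandSwap m i :=
  Equiv.swap_inv _ _

variable (n) in
/-- The wreath product of `F_n ⋊ B_n` with the symmetric group on `n + 1` letters. -/
abbrev BraidWreath : Type :=
  (Fin (n + 1) → ArtinSemidirect n) ⋊[mulAutArrow] Equiv.Perm (Fin (n + 1))

theorem BraidWreath.mul_left_apply (a b : BraidWreath n) (j : Fin (n + 1)) :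
    (a * b).left j = a.left j * b.left (a.right⁻¹ j) := rfl

variable (n) in
/-- The generator of the wreath product corresponding to `σ_i`. -/
def wreathGen (i : Fin n) : BraidWreath n :=
  ⟨fun j => braidLabel n i j, strandSwap (n + 1) i⟩

theorem wreathGen_mul_left (a : BraidWreath n) (i : Fin n) (j : Fin (n + 1)) :
    (wreathGen n i * a).left j = braidLabel n i j * a.left (strandSwap (n + 1) i j) := by
  rw [BraidWreath.mul_left_apply, wreathGen, strandSwap_inv]

variable (n) in
/-- The homomorphism from `B_{n+1}` to the wreath product. -/
def braidToWreath : BraidGroup (n + 1) →* BraidWreath n :=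
  braidLift (wreathGen n)
    (fun i k h => by
      ext1
      · funext j
        rw [wreathGen_mul_left, wreathGen_mul_left]
        simp only [wreathGen, strandSwap_val]
        exact braidLabel_comm h k.2
      · have := lift_strandSwap_eq_one (n + 1) _ (IsBraidRelator.comm i k h)
        simp only [map_mul, map_inv, FreeGroup.lift_apply_of] at this
        exact mul_inv_eq_one.mp this)
    (fun i k h => by
      ext1
      · funext j
        rw [mul_assoc, mul_assoc, wreathGen_mul_left, wreathGen_mul_left, wreathGen_mul_left,
          wreathGen_mul_left]
        simp only [wreathGen, strandSwap_val, ← h, ← mul_assoc]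
        exact braidLabel_braid (h.trans_lt k.2) (Nat.lt_succ_iff.mp j.2)
      · have := lift_strandSwap_eq_one (n + 1) _ (IsBraidRelator.braid i k h)
        simp only [map_mul, map_inv, FreeGroup.lift_apply_of] at this
        exact mul_inv_eq_one.mp this)

theorem braidToWreath_braidGen (i : Fin n) :
    braidToWreath n (braidGen (n + 1) i) = wreathGen n i :=
  braidLift_braidGen (m := n + 1) i.2

theorem braidToWreath_right (g : BraidGroup (n + 1)) :
    (braidToWreath n g).right = braidPerm (n + 1) g := by
  have : SemidirectProduct.rightHom.comp (braidToWreath n) = braidPerm (n + 1) := by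
    apply PresentedGroup.ext
    intro i
    rw [of_eq_braidGen, MonoidHom.comp_apply, braidPerm_braidGen i.2]
    exact congrArg SemidirectProduct.right (braidToWreath_braidGen i)
  exact DFunLike.congr_fun this g

variable (n) in
/-- The component of the strand `j`. -/
def braidComponent (g : BraidGroup (n + 1)) (j : Fin (n + 1)) : ArtinSemidirect n :=
  (braidToWreath n g).left j

theorem braidComponent_mul (g g' : BraidGroup (n + 1)) (j : Fin (n + 1)) :
    braidComponent n (g * g') j =
      braidComponent n g j * braidComponent n g' ((braidPerm (n + 1) g)⁻¹ j) := by
  rw [← braidToWreath_right, braidComponent, map_mul]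
  rfl

theorem braidComponent_one (j : Fin (n + 1)) : braidComponent n 1 j = 1 := by
  rw [braidComponent, map_one]
  rfl

theorem braidComponent_braidGen {i : ℕ} (hi : i < n) (j : Fin (n + 1)) :
    braidComponent n (braidGen (n + 1) i) j = braidLabel n i j := by
  rw [braidComponent, braidToWreath_braidGen ⟨i, hi⟩]
  rfl

theorem artinToBraid_pushGen {i : ℕ} (hi : i < n) :
    artinToBraid n (pushGen n i) = braidLoop n i := by
  rw [pushGen, artinToBraid, SemidirectProduct.lift_inl, freeGen, dif_pos hi]
  exact FreeGroup.lift_apply_of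

theorem artinToBraid_swapGen {i : ℕ} (hi : i + 1 < n) :
    artinToBraid n (swapGen n i) = braidGen (n + 1) i := by
  rw [swapGen, artinToBraid, SemidirectProduct.lift_inr, braidInclusion_braidGen hi]

theorem braidTau_mul_gen {i : ℕ} (hi : i < n) {j : ℕ} (hj : j ≤ n) :
    braidTau n j * braidGen (n + 1) i =
      artinToBraid n (braidLabel n i j) * braidTau n (natSwap i j) := by
  rcases lt_trichotomy j i with h1 | rfl | h1
  · obtain ⟨i, rfl⟩ : ∃ i', i = i' + 1 := ⟨i - 1, by omega⟩
    rw [natSwap_of_ne (by omega) (by omega), braidLabel_of_gt (by omega), artinToBraid_swapGen hi,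
      braidTau_mul_braidGen (by omega) hi]
  · rw [natSwap_self, braidLabel_self, artinToBraid_pushGen hi, braidLoop, inv_mul_cancel_right,
      braidTau_eq hi, mul_assoc]
  rcases Nat.lt_or_ge (i + 1) j with h2 | h2
  · rw [natSwap_of_ne (by omega) (by omega), braidLabel_of_lt h2, artinToBraid_swapGen (by omega),
      (commute_braidTau (by omega) hj).eq]
  · obtain rfl : j = i + 1 := by omega
    rw [natSwap_succ, braidLabel_succ, map_one, one_mul, braidTau_eq hi]

/-- The coset rule for the generators extends multiplicatively. At the last strand, where the
representative is `1`, it writes a braid fixing that strand as an element of the image of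
`artinToBraid`. -/
theorem braidTau_mul (g : BraidGroup (n + 1)) (j : Fin (n + 1)) :
    braidTau n j * g =
      artinToBraid n (braidComponent n g j) *
        braidTau n ((braidPerm (n + 1) g)⁻¹ j : Fin (n + 1)) := by
  let S : Subgroup (BraidGroup (n + 1)) :=
    { carrier := {g | ∀ j : Fin (n + 1), braidTau n j * g =
        artinToBraid n (braidComponent n g j) *
          braidTau n ((braidPerm (n + 1) g)⁻¹ j : Fin (n + 1))}
      one_mem' := fun j => by simp [braidComponent_one]
      mul_mem' := fun {g g'} hg hg' j => by
        rw [← mul_assoc, hg, mul_assoc, hg', braidComponent_mul, map_mul, map_mul, mul_assoc]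
        simp
      inv_mem' := fun {g} hg j => by
        have h := hg (braidPerm (n + 1) g j)
        have h1 := braidComponent_mul g g⁻¹ (braidPerm (n + 1) g j)
        have e : (braidPerm (n + 1) g)⁻¹ (braidPerm (n + 1) g j) = j :=
          (braidPerm (n + 1) g).symm_apply_apply j
        rw [mul_inv_cancel, braidComponent_one, e] at h1
        rw [e] at h
        rw [eq_inv_of_mul_eq_one_right h1.symm, map_inv, mul_inv_eq_iff_eq_mul, mul_assoc,
          map_inv, inv_inv, h, inv_mul_cancel_left] }
  have hS : g ∈ S := by
    apply braidGroup_eq_top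
    intro i hi j
    have hi' : i < n := hi
    rw [braidTau_mul_gen hi' (Nat.lt_succ_iff.mp j.2), braidComponent_braidGen hi',
      braidPerm_braidGen hi, strandSwap_inv, strandSwap_val]
  exact hS j

end Wreath

end QGoodness

namespace QGoodness

/-! ### The decomposition of the pure braid group -/

section PureBraid

variable {n : ℕ}

theorem braidPerm_braidInclusion (b : BraidGroup n) :
    braidPerm (n + 1) (braidInclusion n b) (Fin.last n) = Fin.last n ∧
      ∀ k : Fin n, braidPerm (n + 1) (braidInclusion n b) k.castSucc =
        (braidPerm n b k).castSucc := by
  let S : Subgroup (BraidGroup n) :=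
    { carrier := {b | braidPerm (n + 1) (braidInclusion n b) (Fin.last n) = Fin.last n ∧
        ∀ k : Fin n, braidPerm (n + 1) (braidInclusion n b) k.castSucc =
          (braidPerm n b k).castSucc}
      one_mem' := by simp
      mul_mem' := fun {b b'} hb hb' => by
        simp only [Set.mem_ofPred_eq, map_mul, Equiv.Perm.mul_apply, hb.1, hb'.1, hb.2, hb'.2,
          implies_true, and_self]
      inv_mem' := fun {b} hb => by
        simp only [Set.mem_ofPred_eq, map_inv, Equiv.Perm.inv_eq_iff_eq, hb.1, hb.2, true_and]
        intro k
        rw [← Equiv.Perm.mul_apply, mul_inv_cancel, Equiv.Perm.one_apply] }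
  have hS : b ∈ S := by
    apply braidGroup_eq_top
    intro i hi
    have hi' : i < n + 1 - 1 := by omega
    change _ ∧ _
    rw [braidInclusion_braidGen (by omega), braidPerm_braidGen hi', braidPerm_braidGen hi]
    constructor
    · ext
      rw [strandSwap_val]
      exact natSwap_of_ne (by simp only [Fin.val_last]; omega) (by simp only [Fin.val_last]; omega)
    · intro k
      ext
      rw [strandSwap_val, Fin.val_castSucc, Fin.val_castSucc, strandSwap_val]
  exact hS

theorem braidPerm_pointPush (x : FreeGroup (Fin n)) : braidPerm (n + 1) (pointPush n x) = 1 := by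
  have h : (braidPerm (n + 1)).comp (pointPush n) = 1 := by
    ext1 k
    have hk : (k : ℕ) < n + 1 - 1 := k.2
    have h1 : strandSwap (n + 1) ⟨k, hk⟩ * strandSwap (n + 1) ⟨k, hk⟩ = 1 := Equiv.swap_mul_self _ _
    rw [MonoidHom.comp_apply, pointPush, FreeGroup.lift_apply_of, braidLoop, map_mul, map_mul,
      map_mul, map_inv, braidPerm_braidGen hk, h1, mul_one, mul_inv_cancel]
    rfl
  exact DFunLike.congr_fun h x

theorem artinToBraid_apply (q : ArtinSemidirect n) :
    artinToBraid n q = pointPush n q.left * braidInclusion n q.right := rfl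

theorem braidComponent_braidTau {j : ℕ} (hj : j ≤ n) :
    braidComponent n (braidTau n j) (Fin.last n) = 1 ∧
      (((braidPerm (n + 1) (braidTau n j))⁻¹ (Fin.last n) : Fin (n + 1)) : ℕ) = j := by
  induction hj using Nat.decreasingInduction with
  | self =>
    rw [braidTau_self, braidComponent_one, map_one]
    simp
  | of_succ k hk ih =>
    have hk' : k < n + 1 - 1 := hk
    constructor
    · rw [braidTau_eq hk, braidComponent_mul, ih.1, one_mul, braidComponent_braidGen hk, ih.2,
        braidLabel_succ]
    · rw [braidTau_eq hk, map_mul, mul_inv_rev, Equiv.Perm.mul_apply, braidPerm_braidGen hk',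
        strandSwap_inv, strandSwap_val, ih.2, natSwap_succ]

/-- Both sides of `A_j τ_{j+1} = τ_{j+1} σ_j²` have the same component at the last strand. Following
that strand through `σ_j²` meets the labels `1` and `x_j`. -/
theorem braidComponent_braidLoop {j : ℕ} (hj : j < n) (hp : braidPerm (n + 1) (braidLoop n j) = 1) :
    braidComponent n (braidLoop n j) (Fin.last n) = pushGen n j := by
  have hj' : j < n + 1 - 1 := hj
  have h1 : braidLoop n j * braidTau n (j + 1) =
      braidTau n (j + 1) * (braidGen (n + 1) j * braidGen (n + 1) j) := by
    rw [braidLoop, inv_mul_cancel_right]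
  have h2 := congrFun (congrArg (braidComponent n) h1) (Fin.last n)
  have h3 := braidComponent_braidTau (n := n) (j := j + 1) hj
  rw [braidComponent_mul, braidComponent_mul, braidComponent_mul, hp, inv_one, Equiv.Perm.one_apply,
    h3.1, mul_one, one_mul, braidComponent_braidGen hj, braidComponent_braidGen hj,
    braidPerm_braidGen hj', strandSwap_inv, strandSwap_val, h3.2, natSwap_succ, braidLabel_succ,
    braidLabel_self, one_mul] at h2
  exact h2

theorem braidComponent_pointPush (x : FreeGroup (Fin n)) :
    braidComponent n (pointPush n x) (Fin.last n) = SemidirectProduct.inl x := by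
  let f : FreeGroup (Fin n) →* ArtinSemidirect n :=
    MonoidHom.mk' (fun x => braidComponent n (pointPush n x) (Fin.last n)) fun x y => by
      rw [map_mul, braidComponent_mul, braidPerm_pointPush, inv_one, Equiv.Perm.one_apply]
  have h : f = SemidirectProduct.inl := by
    ext1 k
    have h1 := braidPerm_pointPush (FreeGroup.of k)
    change braidComponent n (pointPush n (FreeGroup.of k)) (Fin.last n) = _
    rw [pointPush, FreeGroup.lift_apply_of] at h1 ⊢
    rw [braidComponent_braidLoop k.2 h1, pushGen, freeGen, dif_pos k.2]
  exact DFunLike.congr_fun h x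

theorem braidComponent_braidInclusion (b : BraidGroup n) :
    braidComponent n (braidInclusion n b) (Fin.last n) = SemidirectProduct.inr b := by
  have hp : ∀ b : BraidGroup n,
      (braidPerm (n + 1) (braidInclusion n b))⁻¹ (Fin.last n) = Fin.last n := by
    intro b
    rw [← map_inv, ← map_inv]
    exact (braidPerm_braidInclusion b⁻¹).1
  let f : BraidGroup n →* ArtinSemidirect n :=
    MonoidHom.mk' (fun b => braidComponent n (braidInclusion n b) (Fin.last n)) fun b b' => by
      rw [map_mul, braidComponent_mul, hp]
  have h : f = SemidirectProduct.inr := by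
    apply PresentedGroup.ext
    intro k
    have hk : (k : ℕ) + 1 < n := by omega
    rw [of_eq_braidGen]
    change braidComponent n (braidInclusion n (braidGen n k)) (Fin.last n) = _
    rw [braidInclusion_braidGen hk, braidComponent_braidGen (by omega),
      braidLabel_of_lt (by simpa using hk), swapGen]
  exact DFunLike.congr_fun h b

/-- On braids fixing the last strand this component is multiplicative, so the claim reduces to the
two factors. It makes `artinToBraid` injective. -/
theorem braidComponent_artinToBraid (q : ArtinSemidirect n) :
    braidComponent n (artinToBraid n q) (Fin.last n) = q := by
  rw [artinToBraid_apply, braidComponent_mul, braidPerm_pointPush, inv_one, Equiv.Perm.one_apply,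
    braidComponent_pointPush, braidComponent_braidInclusion,
    SemidirectProduct.inl_left_mul_inr_right]

variable (n) in
/-- The action of the pure braid group on the free group. -/
def pureArtinAction : PureBraidGroup n →* MulAut (FreeGroup (Fin n)) :=
  (artinAction n).comp (braidPerm n).ker.subtype

variable (n) in
/-- The homomorphism `F_n ⋊ P_n → F_n ⋊ B_n`. -/
def pureToArtin : FreeGroup (Fin n) ⋊[pureArtinAction n] PureBraidGroup n →* ArtinSemidirect n :=
  SemidirectProduct.map (MonoidHom.id _) (braidPerm n).ker.subtype fun _ => rfl

theorem braidPerm_artinToBraid (q : ArtinSemidirect n) :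
    braidPerm (n + 1) (artinToBraid n q) = 1 ↔ braidPerm n q.right = 1 := by
  have h := braidPerm_braidInclusion q.right
  rw [artinToBraid_apply, map_mul, braidPerm_pointPush, one_mul]
  constructor
  · intro h1
    ext1 k
    have h2 := h.2 k
    rw [h1, Equiv.Perm.one_apply] at h2
    exact (Fin.castSucc_injective _ h2).symm
  · intro h1
    rw [h1] at h
    ext1 k
    refine Fin.lastCases h.1 (fun k => ?_) k
    rw [h.2]
    rfl

variable (n) in
/-- The isomorphism `F_n ⋊ P_n ≅ P_{n+1}`. -/
def pureBraidDecomposition :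
    FreeGroup (Fin n) ⋊[pureArtinAction n] PureBraidGroup n →* PureBraidGroup (n + 1) :=
  ((artinToBraid n).comp (pureToArtin n)).codRestrict _ fun q =>
    (braidPerm_artinToBraid _).mpr q.right.2

/-- Injectivity comes from the component at the last strand, which is a left inverse, and
surjectivity from `braidTau_mul` at that strand, where `τ_n = 1`. -/
theorem pureBraidDecomposition_bijective : Function.Bijective (pureBraidDecomposition n) := by
  constructor
  · intro q q' h
    have h1 : artinToBraid n (pureToArtin n q) = artinToBraid n (pureToArtin n q') :=
      congrArg Subtype.val h
    have h2 := congrArg (fun g => braidComponent n g (Fin.last n)) h1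
    simp only [braidComponent_artinToBraid] at h2
    have h3 : q.left = q'.left := congrArg (fun x : ArtinSemidirect n => x.left) h2
    have h4 : (q.right : BraidGroup n) = q'.right :=
      congrArg (fun x : ArtinSemidirect n => x.right) h2
    exact SemidirectProduct.ext h3 (Subtype.ext h4)
  · rintro ⟨g, hg⟩
    have hg' : braidPerm (n + 1) g = 1 := hg
    have h1 := braidTau_mul g (Fin.last n)
    rw [hg', inv_one, Equiv.Perm.one_apply, Fin.val_last, braidTau_self, one_mul, mul_one] at h1
    rw [h1, braidPerm_artinToBraid] at hg'
    refine ⟨⟨(braidComponent n g (Fin.last n)).left, ⟨_, hg'⟩⟩, Subtype.ext ?_⟩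
    exact h1.symm

theorem isPolGood_pureBraidGroup (n : ℕ) : IsPolGood (PureBraidGroup n) := by
  induction n with
  | zero =>
    have : Subsingleton (BraidGroup 0) := by
      refine ⟨fun a b => ?_⟩
      have h : ∀ g : BraidGroup 0, g ∈ (⊥ : Subgroup (BraidGroup 0)) := fun g =>
        braidGroup_eq_top (fun i hi => absurd hi (by omega)) g
      rw [(Subgroup.mem_bot).mp (h a), (Subgroup.mem_bot).mp (h b)]
    exact isPolGood_of_subsingleton
  | succ n ih =>
    let e := (MulEquiv.ofBijective _ (pureBraidDecomposition_bijective (n := n))).symm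
    exact isPolGood_of_bijective (π := e.toMonoidHom) e.bijective
      (isPolGood_semidirectProduct (φ := pureArtinAction n)
        (fun q x => artinAction_mul_inv_mem_commutator q.2 x) ih)

instance fg_pureBraidGroup (n : ℕ) : Group.FG (PureBraidGroup n) := by
  -- The pure braid group has finite index in a finitely generated group.
  have : Group.FG (BraidGroup n) := QuotientGroup.fg _
  have : (braidPerm n).ker.FiniteIndex := Subgroup.finiteIndex_ker _
  exact Subgroup.fg_of_index_ne_zero _

end PureBraid

end QGoodness

theorem mainTheorem11 (n : ℕ) :
    QGoodness.IsQGood (GrpCat.of (QGoodness.PureBraidGroup n)) ∧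
    QGoodness.IsQCompletion (QGoodness.malcevCone (QGoodness.PureBraidGroup n)) ∧
    QGoodness.IsRatCohomologyIso (QGoodness.malcevCone (QGoodness.PureBraidGroup n)) :=
  have h := QGoodness.isPolGood_pureBraidGroup n
  ⟨QGoodness.isQGood_of_isPolGood h, QGoodness.isQCompletion_malcevCone _,
    QGoodness.isRatCohomologyIso_malcevCone h⟩
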